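/- **Setting.** Let $\Sigma=\mathbb{Z}_{\ge 0}^{\mathbb{Z}}$ with the product $\sigma$-algebra and the coordinatewise order $\preccurlyeq$. For $\eta\in\Sigma$ and a finite set $I\subset\mathbb Z$ write $\eta(I)=\sum_{x\in I}\eta(x)$. For integers $a\le b$, $[a,b]$ denotes $\{a,\dots,b\}$, an interval of length $|[a,b]|=b-a+1$. The time set $T$ is $\mathbb{Z}_{\ge0}$ or $[0,\infty)$ (more generally, the positive cone of a linearly ordered commutative ring). A coupling of two probability measures is a probability measure on the product space with these marginals. An *environment* consists of a non-empty bounded open interval $J\subseteq[0,\infty)$, probability measures $(\mu_\rho)_{\rho\in J}$ on $\Sigma$, and probability measures $(\mathbf P^{\eta_0})_{\eta_0\in\Sigma}$ on $\Sigma^{T}$, measurable in $\eta_0$, with $\eta_{t=0}=\eta_0$ $\mathbf P^{\eta_0}$-a.s. Put $\mathbf P^\rho=\int\mu_\rho(d\eta_0)\,\mathbf P^{\eta_0}$. It is required that: 1. (Markov property and invariance) under every $\mathbf P^{\eta_0}$, for all $s\in T$ and $x\in\mathbb Z$, conditionally on $(\eta_u)_{u\le s}$ the process $(\eta_{s+t}(x+\cdot))_{t}$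 has law $\mathbf P^{\eta_s(x+\cdot)}$; each $\mu_\rho$ is invariant under translations of $\mathbb Z$; 2. (stationarity) for all $\rho\in J$ and $s\in T$, $(\eta_{s+t})_t$ has the same law as $(\eta_t)_t$ under $\mathbf P^\rho$; 3. (monotonicity) if $\eta_0'\preccurlyeq\eta_0$, there is a coupling of $\mathbf P^{\eta_0'}$ and $\mathbf P^{\eta_0}$ with $\eta'_t\preccurlyeq\eta_t$ a.s. for every $t\in T$; if $\rho'\le\rho$ in $J$, there is a coupling of $\mu_{\rho'}$ and $\mu_\rho$ which is a.s. supported on $\{\eta'\preccurlyeq\eta\}$; 4. (density) there is $c_1>0$ such that for all $\rho\in J$, $\varepsilon\in(0,1)$ and integers $\ell\ge1$, $\mu_\rho\big(|\eta([0,\ell-1])-\rho\ell|\ge\varepsilon\ell\big)\le 2\exp(-c_1\varepsilon^2\ell)$. Let $\nu>0$. Consider two further conditions (if $T$ is uncountable, $\mathbb Q$ of an event is understood as outer measure). * *(No particle drifting in from the side.)* For all integers $t,H\ge0$, $k\ge1$ and all $\eta_0,\eta_0'\in\Sigma$ with $\eta_0\succcurlyeq\eta_0'$ on $[-H,H]$,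 there is a coupling $\mathbb Q$ of $\eta\sim\mathbf P^{\eta_0}$ and $\eta'\sim\mathbf P^{\eta_0'}$ such that $$\mathbb Q\big(\forall s\in T,\ s\le t,\ \forall x\in\mathbb Z,\ |x|\le H-2\nu kt:\ \eta_s(x)\ge\eta'_s(x)\big)\ge1-20e^{-k\nu t/4}.$$ * *(Covering.)* There are $C,C'>0$ such that for all $\rho\in J$, $\varepsilon\in(0,1)$ with $\rho+\varepsilon\in J$, and all integers $H,t\ge1$ with $H>4\nu t$, $\nu^8t>1$ and $\nu t^{1/4}>C\varepsilon^{-2}(1+|\log^3(\nu t)|)$, the following holds with $\ell=\lfloor t^{1/4}\rfloor$. If $\eta_0,\eta'_0\in\Sigma$ satisfy $\eta_0(I)\ge(\rho+3\varepsilon/4)|I|$ and $\eta_0'(I)\le(\rho+\varepsilon/4)|I|$ for every interval $I\subseteq[-H,H]$ with $\lfloor\ell/2\rfloor\le|I|\le\ell$, there is a coupling $\mathbb Q$ of $\eta\sim\mathbf P^{\eta_0}$ and $\eta'\sim\mathbf P^{\eta_0'}$ such that $$\mathbb Q\big(\forall x\in\mathbb Z,\ |x|\le H-4\nu t:\ \eta_t(x)\ge\eta'_t(x)\big)\ge1-C'tH\exp\big(-(C'(1+\nu^{-1}))^{-1}\varepsilon^2t^{1/4}\big).$$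 *The walk.* Let $0\le p_\circ<p_\bullet\le1$. Given $\eta$ and i.i.d. uniform variables $(U_n)_{n\ge0}$ on $[0,1]$ independent of $\eta$, let $X_0=0$ and $$X_{n+1}=X_n+2\cdot\mathbf 1\{U_n\le(p_\circ-p_\bullet)\mathbf 1\{\eta_n(X_n)=0\}+p_\bullet\}-1 .$$ $\mathbb P^\rho$ denotes the (annealed) law when $\eta\sim\mathbf P^\rho$, with expectation $\mathbb E^\rho$. For $\rho\in J$, $L\ge1$ let $v(\rho,L)=\mathbb E^\rho[X_L/L]$; let $\bar J$ be the set of $\rho\in J$ for which $v(\rho)=\lim_{L\to\infty}v(\rho,L)$ exists; and let $$v^-(\rho)=\lim_{\rho'\uparrow\rho,\ \rho'\in\bar J,\ \rho'<\rho}v(\rho'),\qquad v^+(\rho)=\lim_{\rho'\downarrow\rho,\ \rho'\in\bar J,\ \rho'>\rho}v(\rho').$$ **Corollary 4.3.** Consider an environment which satisfies the two further conditions above for some $\nu>0$, and let $\rho\in J$. Then $\rho$ is an accumulation point of $\bar J$ from both sides, the limits $v^-(\rho)$ and $v^+(\rho)$ exist, and: * for every $v_\star\in(0,v^-(\rho))$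 there is $c>0$ such that for all sufficiently large $K\in\mathbb N$, $$\mathbb P^\rho\big(\exists n\in\mathbb N:\ X_n<nv_\star-K\big)\le2\exp\big(-cK^{1/1000}\big);$$ * for every $v_\star\in(v^+(\rho),1)$ there is $c>0$ such that for all sufficiently large $K\in\mathbb N$, $$\mathbb P^\rho\big(\exists n\in\mathbb N:\ X_n>nv_\star+K\big)\le2\exp\big(-cK^{1/1000}\big).$$ -/

import Mathlib

open MeasureTheory ProbabilityTheory Filter Topology Set

namespace RWDRE

noncomputable section

/-- Particle configurations: `η x` is the number of particles at the site `x`. They carry the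
product σ-algebra and the pointwise order. -/
abbrev Config : Type := ℤ → ℕ

/-- Trajectories of the environment, indexed by a time set `T` (`ℕ` for discrete time, `ℝ≥0` for
continuous time), with the product σ-algebra. -/
abbrev EnvPath (T : Type) : Type := T → Config

/-- `η(x + ·)`. -/
def translate (x : ℤ) (η : Config) : Config := fun y => η (x + y)

/-- `(η_{s+t}(x + ·))_{t ≥ 0}`. -/
def shift {T : Type} [Add T] (s : T) (x : ℤ) (η : EnvPath T) : EnvPath T :=
  fun t => translate x (η (s + t))

/-- The σ-algebra generated by `η_u`, `u ≤ s`. -/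
@[reducible]
def past {T : Type} [LE T] (s : T) : MeasurableSpace (EnvPath T) :=
  ⨆ u : {u : T // u ≤ s}, MeasurableSpace.comap (fun η : EnvPath T => η u) inferInstance

/-- `η([a, b])`, the number of particles in the integer interval `[a, b]`. -/
def count (η : Config) (a b : ℤ) : ℕ := ∑ x ∈ Finset.Icc a b, η x

/-- `Q` is a coupling of `m₁` and `m₂`. -/
def IsCoupling {A B : Type} [MeasurableSpace A] [MeasurableSpace B]
    (Q : Measure (A × B)) (m₁ : Measure A) (m₂ : Measure B) : Prop :=
  Q.map Prod.fst = m₁ ∧ Q.map Prod.snd = m₂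

/-- A dynamic random environment over the time set `T`, for densities in the bounded open interval
`(lo, hi)`: the initial laws `μ ρ`, and the laws `P η₀` of the environment started from `η₀`. -/
structure Environment (T : Type) [CommSemiring T] [LinearOrder T] where
  lo : ℝ
  hi : ℝ
  lo_nonneg : 0 ≤ lo
  lo_lt_hi : lo < hi
  μ : ℝ → Measure Config
  P : Kernel Config (EnvPath T)
  isProbabilityMeasure_μ : ∀ ρ ∈ Ioo lo hi, IsProbabilityMeasure (μ ρ)
  isMarkovKernel_P : IsMarkovKernel P
  /-- under `P η₀` the environment starts from `η₀` -/
  start : ∀ η₀ : Config, ∀ᵐ η ∂(P η₀), η 0 = η₀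
  /-- Markov property, time homogeneity and translation invariance of the dynamics: given the past
  up to time `s`, the process `(η_{s+t}(x + ·))_t` has law `P (η_s(x + ·))` -/
  markov : ∀ (η₀ : Config) (s : T) (x : ℤ) (A B : Set (EnvPath T)),
    MeasurableSet[past s] A → MeasurableSet B →
    P η₀ (A ∩ shift s x ⁻¹' B) = ∫⁻ η in A, P (translate x (η s)) B ∂(P η₀)
  /-- translation invariance of the initial laws -/
  map_translate_μ : ∀ ρ ∈ Ioo lo hi, ∀ x : ℤ, (μ ρ).map (translate x) = μ ρ
  /-- stationarity -/
  stationary : ∀ ρ ∈ Ioo lo hi, ∀ s : T,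
    ((μ ρ).bind P).map (shift s 0) = (μ ρ).bind P
  /-- quenched monotonicity -/
  monotone_quenched : ∀ η₀' η₀ : Config, η₀' ≤ η₀ →
    ∃ Q : Measure (EnvPath T × EnvPath T), IsCoupling Q (P η₀') (P η₀) ∧
      ∀ t : T, ∀ᵐ ω ∂Q, ω.1 t ≤ ω.2 t
  /-- annealed monotonicity -/
  monotone_annealed : ∀ ρ' ∈ Ioo lo hi, ∀ ρ ∈ Ioo lo hi, ρ' ≤ ρ →
    ∃ Q : Measure (Config × Config), IsCoupling Q (μ ρ') (μ ρ) ∧ ∀ᵐ ω ∂Q, ω.1 ≤ ω.2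
  /-- density at stationarity -/
  density : ∃ c : ℝ, 0 < c ∧ ∀ ρ ∈ Ioo lo hi, ∀ ε ∈ Ioo (0 : ℝ) 1, ∀ ℓ : ℕ, 1 ≤ ℓ →
    (μ ρ).real {η | ε * ℓ ≤ |(count η 0 ((ℓ : ℤ) - 1) : ℝ) - ρ * ℓ|}
      ≤ 2 * Real.exp (-c * ε ^ 2 * ℓ)

namespace Environment

variable {T : Type} [CommSemiring T] [LinearOrder T] (E : Environment T)

/-- The interval of densities. -/
def J : Set ℝ := Ioo E.lo E.hi

/-- No particle drifting in from the side, for an environment of activity rate `ν`: domination on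
`[-H, H]` at time `0` persists up to time `t` on `[-H + 2νkt, H - 2νkt]`. -/
def NoDriftingIn (ν : ℝ) : Prop :=
  ∀ (t H k : ℕ), 1 ≤ k → ∀ η₀ η₀' : Config,
    (∀ x : ℤ, |x| ≤ (H : ℤ) → η₀' x ≤ η₀ x) →
    ∃ Q : Measure (EnvPath T × EnvPath T), IsCoupling Q (E.P η₀) (E.P η₀') ∧
      1 - 20 * Real.exp (-(k * ν * t / 4)) ≤
        Q.real {ω | ∀ s : T, s ≤ (t : T) → ∀ x : ℤ, |(x : ℝ)| ≤ H - 2 * ν * k * t →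
          ω.2 s x ≤ ω.1 s x}

/-- Covering of `η'` by `η`, for an environment of activity rate `ν`: if `η₀` has a slightly larger
empirical density than `η₀'` on `[-H, H]`, on all intervals of length between `⌊ℓ/2⌋` and `ℓ` with
`ℓ = ⌊t^{1/4}⌋`, then `η_t` can be made to dominate `η'_t` on `[-H + 4νt, H - 4νt]`. -/
def Covering (ν : ℝ) : Prop :=
  ∃ C C' : ℝ, 0 < C ∧ 0 < C' ∧ ∀ ρ ∈ E.J, ∀ ε ∈ Ioo (0 : ℝ) 1, ρ + ε ∈ E.J →
    ∀ H t : ℕ, 1 ≤ H → 1 ≤ t → 4 * ν * t < H → 1 < ν ^ 8 * t →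
      C * (ε ^ 2)⁻¹ * (1 + |Real.log (ν * t) ^ 3|) < ν * (t : ℝ) ^ (1 / 4 : ℝ) →
    ∀ η₀ η₀' : Config,
      (∀ a b : ℤ, -(H : ℤ) ≤ a → a ≤ b → b ≤ H →
        ⌊(t : ℝ) ^ (1 / 4 : ℝ)⌋ / 2 ≤ b - a + 1 → b - a + 1 ≤ ⌊(t : ℝ) ^ (1 / 4 : ℝ)⌋ →
          (ρ + 3 * ε / 4) * ((b - a + 1 : ℤ) : ℝ) ≤ count η₀ a b ∧
          (count η₀' a b : ℝ) ≤ (ρ + ε / 4) * ((b - a + 1 : ℤ) : ℝ)) →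
      ∃ Q : Measure (EnvPath T × EnvPath T), IsCoupling Q (E.P η₀) (E.P η₀') ∧
        1 - C' * t * H * Real.exp (-((C' * (1 + ν⁻¹))⁻¹ * ε ^ 2 * (t : ℝ) ^ (1 / 4 : ℝ))) ≤
          Q.real {ω | ∀ x : ℤ, |(x : ℝ)| ≤ H - 4 * ν * t →
            ω.2 (t : T) x ≤ ω.1 (t : T) x}

end Environment

/-- The random walk on the environment `η`, started from the origin at time `0` and driven by the
variables `u 0, u 1, …`: it jumps to the right when `u n ≤ p₁` if its site is occupied, and when
`u n ≤ p₀` if its site is empty; it jumps to the left otherwise. -/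
def walk {T : Type} [CommSemiring T] (p₀ p₁ : ℝ) (η : EnvPath T) (u : ℕ → ℝ) : ℕ → ℤ
  | 0 => 0
  | n + 1 => walk p₀ p₁ η u n +
      2 * (if u n ≤ (p₀ - p₁) * (if η (n : T) (walk p₀ p₁ η u n) = 0 then 1 else 0) + p₁
        then 1 else 0) - 1

/-- The law of a sequence of i.i.d. uniform variables on `[0, 1]`. -/
def uniforms : Measure (ℕ → ℝ) :=
  Measure.infinitePi (fun _ : ℕ => (volume.restrict (Icc (0 : ℝ) 1) : Measure ℝ))

namespace Environment

variable {T : Type} [CommSemiring T] [LinearOrder T] (E : Environment T)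

/-- The annealed law at density `ρ`, as the joint law of the environment started from `μ ρ` and of
the independent uniform variables which drive the walk. -/
def annealed (ρ : ℝ) : Measure (EnvPath T × (ℕ → ℝ)) :=
  ((E.μ ρ).bind E.P).prod uniforms

/-- `v(ρ, L)`, the expectation of `X_L / L` at density `ρ`. -/
def meanSpeed (p₀ p₁ ρ : ℝ) (L : ℕ) : ℝ :=
  ∫ ω, (walk p₀ p₁ ω.1 ω.2 L : ℝ) / L ∂(E.annealed ρ)

/-- The densities `ρ` in `J` for which `v(ρ) = lim_L v(ρ, L)` exists. -/
def regularDensities (p₀ p₁ : ℝ) : Set ℝ :=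
  {ρ | ρ ∈ E.J ∧ ∃ v : ℝ, Tendsto (E.meanSpeed p₀ p₁ ρ) atTop (𝓝 v)}

/-- `v(ρ) = lim_L v(ρ, L)`; only used at densities for which the limit exists. -/
def speed (p₀ p₁ ρ : ℝ) : ℝ := limUnder atTop (E.meanSpeed p₀ p₁ ρ)

/-- `v` is the limit of `v(ρ')` as `ρ'` increases strictly to `ρ` through densities at which it
is defined, and there are such densities arbitrarily close to `ρ`. -/
def IsLowerSpeed (p₀ p₁ ρ v : ℝ) : Prop :=
  (𝓝[E.regularDensities p₀ p₁ ∩ Iio ρ] ρ).NeBot ∧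
    Tendsto (E.speed p₀ p₁) (𝓝[E.regularDensities p₀ p₁ ∩ Iio ρ] ρ) (𝓝 v)

/-- `v` is the limit of `v(ρ')` as `ρ'` decreases strictly to `ρ` through densities at which it
is defined, and there are such densities arbitrarily close to `ρ`. -/
def IsUpperSpeed (p₀ p₁ ρ v : ℝ) : Prop :=
  (𝓝[E.regularDensities p₀ p₁ ∩ Ioi ρ] ρ).NeBot ∧
    Tendsto (E.speed p₀ p₁) (𝓝[E.regularDensities p₀ p₁ ∩ Ioi ρ] ρ) (𝓝 v)

end Environment

end

end RWDRE

/-! Both deviation bounds come from one mechanism: a walk at density `ρ` can have its environment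
refreshed, at the price of a small change of density. At any time `n`, stationarity makes the
configuration typical of `ρ` on a large window, up to a small probability. Draw an independent
configuration of density `ρ + ε`. By the covering condition it can be made to dominate the true one
after a time `√L`, and by the condition on side particles the domination then lasts for another time
`L`. The walk moves by at most `√L` meanwhile, and more particles push it to the right. Hence its
increment over `√L + L` is stochastically at most `√L` plus an independent copy of `X_L` at density
`ρ + ε`, up to an error of order `n * exp (-L ^ (1/20))`, provided `ε ≥ L ^ (-1/100)`. This is
`Refreshes`, proved in `exists_refreshes` through `integral_walkLaw_add_le` and
`integral_walkLaw_le_of_covers`. Reflecting space gives the bound from the other side, with the two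
densities exchanged.

Applied to the identity function and iterated over scales, refreshment bounds the mean speed at `ρ`
and a large time by the mean speed at `ρ + ε` and a smaller time (`exists_meanSpeed_le`). So the
limsup of the speeds at one density is at most their liminf at any slightly larger one
(`speedsOrdered`). The liminf is then locally monotone in the density, and the speed exists wherever
it is continuous, hence on a dense set. This yields the one-sided limits.

Applied to exponential functions, refreshment makes exponential moments almost multiplicative over
blocks. If `v` exceeds the limit speed from above, some regular `ρ' > ρ` still has speed below `v`.
The centred exponential moment of one block at `ρ'` is then below `1`, and a Chernoff bound over
many blocks controls `X_N ≥ v N` (`exists_measureReal_ge_le`). Summing over `N` gives the bound for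
all times at once (`exists_measureReal_exists_le`). -/

namespace RWDRE

noncomputable section

section Quenched

/-! ### The quenched semigroup of the walk -/

/-- The probability of a jump to the right from a site with `m` particles. -/
def jumpProb (p₀ p₁ : ℝ) (m : ℕ) : ℝ := if m = 0 then p₀ else p₁

/-- The one-step transition operator of the walk in the configuration `ζ`. -/
def jump (p₀ p₁ : ℝ) (ζ : Config) (Φ : ℤ → ℝ) (x : ℤ) : ℝ :=
  jumpProb p₀ p₁ (ζ x) * Φ (x + 1) + (1 - jumpProb p₀ p₁ (ζ x)) * Φ (x - 1)

/-- `quenched p₀ p₁ η n Φ x` is the expectation of `Φ (X n)` for the walk started from `x` in the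
fixed environment `η`. -/
def quenched {T : Type} [CommSemiring T] (p₀ p₁ : ℝ) (η : EnvPath T) :
    ℕ → (ℤ → ℝ) → ℤ → ℝ
  | 0, Φ => Φ
  -- The last jump, made at time `n`, is integrated out first. Inductions on `n` therefore
  -- generalise over the test function and keep the starting point.
  | n + 1, Φ => quenched p₀ p₁ η n (jump p₀ p₁ (η n) Φ)

variable {T : Type} [CommSemiring T] {p₀ p₁ : ℝ}

lemma jumpProb_nonneg (hp₀ : 0 ≤ p₀) (hp : p₀ ≤ p₁) (m : ℕ) : 0 ≤ jumpProb p₀ p₁ m := by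
  unfold jumpProb; split_ifs <;> linarith

lemma jumpProb_le_one (hp : p₀ ≤ p₁) (hp₁ : p₁ ≤ 1) (m : ℕ) : jumpProb p₀ p₁ m ≤ 1 := by
  unfold jumpProb; split_ifs <;> linarith

lemma jumpProb_mono (hp : p₀ ≤ p₁) {m m' : ℕ} (h : m ≤ m') :
    jumpProb p₀ p₁ m ≤ jumpProb p₀ p₁ m' := by
  unfold jumpProb; split_ifs <;> first | linarith | omega

lemma jump_const (ζ : Config) (c : ℝ) : jump p₀ p₁ ζ (fun _ => c) = fun _ => c := by
  funext x; simp only [jump]; ring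

lemma quenched_const (η : EnvPath T) (n : ℕ) (c : ℝ) :
    quenched p₀ p₁ η n (fun _ => c) = fun _ => c := by
  induction n with
  | zero => rfl
  | succ n ih => rw [quenched, jump_const, ih]

lemma quenched_sub (η : EnvPath T) (n : ℕ) (Φ Ψ : ℤ → ℝ) :
    quenched p₀ p₁ η n (fun x => Φ x - Ψ x)
      = fun x => quenched p₀ p₁ η n Φ x - quenched p₀ p₁ η n Ψ x := by
  induction n generalizing Φ Ψ with
  | zero => rfl
  | succ n ih =>
    simp only [quenched]
    rw [← ih]
    congr 1
    funext x; simp only [jump]; ring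

lemma quenched_sum {ι : Type*} (s : Finset ι) (η : EnvPath T) (n : ℕ) (c : ι → ℝ)
    (Φ : ι → ℤ → ℝ) :
    quenched p₀ p₁ η n (fun x => ∑ i ∈ s, c i * Φ i x)
      = fun x => ∑ i ∈ s, c i * quenched p₀ p₁ η n (Φ i) x := by
  induction n generalizing Φ with
  | zero => rfl
  | succ n ih =>
    simp only [quenched]
    rw [← ih]
    congr 1
    funext x
    simp only [jump, Finset.mul_sum, ← Finset.sum_add_distrib]
    exact Finset.sum_congr rfl fun i _ => by ring

lemma quenched_congr (η : EnvPath T) (n : ℕ) {Φ Ψ : ℤ → ℝ} {x : ℤ}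
    (h : ∀ y, |y - x| ≤ n → Φ y = Ψ y) :
    quenched p₀ p₁ η n Φ x = quenched p₀ p₁ η n Ψ x := by
  induction n generalizing Φ Ψ with
  | zero => exact h x (by simp)
  | succ n ih =>
    refine ih fun y hy => ?_
    rw [abs_le] at hy
    simp only [jump]
    rw [h (y + 1) (by rw [abs_le]; push_cast; omega), h (y - 1) (by rw [abs_le]; push_cast; omega)]

lemma quenched_mono (hp₀ : 0 ≤ p₀) (hp : p₀ ≤ p₁) (hp₁ : p₁ ≤ 1) (η : EnvPath T) (n : ℕ)
    {Φ Ψ : ℤ → ℝ} {x : ℤ} (h : ∀ y, |y - x| ≤ n → Φ y ≤ Ψ y) :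
    quenched p₀ p₁ η n Φ x ≤ quenched p₀ p₁ η n Ψ x := by
  induction n generalizing Φ Ψ with
  | zero => exact h x (by simp)
  | succ n ih =>
    refine ih fun y hy => ?_
    rw [abs_le] at hy
    have h1 := h (y + 1) (by rw [abs_le]; push_cast; omega)
    have h2 := h (y - 1) (by rw [abs_le]; push_cast; omega)
    have h3 := jumpProb_nonneg hp₀ hp (η n y)
    have h4 := jumpProb_le_one hp hp₁ (η n y)
    simp only [jump]
    have := mul_le_mul_of_nonneg_left h1 h3
    have := mul_le_mul_of_nonneg_left h2 (sub_nonneg.2 h4)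
    linarith

lemma quenched_nonneg (hp₀ : 0 ≤ p₀) (hp : p₀ ≤ p₁) (hp₁ : p₁ ≤ 1) (η : EnvPath T) (n : ℕ)
    {Φ : ℤ → ℝ} (h : ∀ y, 0 ≤ Φ y) (x : ℤ) : 0 ≤ quenched p₀ p₁ η n Φ x := by
  have := quenched_mono hp₀ hp hp₁ η n (x := x) (Φ := fun _ => 0) (Ψ := Φ) fun y _ => h y
  rwa [quenched_const] at this

lemma quenched_le (hp₀ : 0 ≤ p₀) (hp : p₀ ≤ p₁) (hp₁ : p₁ ≤ 1) (η : EnvPath T) (n : ℕ)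
    {Φ : ℤ → ℝ} {M : ℝ} (h : ∀ y, Φ y ≤ M) (x : ℤ) : quenched p₀ p₁ η n Φ x ≤ M := by
  have := quenched_mono hp₀ hp hp₁ η n (x := x) (Φ := Φ) (Ψ := fun _ => M) fun y _ => h y
  rwa [quenched_const] at this

/-- Functions which are nondecreasing on each of the two parity classes. -/
def ParityMono (Φ : ℤ → ℝ) : Prop := ∀ x, Φ x ≤ Φ (x + 2)

lemma _root_.Monotone.parityMono {Φ : ℤ → ℝ} (h : Monotone Φ) : ParityMono Φ :=
  fun x => h (by omega)

lemma jump_le_of_parityMono (hp : p₀ ≤ p₁) (hp₁ : p₁ ≤ 1) (ζ : Config) {Φ : ℤ → ℝ}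
    (hΦ : ParityMono Φ) (x : ℤ) : jump p₀ p₁ ζ Φ x ≤ Φ (x + 1) := by
  have h := hΦ (x - 1)
  rw [show x - 1 + 2 = x + 1 by ring] at h
  have := mul_le_mul_of_nonneg_left h (sub_nonneg.2 (jumpProb_le_one hp hp₁ (ζ x)))
  simp only [jump]; linarith

lemma le_jump_of_parityMono (hp₀ : 0 ≤ p₀) (hp : p₀ ≤ p₁) (ζ : Config) {Φ : ℤ → ℝ}
    (hΦ : ParityMono Φ) (x : ℤ) : Φ (x - 1) ≤ jump p₀ p₁ ζ Φ x := by
  have h := hΦ (x - 1)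
  rw [show x - 1 + 2 = x + 1 by ring] at h
  have := mul_le_mul_of_nonneg_left h (jumpProb_nonneg hp₀ hp (ζ x))
  simp only [jump]; linarith

/-- Plain monotonicity is not preserved, since walkers at `x` and `x + 1` can exchange their order
in one step. Walkers at `x` and `x + 2` cannot: the value at `x + 1` separates the two averages. -/
lemma ParityMono.jump (hp₀ : 0 ≤ p₀) (hp : p₀ ≤ p₁) (hp₁ : p₁ ≤ 1) (ζ : Config) {Φ : ℤ → ℝ}
    (hΦ : ParityMono Φ) : ParityMono (jump p₀ p₁ ζ Φ) := fun x => by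
  have h1 := jump_le_of_parityMono hp hp₁ ζ hΦ x
  have h2 := le_jump_of_parityMono hp₀ hp ζ hΦ (x + 2)
  rw [show x + 2 - 1 = x + 1 by ring] at h2
  exact h1.trans h2

/-- All reachable sites have the parity of `x + n` and lie to its left. This pays for the
refreshment time, during which nothing else is known about the walk. -/
lemma quenched_le_add (hp₀ : 0 ≤ p₀) (hp : p₀ ≤ p₁) (hp₁ : p₁ ≤ 1) (η : EnvPath T) (n : ℕ)
    {Φ : ℤ → ℝ} (hΦ : ParityMono Φ) (x : ℤ) : quenched p₀ p₁ η n Φ x ≤ Φ (x + n) := by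
  induction n generalizing Φ with
  | zero => simp [quenched]
  | succ n ih =>
    refine (ih (hΦ.jump hp₀ hp hp₁ _)).trans ((jump_le_of_parityMono hp hp₁ _ hΦ _).trans_eq ?_)
    push_cast; ring_nf

lemma le_quenched_sub (hp₀ : 0 ≤ p₀) (hp : p₀ ≤ p₁) (hp₁ : p₁ ≤ 1) (η : EnvPath T) (n : ℕ)
    {Φ : ℤ → ℝ} (hΦ : ParityMono Φ) (x : ℤ) : Φ (x - n) ≤ quenched p₀ p₁ η n Φ x := by
  induction n generalizing Φ with
  | zero => simp [quenched]
  | succ n ih =>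
    refine le_trans (le_of_eq_of_le ?_ (le_jump_of_parityMono hp₀ hp _ hΦ _))
      (ih (hΦ.jump hp₀ hp hp₁ _))
    push_cast; ring_nf

lemma ParityMono.quenched (hp₀ : 0 ≤ p₀) (hp : p₀ ≤ p₁) (hp₁ : p₁ ≤ 1) (η : EnvPath T) (n : ℕ)
    {Φ : ℤ → ℝ} (hΦ : ParityMono Φ) : ParityMono (quenched p₀ p₁ η n Φ) := by
  induction n generalizing Φ with
  | zero => exact hΦ
  | succ n ih => exact ih (hΦ.jump hp₀ hp hp₁ _)

/-- Extra particles only raise the probability of a jump to the right, which helps a parity-monotone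
function. The environments are exchanged one time level at a time, and only inside the cone
reachable from `x`, so a domination valid on a finite window is enough. -/
lemma quenched_mono_env (hp₀ : 0 ≤ p₀) (hp : p₀ ≤ p₁) (hp₁ : p₁ ≤ 1) {η η' : EnvPath T} (n : ℕ)
    {Φ : ℤ → ℝ} (hΦ : ParityMono Φ) {x : ℤ}
    (h : ∀ j : ℕ, j < n → ∀ y, |y - x| ≤ n → η j y ≤ η' j y) :
    quenched p₀ p₁ η n Φ x ≤ quenched p₀ p₁ η' n Φ x := by
  induction n generalizing Φ with
  | zero => exact le_rfl
  | succ n ih =>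
    refine le_trans ?_ (ih (hΦ.jump hp₀ hp hp₁ _) fun j hj y hy => h j (by omega) y ?_)
    · refine quenched_mono hp₀ hp hp₁ η n fun y hy => ?_
      have h1 := jumpProb_mono hp (h n (by omega) y (by push_cast; omega))
      have h2 := hΦ (y - 1)
      rw [show y - 1 + 2 = y + 1 by ring] at h2
      have := mul_le_mul_of_nonneg_right h1 (sub_nonneg.2 h2)
      simp only [RWDRE.jump]; linarith
    · push_cast; omega

lemma quenched_add (η : EnvPath T) (n m : ℕ) (Φ : ℤ → ℝ) :
    quenched p₀ p₁ η (n + m) Φ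
      = quenched p₀ p₁ η n (quenched p₀ p₁ (shift (n : T) 0 η) m Φ) := by
  induction m generalizing Φ with
  | zero => rfl
  | succ m ih =>
    rw [← add_assoc, quenched, ih, quenched]
    congr 3
    funext y
    simp [shift, translate]

lemma quenched_shift_zero (η : EnvPath T) (n : ℕ) (Φ : ℤ → ℝ) (x y : ℤ) :
    quenched p₀ p₁ (shift 0 x η) n (fun z => Φ (x + z)) y = quenched p₀ p₁ η n Φ (x + y) := by
  induction n generalizing Φ with
  | zero => rfl
  | succ n ih =>
    rw [quenched, quenched, ← ih]
    congr 1
    funext z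
    simp only [jump, shift, translate, zero_add]
    ring_nf

/-- The quenched probability that the walk started from the origin is at `x` at time `n`. -/
def weight (p₀ p₁ : ℝ) (η : EnvPath T) (n : ℕ) (x : ℤ) : ℝ :=
  quenched p₀ p₁ η n (fun y => if y = x then 1 else 0) 0

lemma weight_nonneg (hp₀ : 0 ≤ p₀) (hp : p₀ ≤ p₁) (hp₁ : p₁ ≤ 1) (η : EnvPath T) (n : ℕ) (x : ℤ) :
    0 ≤ weight p₀ p₁ η n x :=
  quenched_nonneg hp₀ hp hp₁ η n (fun y => by split_ifs <;> norm_num) 0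

lemma weight_le_one (hp₀ : 0 ≤ p₀) (hp : p₀ ≤ p₁) (hp₁ : p₁ ≤ 1) (η : EnvPath T) (n : ℕ) (x : ℤ) :
    weight p₀ p₁ η n x ≤ 1 :=
  quenched_le hp₀ hp hp₁ η n (fun y => by split_ifs <;> norm_num) 0

lemma quenched_eq_sum (η : EnvPath T) (n : ℕ) (Φ : ℤ → ℝ) :
    quenched p₀ p₁ η n Φ 0 = ∑ x ∈ Finset.Icc (-(n : ℤ)) n, weight p₀ p₁ η n x * Φ x := by
  have h := congrFun (quenched_sum (p₀ := p₀) (p₁ := p₁) (Finset.Icc (-(n : ℤ)) n) η n Φ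
    (fun x y => if y = x then 1 else 0)) 0
  simp only [weight]
  simp_rw [mul_comm _ (Φ _)]
  rw [← h]
  refine quenched_congr η n fun y hy => ?_
  rw [sub_zero, abs_le] at hy
  simp [hy.1, hy.2]

lemma sum_weight (η : EnvPath T) (n : ℕ) :
    ∑ x ∈ Finset.Icc (-(n : ℤ)) n, weight p₀ p₁ η n x = 1 := by
  have h := quenched_eq_sum (p₀ := p₀) (p₁ := p₁) η n (fun _ => 1)
  simpa [quenched_const] using h.symm

/-! ### Measurability -/

lemma measurable_eval_rand {α : Type*} [MeasurableSpace α] {f : α → Config} {g : α → ℤ}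
    (hf : Measurable f) (hg : Measurable g) : Measurable fun a => f a (g a) := by
  have : Measurable fun p : Config × ℤ => p.1 p.2 :=
    measurable_from_prod_countable_left fun x => measurable_pi_apply x
  exact this.comp (hf.prodMk hg)

lemma measurable_translate (x : ℤ) : Measurable (translate x) :=
  measurable_pi_lambda _ fun _ => measurable_pi_apply _

lemma measurable_shift (s : T) (x : ℤ) : Measurable (shift s x : EnvPath T → EnvPath T) :=
  measurable_pi_lambda _ fun _ => (measurable_translate x).comp (measurable_pi_apply _)

lemma measurable_count (a b : ℤ) : Measurable fun ζ : Config => count ζ a b :=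
  Finset.measurable_sum _ fun x _ => measurable_pi_apply x

lemma measurable_jumpProb : Measurable (jumpProb p₀ p₁) := measurable_from_nat

lemma measurable_jump {α : Type*} [MeasurableSpace α] {f : α → Config} (hf : Measurable f)
    {Φ : α → ℤ → ℝ} (hΦ : ∀ x, Measurable fun a => Φ a x) (x : ℤ) :
    Measurable fun a => jump p₀ p₁ (f a) (Φ a) x := by
  have h : Measurable fun a => jumpProb p₀ p₁ (f a x) :=
    measurable_jumpProb.comp ((measurable_pi_apply x).comp hf)
  exact (h.mul (hΦ _)).add ((measurable_const.sub h).mul (hΦ _))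

lemma measurable_quenched' {α : Type*} [MeasurableSpace α] {f : α → EnvPath T} {n : ℕ}
    (hf : ∀ j : ℕ, j < n → Measurable fun a => f a j)
    {Φ : α → ℤ → ℝ} (hΦ : ∀ x, Measurable fun a => Φ a x) (x : ℤ) :
    Measurable fun a => quenched p₀ p₁ (f a) n (Φ a) x := by
  induction n generalizing Φ with
  | zero => exact hΦ x
  | succ n ih =>
    exact ih (fun j hj => hf j (by omega)) fun y => measurable_jump (hf n (by omega)) hΦ y

lemma measurable_quenched (n : ℕ) (Φ : ℤ → ℝ) (x : ℤ) :
    Measurable fun η : EnvPath T => quenched p₀ p₁ η n Φ x :=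
  measurable_quenched' (f := fun η : EnvPath T => η) (Φ := fun _ => Φ)
    (fun _ _ => measurable_pi_apply _) (fun _ => measurable_const) x

lemma measurable_eval_past {S : Type} [LE S] {u s : S} (h : u ≤ s) :
    Measurable[past s] fun η : EnvPath S => η u := by
  intro A hA
  exact le_iSup (fun u : {u : S // u ≤ s} =>
    MeasurableSpace.comap (fun η : EnvPath S => η u) inferInstance) ⟨u, h⟩ _ ⟨A, hA, rfl⟩

lemma past_le {S : Type} [LE S] (s : S) :
    past s ≤ (inferInstance : MeasurableSpace (EnvPath S)) :=
  iSup_le fun u => (measurable_pi_apply (u : S)).comap_le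

/-- The position at time `n` reads the environment only before time `n`. Splitting over the
deterministic sites `x` then lets the Markov property of the environment be used at time `n`,
although the position of the walk is random. -/
lemma measurable_weight_past [LinearOrder T] [IsStrictOrderedRing T] (n : ℕ) (x : ℤ) :
    Measurable[past (n : T)] fun η : EnvPath T => weight p₀ p₁ η n x :=
  @measurable_quenched' T _ p₀ p₁ _ (past (n : T)) (fun η : EnvPath T => η) n
    (fun _ hj => measurable_eval_past (Nat.cast_le.2 hj.le))
    (fun _ y => if y = x then 1 else 0) (fun _ => measurable_const) 0

end Quenched

/-! ### The walk driven by uniform variables, and its quenched law -/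

section Walk

variable {T : Type} [CommSemiring T] {p₀ p₁ : ℝ}

instance isProbabilityMeasure_unit :
    IsProbabilityMeasure (volume.restrict (Icc (0 : ℝ) 1)) := ⟨by simp⟩

instance isProbabilityMeasure_uniforms : IsProbabilityMeasure uniforms := by
  unfold uniforms; infer_instance

lemma walk_succ (η : EnvPath T) (u : ℕ → ℝ) (n : ℕ) :
    walk p₀ p₁ η u (n + 1) = if u n ≤ jumpProb p₀ p₁ (η (n : T) (walk p₀ p₁ η u n))
      then walk p₀ p₁ η u n + 1 else walk p₀ p₁ η u n - 1 := by
  rw [walk, jumpProb]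
  by_cases h : η (n : T) (walk p₀ p₁ η u n) = 0
  · simp only [h, if_true, mul_one, sub_add_cancel]
    split_ifs <;> ring
  · simp only [h, if_false, mul_zero, zero_add]
    split_ifs <;> ring

lemma walk_congr (η : EnvPath T) {u u' : ℕ → ℝ} {n : ℕ} (h : ∀ i < n, u i = u' i) :
    walk p₀ p₁ η u n = walk p₀ p₁ η u' n := by
  induction n with
  | zero => rfl
  | succ n ih => rw [walk_succ, walk_succ, ih fun i hi => h i (by omega), h n (by omega)]

lemma abs_walk_le (η : EnvPath T) (u : ℕ → ℝ) (n : ℕ) : |walk p₀ p₁ η u n| ≤ n := by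
  induction n with
  | zero => simp [walk]
  | succ n ih =>
    rw [abs_le] at *
    rw [walk_succ]
    push_cast
    split_ifs <;> omega

lemma measurable_walk' {α : Type*} [MeasurableSpace α] {f : α → EnvPath T} {g : α → ℕ → ℝ}
    (hf : Measurable f) (hg : Measurable g) (n : ℕ) :
    Measurable fun a => walk p₀ p₁ (f a) (g a) n := by
  induction n with
  | zero => exact measurable_const
  | succ n ih =>
    simp only [walk_succ]
    refine Measurable.ite (measurableSet_le ((measurable_pi_apply n).comp hg) ?_)
      (ih.add_const 1) (ih.sub_const 1)
    exact measurable_jumpProb.comp (measurable_eval_rand ((measurable_pi_apply _).comp hf) ih)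

lemma measurable_walk (n : ℕ) :
    Measurable fun ω : EnvPath T × (ℕ → ℝ) => walk p₀ p₁ ω.1 ω.2 n :=
  measurable_walk' measurable_fst measurable_snd n

/-- The position at time `n` is a function of the variables of index less than `n`. They are padded
by `0` in order to express this as a composition. -/
lemma indepFun_walk (η : EnvPath T) (n : ℕ) :
    IndepFun (fun u => walk p₀ p₁ η u n) (fun u => u n) uniforms := by
  have h := iIndepFun_infinitePi (P := fun _ : ℕ => volume.restrict (Icc (0 : ℝ) 1))
    (X := fun _ x => x) (fun _ => measurable_id)
  have h2 := h.indepFun_finset (Finset.range n) {n} (by simp) (fun i => measurable_pi_apply i)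
  have h3 := h2.comp
    (φ := fun w : Finset.range n → ℝ =>
      walk p₀ p₁ η (fun i => if hi : i ∈ Finset.range n then w ⟨i, hi⟩ else 0) n)
    (ψ := fun w : ({n} : Finset ℕ) → ℝ => w ⟨n, by simp⟩)
    (measurable_walk' measurable_const (measurable_pi_lambda _ fun i => by
      by_cases hi : i ∈ Finset.range n
      · simp only [hi, dif_pos]; exact measurable_pi_apply _
      · simp only [hi, dif_neg, not_false_eq_true]; exact measurable_const) n)
    (measurable_pi_apply (X := fun _ : ({n} : Finset ℕ) => ℝ) ⟨n, by simp⟩)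
  refine h3.congr (Eventually.of_forall fun u => ?_) (Eventually.of_forall fun u => rfl)
  exact walk_congr η fun i hi => by simp [hi]

lemma map_eval_uniforms (n : ℕ) :
    uniforms.map (fun u => u n) = volume.restrict (Icc (0 : ℝ) 1) :=
  (measurePreserving_eval_infinitePi _ n).map_eq

lemma integral_ite_le {q : ℝ} (h0 : 0 ≤ q) (h1 : q ≤ 1) (a b : ℝ) :
    ∫ r in Icc (0 : ℝ) 1, (if r ≤ q then a else b) = q * a + (1 - q) * b := by
  have h : (fun r : ℝ => if r ≤ q then a else b)
      = fun r => (Iic q).indicator (fun _ => a - b) r + b := by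
    funext r; by_cases hr : r ≤ q <;> simp [hr]
  rw [h, integral_add, integral_indicator_const _ measurableSet_Iic]
  · have : (volume.restrict (Icc (0 : ℝ) 1)).real (Iic q) = q := by
      rw [measureReal_restrict_apply measurableSet_Iic]
      have : Iic q ∩ Icc (0 : ℝ) 1 = Icc 0 q := by
        ext r; simp only [mem_inter_iff, mem_Iic, mem_Icc]
        constructor
        · rintro ⟨h, h', -⟩; exact ⟨h', h⟩
        · rintro ⟨h, h'⟩; exact ⟨h', h, h'.trans h1⟩
      rw [this]; simp [h0]
    rw [this]; simp; ring
  · exact (integrable_const _).indicator measurableSet_Iic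
  · exact integrable_const _

lemma integral_walk_uniforms (hp₀ : 0 ≤ p₀) (hp : p₀ ≤ p₁) (hp₁ : p₁ ≤ 1) (η : EnvPath T)
    (n : ℕ) {Φ : ℤ → ℝ} {M : ℝ} (hΦ : ∀ x, |Φ x| ≤ M) :
    ∫ u, Φ (walk p₀ p₁ η u n) ∂uniforms = quenched p₀ p₁ η n Φ 0 := by
  induction n generalizing Φ with
  | zero => simp [walk, quenched]
  | succ n ih =>
    have hW : Measurable fun u => walk p₀ p₁ η u n :=
      measurable_walk' measurable_const measurable_id n
    set F : ℤ × ℝ → ℝ := fun z =>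
      if z.2 ≤ jumpProb p₀ p₁ (η (n : T) z.1) then Φ (z.1 + 1) else Φ (z.1 - 1) with hF
    have hFm : Measurable F := measurable_from_prod_countable_right fun x => by
      simp only [hF]
      exact Measurable.ite measurableSet_Iic measurable_const measurable_const
    have hFb : ∀ z, |F z| ≤ M := fun z => by simp only [hF]; split_ifs <;> apply hΦ
    have hmap := (indepFun_iff_map_prod_eq_prod_map_map hW.aemeasurable
      (measurable_pi_apply n).aemeasurable).1 (indepFun_walk (p₀ := p₀) (p₁ := p₁) η n)
    have : IsProbabilityMeasure (uniforms.map fun u => walk p₀ p₁ η u n) :=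
      Measure.isProbabilityMeasure_map hW.aemeasurable
    calc ∫ u, Φ (walk p₀ p₁ η u (n + 1)) ∂uniforms
        = ∫ u, F (walk p₀ p₁ η u n, u n) ∂uniforms := by
          refine integral_congr_ae (Eventually.of_forall fun u => ?_)
          simp only [hF, walk_succ]; split_ifs <;> rfl
      _ = ∫ z, F z ∂(uniforms.map fun u => (walk p₀ p₁ η u n, u n)) :=
          (integral_map (hW.prodMk (measurable_pi_apply n)).aemeasurable
            hFm.aestronglyMeasurable).symm
      _ = ∫ x, ∫ r, F (x, r) ∂(volume.restrict (Icc (0 : ℝ) 1))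
            ∂(uniforms.map fun u => walk p₀ p₁ η u n) := by
          rw [hmap, map_eval_uniforms, integral_prod]
          exact Integrable.of_bound hFm.aestronglyMeasurable M
            (Eventually.of_forall fun z => hFb z)
      _ = ∫ x, jump p₀ p₁ (η n) Φ x ∂(uniforms.map fun u => walk p₀ p₁ η u n) := by
          refine integral_congr_ae (Eventually.of_forall fun x => ?_)
          exact integral_ite_le (jumpProb_nonneg hp₀ hp (η n x)) (jumpProb_le_one hp hp₁ (η n x))
            (Φ (x + 1)) (Φ (x - 1))
      _ = ∫ u, jump p₀ p₁ (η n) Φ (walk p₀ p₁ η u n) ∂uniforms :=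
          integral_map hW.aemeasurable (measurable_of_countable _).aestronglyMeasurable
      _ = quenched p₀ p₁ η (n + 1) Φ 0 := by
          refine ih fun x => ?_
          have h1 := abs_le.1 (hΦ (x + 1))
          have h2 := abs_le.1 (hΦ (x - 1))
          have h3 := jumpProb_nonneg hp₀ hp (η n x)
          have h4 := sub_nonneg.2 (jumpProb_le_one hp hp₁ (η n x))
          have := mul_le_mul_of_nonneg_left h1.1 h3
          have := mul_le_mul_of_nonneg_left h1.2 h3
          have := mul_le_mul_of_nonneg_left h2.1 h4
          have := mul_le_mul_of_nonneg_left h2.2 h4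
          rw [abs_le]; simp only [jump]; constructor <;> linarith

end Walk

/-! ### Markov property, invariance, and the annealed law -/

namespace Environment

variable {T : Type} [CommSemiring T] [LinearOrder T] (E : Environment T)

instance : IsMarkovKernel E.P := E.isMarkovKernel_P

/-- The annealed law of the environment. -/
def envLaw (ρ : ℝ) : Measure (EnvPath T) := (E.μ ρ).bind E.P

lemma isProbabilityMeasure_envLaw {ρ : ℝ} (hρ : ρ ∈ E.J) : IsProbabilityMeasure (E.envLaw ρ) := by
  have := E.isProbabilityMeasure_μ ρ hρ
  unfold envLaw; infer_instance

lemma integral_envLaw {ρ : ℝ} (hρ : ρ ∈ E.J) {f : EnvPath T → ℝ} (hf : Measurable f)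
    {M : ℝ} (hM : ∀ η, |f η| ≤ M) :
    ∫ η, f η ∂(E.envLaw ρ) = ∫ ζ, ∫ η, f η ∂(E.P ζ) ∂(E.μ ρ) := by
  have := E.isProbabilityMeasure_envLaw hρ
  have h : E.envLaw ρ = (E.P ∘ₖ Kernel.const Unit (E.μ ρ)) () := by
    rw [Kernel.comp_apply, Kernel.const_apply]; rfl
  rw [h, Kernel.integral_comp, Kernel.const_apply]
  rw [← h]
  exact Integrable.of_bound hf.aestronglyMeasurable M (Eventually.of_forall hM)

lemma measurable_P_eval (s : T) : Measurable fun η : EnvPath T => E.P (η s) :=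
  E.P.measurable.comp (measurable_pi_apply s)

lemma map_shift_restrict (η₀ : Config) (s : T) {A : Set (EnvPath T)}
    (hA : MeasurableSet[past s] A) :
    ((E.P η₀).restrict A).map (shift s 0) = ((E.P η₀).restrict A).bind (fun η => E.P (η s)) := by
  have hA' := past_le s A hA
  ext B hB
  rw [Measure.map_apply (measurable_shift s 0) hB,
    Measure.restrict_apply (measurable_shift s 0 hB), inter_comm, E.markov η₀ s 0 A B hA hB,
    Measure.bind_apply hB (E.measurable_P_eval s).aemeasurable]
  refine lintegral_congr fun η => ?_
  rw [show translate 0 (η s) = η s from funext fun y => by simp [translate]]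

lemma setLIntegral_markov (η₀ : Config) (s : T) {A : Set (EnvPath T)}
    (hA : MeasurableSet[past s] A) {g : EnvPath T → ENNReal} (hg : Measurable g) :
    ∫⁻ η in A, g (shift s 0 η) ∂(E.P η₀) = ∫⁻ η in A, ∫⁻ η', g η' ∂(E.P (η s)) ∂(E.P η₀) := by
  rw [← lintegral_map hg (measurable_shift s 0), E.map_shift_restrict η₀ s hA,
    Measure.lintegral_bind (E.measurable_P_eval s).aemeasurable
      hg.aemeasurable]

/-- The Markov property is given for events; in `f` it extends by linearity and monotone limits, and
in `g` through the equality of measures `map_shift_restrict`. -/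
lemma lintegral_markov (η₀ : Config) (s : T) {f g : EnvPath T → ENNReal}
    (hf : Measurable[past s] f) (hg : Measurable g) :
    ∫⁻ η, f η * g (shift s 0 η) ∂(E.P η₀) = ∫⁻ η, f η * ∫⁻ η', g η' ∂(E.P (η s)) ∂(E.P η₀) := by
  have hg1 : Measurable fun η => g (shift s 0 η) := hg.comp (measurable_shift s 0)
  have hg2 : Measurable fun η : EnvPath T => ∫⁻ η', g η' ∂(E.P (η s)) :=
    hg.lintegral_kernel.comp (measurable_pi_apply s)
  refine @Measurable.ennreal_induction (EnvPath T) (past s) (fun f =>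
    ∫⁻ η, f η * g (shift s 0 η) ∂(E.P η₀) = ∫⁻ η, f η * ∫⁻ η', g η' ∂(E.P (η s)) ∂(E.P η₀))
    ?_ ?_ ?_ f hf
  · intro c A hA
    have hA' := past_le s A hA
    have key : ∀ h : EnvPath T → ENNReal, Measurable h →
        ∫⁻ η, A.indicator (fun _ => c) η * h η ∂(E.P η₀) = c * ∫⁻ η in A, h η ∂(E.P η₀) := by
      intro h hh
      rw [← lintegral_const_mul _ hh, ← lintegral_indicator hA']
      refine lintegral_congr fun η => ?_
      by_cases hη : η ∈ A <;> simp [hη]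
    rw [key _ hg1, key _ hg2, E.setLIntegral_markov η₀ s hA hg]
  · intro f₁ f₂ _ hf₁ _ h₁ h₂
    have hf₁' := hf₁.mono (past_le s) le_rfl
    simp only [Pi.add_apply, add_mul]
    rw [lintegral_add_left (by exact hf₁'.mul hg1), lintegral_add_left (by exact hf₁'.mul hg2),
      h₁, h₂]
  · intro F hF hmono h
    have key : ∀ h : EnvPath T → ENNReal, Measurable h →
        ∫⁻ η, (⨆ n, F n η) * h η ∂(E.P η₀) = ⨆ n, ∫⁻ η, F n η * h η ∂(E.P η₀) := by
      intro h hh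
      rw [← lintegral_iSup (fun n => by exact ((hF n).mono (past_le s) le_rfl).mul hh)
        (fun n m hnm η => by dsimp only; gcongr; exact hmono hnm η)]
      exact lintegral_congr fun η => ENNReal.iSup_mul _ _
    rw [key _ hg1, key _ hg2]
    exact iSup_congr h

/-- The Markov property, for expectations of bounded functions. -/
lemma integral_markov (η₀ : Config) (s : T) {f g : EnvPath T → ℝ}
    (hf : Measurable[past s] f) (hf0 : ∀ η, 0 ≤ f η)
    (hg : Measurable g) (hg0 : ∀ η, 0 ≤ g η) {M : ℝ} (hgM : ∀ η, g η ≤ M) :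
    ∫ η, f η * g (shift s 0 η) ∂(E.P η₀) = ∫ η, f η * ∫ η', g η' ∂(E.P (η s)) ∂(E.P η₀) := by
  have hf' := hf.mono (past_le s) le_rfl
  have hgi : ∀ ζ, Integrable g (E.P ζ) := fun ζ =>
    Integrable.of_bound hg.aestronglyMeasurable M
      (Eventually.of_forall fun η => by rw [Real.norm_of_nonneg (hg0 η)]; exact hgM η)
  have hg2 : Measurable fun η : EnvPath T => ∫ η', g η' ∂(E.P (η s)) :=
    (hg.stronglyMeasurable.integral_kernel (κ := E.P)).measurable.comp (measurable_pi_apply s)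
  rw [integral_eq_lintegral_of_nonneg_ae, integral_eq_lintegral_of_nonneg_ae]
  · congr 1
    have h := E.lintegral_markov η₀ s hf.ennreal_ofReal hg.ennreal_ofReal
    simp_rw [ENNReal.ofReal_mul (hf0 _)]
    rw [h]
    refine lintegral_congr fun η => ?_
    rw [ofReal_integral_eq_lintegral_ofReal (hgi _) (Eventually.of_forall hg0)]
  · exact Eventually.of_forall fun η => mul_nonneg (hf0 η) (integral_nonneg hg0)
  · exact (hf'.mul hg2).aestronglyMeasurable
  · exact Eventually.of_forall fun η => mul_nonneg (hf0 η) (hg0 _)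
  · exact (hf'.mul (hg.comp (measurable_shift s 0))).aestronglyMeasurable

/-- The Markov property at time `0` carries the spatial translation over to the initial
configuration, whose law is translation invariant. -/
lemma map_shift_zero_envLaw {ρ : ℝ} (hρ : ρ ∈ E.J) (x : ℤ) :
    (E.envLaw ρ).map (shift 0 x) = E.envLaw ρ := by
  ext B hB
  have hm : Measurable fun ζ => E.P ζ B := E.P.measurable_coe hB
  have h1 : ∀ ζ, E.P ζ (shift 0 x ⁻¹' B) = E.P (translate x ζ) B := fun ζ => by
    have h := E.markov ζ 0 x univ B MeasurableSet.univ hB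
    rw [univ_inter, Measure.restrict_univ] at h
    rw [h, lintegral_congr_ae (g := fun _ => E.P (translate x ζ) B)]
    · simp
    · filter_upwards [E.start ζ] with η hη
      rw [hη]
  rw [Measure.map_apply (measurable_shift 0 x) hB, envLaw,
    Measure.bind_apply (measurable_shift 0 x hB) E.P.aemeasurable,
    Measure.bind_apply hB E.P.aemeasurable]
  simp_rw [h1]
  rw [← lintegral_map hm (measurable_translate x), E.map_translate_μ ρ hρ x]

lemma map_shift_envLaw {ρ : ℝ} (hρ : ρ ∈ E.J) (s : T) :
    (E.envLaw ρ).map (shift s 0) = E.envLaw ρ := E.stationary ρ hρ s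

lemma map_eval_zero_envLaw (ρ : ℝ) :
    (E.envLaw ρ).map (fun η => η 0) = E.μ ρ := by
  ext B hB
  rw [Measure.map_apply (measurable_pi_apply 0) hB, envLaw,
    Measure.bind_apply (measurable_pi_apply (0 : T) hB) E.P.aemeasurable,
    ← lintegral_indicator_one hB]
  refine lintegral_congr fun ζ => ?_
  have : IsProbabilityMeasure (E.P ζ) := inferInstance
  by_cases hζ : ζ ∈ B
  · simp only [hζ, indicator_of_mem, Pi.one_apply]
    rw [← prob_compl_eq_zero_iff (measurable_pi_apply (0 : T) hB)]
    refine measure_mono_null (fun η hη => ?_) (E.start ζ)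
    simp only [mem_compl_iff, mem_preimage, mem_ofPred_eq] at *
    rintro rfl; exact hη hζ
  · simp only [hζ, not_false_eq_true, indicator_of_notMem]
    refine measure_mono_null (fun η hη => ?_) (E.start ζ)
    simp only [mem_compl_iff, mem_preimage, mem_ofPred_eq] at *
    rintro rfl; exact hζ hη

lemma map_eval_envLaw {ρ : ℝ} (hρ : ρ ∈ E.J) (s : T) :
    (E.envLaw ρ).map (fun η => η s) = E.μ ρ := by
  have h := E.map_eval_zero_envLaw ρ
  rw [← E.map_shift_envLaw hρ s, Measure.map_map (measurable_pi_apply 0) (measurable_shift s 0)]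
    at h
  rw [← h]
  congr 1
  funext η y
  simp [shift, translate]

/-- The annealed law of the position of the walk at time `n`. -/
def walkLaw (p₀ p₁ ρ : ℝ) (n : ℕ) : Measure ℤ :=
  (E.annealed ρ).map fun ω => walk p₀ p₁ ω.1 ω.2 n

lemma isProbabilityMeasure_annealed {ρ : ℝ} (hρ : ρ ∈ E.J) :
    IsProbabilityMeasure (E.annealed ρ) := by
  have := E.isProbabilityMeasure_envLaw hρ
  have h : E.annealed ρ = (E.envLaw ρ).prod uniforms := rfl
  rw [h]; infer_instance

variable {p₀ p₁ : ℝ}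

lemma isProbabilityMeasure_walkLaw {ρ : ℝ} (hρ : ρ ∈ E.J) (n : ℕ) :
    IsProbabilityMeasure (E.walkLaw p₀ p₁ ρ n) := by
  have := E.isProbabilityMeasure_annealed hρ
  exact Measure.isProbabilityMeasure_map (measurable_walk n).aemeasurable

lemma ae_walkLaw (ρ : ℝ) (n : ℕ) : ∀ᵐ x ∂(E.walkLaw p₀ p₁ ρ n), |x| ≤ (n : ℤ) := by
  rw [walkLaw, ae_map_iff (measurable_walk n).aemeasurable (MeasurableSet.of_discrete)]
  exact Eventually.of_forall fun ω => abs_walk_le _ _ n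

lemma integral_walkLaw (hp₀ : 0 ≤ p₀) (hp : p₀ ≤ p₁) (hp₁ : p₁ ≤ 1) {ρ : ℝ} (hρ : ρ ∈ E.J)
    (n : ℕ) {Φ : ℤ → ℝ} {M : ℝ} (hΦ : ∀ x, |Φ x| ≤ M) :
    ∫ x, Φ x ∂(E.walkLaw p₀ p₁ ρ n) = ∫ η, quenched p₀ p₁ η n Φ 0 ∂(E.envLaw ρ) := by
  have := E.isProbabilityMeasure_envLaw hρ
  have hΦm : Measurable Φ := measurable_of_countable _
  rw [walkLaw, integral_map (measurable_walk n).aemeasurable hΦm.aestronglyMeasurable]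
  have h : E.annealed ρ = (E.envLaw ρ).prod uniforms := rfl
  rw [h, integral_prod]
  · exact integral_congr_ae (Eventually.of_forall fun η =>
      integral_walk_uniforms hp₀ hp hp₁ η n hΦ)
  · exact Integrable.of_bound (hΦm.comp (measurable_walk n)).aestronglyMeasurable M
      (Eventually.of_forall fun ω => hΦ _)

lemma meanSpeed_eq (ρ : ℝ) (L : ℕ) :
    E.meanSpeed p₀ p₁ ρ L = (∫ x, (x : ℝ) ∂(E.walkLaw p₀ p₁ ρ L)) / L := by
  rw [walkLaw, integral_map (measurable_walk L).aemeasurable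
    (measurable_of_countable _).aestronglyMeasurable, meanSpeed, integral_div]

end Environment

/-! ### Integrals of bounded functions and comparison through couplings -/

lemma integrable_of_bounded {α : Type*} [MeasurableSpace α] {m : Measure α} [IsFiniteMeasure m]
    {f : α → ℝ} (hf : Measurable f) {M : ℝ} (h0 : ∀ a, 0 ≤ f a) (hM : ∀ a, f a ≤ M) :
    Integrable f m :=
  Integrable.of_bound hf.aestronglyMeasurable M
    (Eventually.of_forall fun a => by rw [Real.norm_of_nonneg (h0 a)]; exact hM a)

lemma integral_le_of_forall_le {α : Type*} [MeasurableSpace α] {m : Measure α}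
    [IsProbabilityMeasure m] {f : α → ℝ} {M : ℝ} (h0 : ∀ a, 0 ≤ f a) (hM : ∀ a, f a ≤ M) :
    ∫ a, f a ∂m ≤ M := by
  have : ∫ a, f a ∂m ≤ ∫ _, M ∂m :=
    integral_mono_of_nonneg (Eventually.of_forall h0) (integrable_const M) (Eventually.of_forall hM)
  simpa using this

lemma integral_le_add_measureReal {α : Type*} [MeasurableSpace α] {m : Measure α}
    [IsProbabilityMeasure m] {f g : α → ℝ} {M d : ℝ} (hf0 : ∀ a, 0 ≤ f a)
    (hg : Integrable g m) {B : Set α} (hB : MeasurableSet B)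
    (h : ∀ a, f a ≤ g a + d + B.indicator (fun _ => M) a) :
    ∫ a, f a ∂m ≤ ∫ a, g a ∂m + d + M * m.real B := by
  have hi : Integrable (fun a => g a + d) m := hg.add (integrable_const d)
  have hi2 : Integrable (B.indicator fun _ => M) m := (integrable_const M).indicator hB
  calc ∫ a, f a ∂m ≤ ∫ a, (g a + d + B.indicator (fun _ => M) a) ∂m :=
        integral_mono_of_nonneg (Eventually.of_forall hf0) (hi.add hi2) (Eventually.of_forall h)
    _ = ∫ a, g a ∂m + d + M * m.real B := by
        rw [integral_add hi hi2, integral_add hg (integrable_const d),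
          integral_indicator_const _ hB]
        simp [mul_comm]

/-- Comparison of expectations through a coupling which compares the functions outside an event of
probability at most `e`. -/
lemma IsCoupling.integral_le {A B : Type} [MeasurableSpace A] [MeasurableSpace B]
    {m₁ : Measure A} {m₂ : Measure B} [IsProbabilityMeasure m₁]
    {Q : Measure (A × B)} (hQ : IsCoupling Q m₁ m₂) {f : A → ℝ} {g : B → ℝ}
    (hf : Measurable f) (hg : Measurable g) {M d e : ℝ} (hf0 : ∀ a, 0 ≤ f a) (hfM : ∀ a, f a ≤ M)
    (hg0 : ∀ b, 0 ≤ g b) (hgM : ∀ b, g b ≤ M) (hd : 0 ≤ d) (hM : 0 ≤ M)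
    {S : Set (A × B)} (hS : 1 - e ≤ Q.real S) (h : ∀ ω ∈ S, g ω.2 ≤ f ω.1 + d) :
    ∫ b, g b ∂m₂ ≤ ∫ a, f a ∂m₁ + d + M * e := by
  have hQp : IsProbabilityMeasure Q := by
    refine ⟨?_⟩
    rw [← preimage_univ (f := Prod.fst), ← Measure.map_apply measurable_fst MeasurableSet.univ,
      hQ.1]
    exact measure_univ
  rw [← hQ.1, ← hQ.2, integral_map measurable_snd.aemeasurable hg.aestronglyMeasurable,
    integral_map measurable_fst.aemeasurable hf.aestronglyMeasurable]
  -- `S` need not be measurable. It is replaced by the measurable event on which the wanted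
  -- comparison holds, which contains `S`.
  have hS'm : MeasurableSet {ω : A × B | g ω.2 ≤ f ω.1 + d} :=
    measurableSet_le (hg.comp measurable_snd) ((hf.comp measurable_fst).add_const d)
  have hSS : Q.real S ≤ Q.real {ω : A × B | g ω.2 ≤ f ω.1 + d} := measureReal_mono h
  have hc : Q.real {ω : A × B | g ω.2 ≤ f ω.1 + d}ᶜ ≤ e := by
    rw [probReal_compl_eq_one_sub hS'm]; linarith
  refine (integral_le_add_measureReal (M := M) (d := d) (g := fun ω : A × B => f ω.1)
    (fun ω => hg0 ω.2) (integrable_of_bounded (hf.comp measurable_fst) (fun ω => hf0 ω.1)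
      fun ω => hfM ω.1) hS'm.compl fun ω => ?_).trans ?_
  · by_cases hω : g ω.2 ≤ f ω.1 + d
    · simp [hω]
    · simp only [mem_compl_iff, mem_ofPred_eq, hω, not_false_eq_true, indicator_of_mem]
      linarith [hf0 ω.1, hgM ω.2]
  · have := mul_le_mul_of_nonneg_left hc hM
    linarith

/-! ### Configurations with an atypical empirical density -/

/-- The configurations whose empirical density differs from `ρ` by at least `δ` on some interval
of length between `ℓ / 2` and `ℓ` which starts in `[-H, H]`. -/
def irregular (ρ δ : ℝ) (H ℓ : ℕ) : Set Config :=
  ⋃ a ∈ Finset.Icc (-(H : ℤ)) H, ⋃ m ∈ (Finset.Icc 1 ℓ).filter (fun m => ℓ / 2 ≤ m),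
    {ζ | δ * m ≤ |(count ζ a (a + m - 1) : ℝ) - ρ * m|}

lemma measurableSet_irregular (ρ δ : ℝ) (H ℓ : ℕ) : MeasurableSet (irregular ρ δ H ℓ) := by
  refine Finset.measurableSet_biUnion _ fun a _ => Finset.measurableSet_biUnion _ fun m _ => ?_
  have h : Measurable fun ζ : Config => |(count ζ a (a + m - 1) : ℝ) - ρ * m| :=
    measurable_norm.comp (((measurable_from_nat (f := fun k : ℕ => (k : ℝ))).comp
      (measurable_count _ _)).sub_const _)
  exact measurableSet_le measurable_const h

lemma abs_count_sub_lt {ρ δ : ℝ} {H ℓ : ℕ} {ζ : Config} (h : ζ ∉ irregular ρ δ H ℓ) {a b : ℤ}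
    (ha : -(H : ℤ) ≤ a) (hab : a ≤ b) (hb : b ≤ H) (h1 : (ℓ : ℤ) / 2 ≤ b - a + 1)
    (h2 : b - a + 1 ≤ ℓ) :
    |(count ζ a b : ℝ) - ρ * ((b - a + 1 : ℤ) : ℝ)| < δ * ((b - a + 1 : ℤ) : ℝ) := by
  obtain ⟨m, hm⟩ := Int.eq_ofNat_of_zero_le (show 0 ≤ b - a + 1 by omega)
  by_contra hc
  rw [not_lt] at hc
  apply h
  simp only [irregular, mem_iUnion, Finset.mem_Icc, Finset.mem_filter]
  refine ⟨a, ⟨ha, by omega⟩, m, ⟨⟨by omega, by omega⟩, by omega⟩, ?_⟩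
  rw [show a + (m : ℤ) - 1 = b by omega]
  rw [hm] at hc
  exact_mod_cast hc

lemma count_translate (a : ℤ) (m : ℤ) (ζ : Config) :
    count (translate a ζ) 0 (m - 1) = count ζ a (a + m - 1) := by
  unfold count translate
  refine Finset.sum_nbij' (fun x => a + x) (fun x => x - a) ?_ ?_ ?_ ?_ ?_
  all_goals intro x hx
  all_goals simp only [Finset.mem_Icc] at *
  all_goals omega

namespace Environment

variable {T : Type} [CommSemiring T] [LinearOrder T] (E : Environment T)

/-- Union bound over starting points and lengths. Translation invariance moves every interval to the
origin, and the lengths are at least `(ℓ - 1) / 2` because `ℓ / 2` is rounded down. -/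
lemma measureReal_irregular_le {c ρ δ : ℝ} (hc : 0 < c) (hρ : ρ ∈ E.J) (hδ : δ ∈ Ioo (0 : ℝ) 1)
    (hdens : ∀ ε ∈ Ioo (0 : ℝ) 1, ∀ ℓ : ℕ, 1 ≤ ℓ →
      (E.μ ρ).real {η | ε * ℓ ≤ |(count η 0 ((ℓ : ℤ) - 1) : ℝ) - ρ * ℓ|}
        ≤ 2 * Real.exp (-c * ε ^ 2 * ℓ)) (H ℓ : ℕ) :
    (E.μ ρ).real (irregular ρ δ H ℓ)
      ≤ (2 * H + 1) * (ℓ * (2 * Real.exp (-c * δ ^ 2 * ((ℓ - 1) / 2)))) := by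
  have := E.isProbabilityMeasure_μ ρ hρ
  have key : ∀ a : ℤ, ∀ m ∈ (Finset.Icc 1 ℓ).filter (fun m => ℓ / 2 ≤ m),
      (E.μ ρ).real {ζ | δ * m ≤ |(count ζ a (a + m - 1) : ℝ) - ρ * m|}
        ≤ 2 * Real.exp (-c * δ ^ 2 * ((ℓ - 1) / 2)) := by
    intro a m hm
    simp only [Finset.mem_filter, Finset.mem_Icc] at hm
    have h1 := hdens δ hδ m hm.1.1
    have h2 : (E.μ ρ).real {ζ | δ * m ≤ |(count ζ a (a + m - 1) : ℝ) - ρ * m|}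
        = (E.μ ρ).real {η | δ * m ≤ |(count η 0 ((m : ℤ) - 1) : ℝ) - ρ * m|} := by
      conv_rhs => rw [← E.map_translate_μ ρ hρ a]
      rw [map_measureReal_apply (measurable_translate a)]
      · simp only [preimage_ofPred_eq, count_translate]
      · have h : Measurable fun ζ : Config => |(count ζ 0 ((m : ℤ) - 1) : ℝ) - ρ * m| :=
          measurable_norm.comp (((measurable_from_nat (f := fun k : ℕ => (k : ℝ))).comp
            (measurable_count _ _)).sub_const _)
        exact measurableSet_le measurable_const h
    rw [h2]
    refine h1.trans ?_
    have h3 : ((ℓ : ℝ) - 1) / 2 ≤ m := by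
      have : ℓ ≤ 2 * m + 1 := by omega
      have : (ℓ : ℝ) ≤ 2 * m + 1 := by exact_mod_cast this
      linarith
    have h4 : 0 ≤ c * δ ^ 2 := by positivity
    gcongr 2 * Real.exp ?_
    nlinarith
  have hcard : ((Finset.Icc 1 ℓ).filter (fun m => ℓ / 2 ≤ m)).card ≤ ℓ := by
    simpa using Finset.card_filter_le (Finset.Icc 1 ℓ) (fun m => ℓ / 2 ≤ m)
  have hcard' : ((Finset.Icc (-(H : ℤ)) H).card : ℝ) = 2 * H + 1 := by
    rw [Int.card_Icc]
    have : ((H : ℤ) + 1 - -(H : ℤ)).toNat = 2 * H + 1 := by omega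
    rw [this]; push_cast; ring
  refine (measureReal_biUnion_finset_le _ _).trans ((Finset.sum_le_card_nsmul _ _
    (ℓ * (2 * Real.exp (-c * δ ^ 2 * ((ℓ - 1) / 2)))) fun a _ => ?_).trans ?_)
  · refine (measureReal_biUnion_finset_le _ _).trans ((Finset.sum_le_card_nsmul _ _ _
      (key a)).trans ?_)
    rw [nsmul_eq_mul]
    gcongr
  · rw [nsmul_eq_mul, hcard']

/-! ### Comparison of the walk in two environments -/

variable {E} {p₀ p₁ ν : ℝ}

/-- Started from `y`, the walk stays within distance `L` of `y`. The condition on `H` keeps this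
range inside the window where domination survives up to time `L`; the drift condition is used with
`k = 1`. -/
lemma integral_quenched_le_of_drift [IsStrictOrderedRing T] (hdrift : E.NoDriftingIn ν)
    (hp₀ : 0 ≤ p₀) (hp : p₀ ≤ p₁) (hp₁ : p₁ ≤ 1) {L H : ℕ} {y : ℤ}
    (hH : |(y : ℝ)| + L + 2 * ν * L ≤ H) {ξ' ξ : Config}
    (h : ∀ x : ℤ, |x| ≤ (H : ℤ) → ξ' x ≤ ξ x) {Φ : ℤ → ℝ} (hΦ : ParityMono Φ) {M : ℝ}
    (h0 : ∀ x, 0 ≤ Φ x) (hM : ∀ x, Φ x ≤ M) :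
    ∫ η, quenched p₀ p₁ η L Φ y ∂(E.P ξ')
      ≤ ∫ η, quenched p₀ p₁ η L Φ y ∂(E.P ξ) + M * (20 * Real.exp (-(ν * L / 4))) := by
  obtain ⟨Q, hQ, hQS⟩ := hdrift L H 1 le_rfl ξ ξ' h
  have := hQ.integral_le (measurable_quenched L Φ y) (measurable_quenched L Φ y) (d := 0)
    (fun η => quenched_nonneg hp₀ hp hp₁ η L h0 y) (fun η => quenched_le hp₀ hp hp₁ η L hM y)
    (fun η => quenched_nonneg hp₀ hp hp₁ η L h0 y) (fun η => quenched_le hp₀ hp hp₁ η L hM y)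
    le_rfl ((h0 0).trans (hM 0)) hQS (fun ω hω => by
      rw [add_zero]
      refine quenched_mono_env hp₀ hp hp₁ L hΦ fun j hj z hz => ?_
      refine hω j (Nat.cast_le.2 hj.le) z ?_
      have h1 : |((z - y : ℤ) : ℝ)| ≤ L := by exact_mod_cast hz
      have h2 : |(z : ℝ)| ≤ |((z - y : ℤ) : ℝ)| + |(y : ℝ)| := by
        have := abs_add_le ((z - y : ℤ) : ℝ) (y : ℝ)
        push_cast at this ⊢
        simpa using this
      push_cast
      linarith)
  simpa using this

/-- The expectation of `Φ (X L)` for the walk started from `y` at time `t`. -/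
def delayed (E : Environment T) (p₀ p₁ : ℝ) (t L : ℕ) (Φ : ℤ → ℝ) (y : ℤ) (ζ : Config) : ℝ :=
  ∫ η, quenched p₀ p₁ (shift (t : T) 0 η) L Φ y ∂(E.P ζ)

lemma measurable_integral_P {f : EnvPath T → ℝ} (hf : Measurable f) :
    Measurable fun ζ => ∫ η, f η ∂(E.P ζ) :=
  (hf.stronglyMeasurable.integral_kernel (κ := E.P)).measurable

lemma measurable_delayed (t L : ℕ) (Φ : ℤ → ℝ) (y : ℤ) :
    Measurable (E.delayed p₀ p₁ t L Φ y) :=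
  measurable_integral_P ((measurable_quenched L Φ y).comp (measurable_shift _ _))

lemma delayed_nonneg (hp₀ : 0 ≤ p₀) (hp : p₀ ≤ p₁) (hp₁ : p₁ ≤ 1) (t L : ℕ) {Φ : ℤ → ℝ}
    (h0 : ∀ x, 0 ≤ Φ x) (y : ℤ) (ζ : Config) : 0 ≤ E.delayed p₀ p₁ t L Φ y ζ :=
  integral_nonneg fun _ => quenched_nonneg hp₀ hp hp₁ _ L h0 y

lemma delayed_le (hp₀ : 0 ≤ p₀) (hp : p₀ ≤ p₁) (hp₁ : p₁ ≤ 1) (t L : ℕ) {Φ : ℤ → ℝ} {M : ℝ}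
    (h0 : ∀ x, 0 ≤ Φ x) (hM : ∀ x, Φ x ≤ M) (y : ℤ) (ζ : Config) :
    E.delayed p₀ p₁ t L Φ y ζ ≤ M :=
  integral_le_of_forall_le (fun _ => quenched_nonneg hp₀ hp hp₁ _ L h0 y)
    (fun _ => quenched_le hp₀ hp hp₁ _ L hM y)

lemma delayed_eq (hp₀ : 0 ≤ p₀) (hp : p₀ ≤ p₁) (hp₁ : p₁ ≤ 1) (t L : ℕ) {Φ : ℤ → ℝ} {M : ℝ}
    (h0 : ∀ x, 0 ≤ Φ x) (hM : ∀ x, Φ x ≤ M) (y : ℤ) (ζ : Config) :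
    E.delayed p₀ p₁ t L Φ y ζ
      = ∫ η, ∫ η', quenched p₀ p₁ η' L Φ y ∂(E.P (η (t : T))) ∂(E.P ζ) := by
  have := E.integral_markov ζ (t : T) (f := fun _ => 1) (M := M)
    (g := fun η => quenched p₀ p₁ η L Φ y) measurable_const
    (fun _ => zero_le_one) (measurable_quenched L Φ y)
    (fun η => quenched_nonneg hp₀ hp hp₁ η L h0 y) (fun η => quenched_le hp₀ hp hp₁ η L hM y)
  simpa [delayed] using this

/-- The coupling orders the two configurations at time `t` on the window `[-H', H']`. The Markov
property restarts both environments there, and the ordering is then propagated for the remaining `L`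
steps. -/
lemma delayed_le_of_coupling [IsStrictOrderedRing T] (hdrift : E.NoDriftingIn ν)
    (hp₀ : 0 ≤ p₀) (hp : p₀ ≤ p₁) (hp₁ : p₁ ≤ 1) {t L H H' : ℕ} {y : ℤ}
    (hH' : |(y : ℝ)| + L + 2 * ν * L ≤ H') (hH : (H' : ℝ) ≤ H - 4 * ν * t) {ζ' ζ : Config}
    {Q : Measure (EnvPath T × EnvPath T)} (hQ : IsCoupling Q (E.P ζ) (E.P ζ')) {e : ℝ}
    (he : 1 - e ≤ Q.real {ω | ∀ x : ℤ, |(x : ℝ)| ≤ H - 4 * ν * t → ω.2 (t : T) x ≤ ω.1 (t : T) x})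
    {Φ : ℤ → ℝ} (hΦ : ParityMono Φ) {M : ℝ} (h0 : ∀ x, 0 ≤ Φ x) (hM : ∀ x, Φ x ≤ M) :
    E.delayed p₀ p₁ t L Φ y ζ'
      ≤ E.delayed p₀ p₁ t L Φ y ζ + M * (20 * Real.exp (-(ν * L / 4)) + e) := by
  have hM0 : 0 ≤ M := (h0 0).trans (hM 0)
  rw [delayed_eq hp₀ hp hp₁ t L h0 hM, delayed_eq hp₀ hp hp₁ t L h0 hM]
  have hm : Measurable fun η : EnvPath T =>
      ∫ η', quenched p₀ p₁ η' L Φ y ∂(E.P (η (t : T))) :=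
    (measurable_integral_P (measurable_quenched L Φ y)).comp (measurable_pi_apply _)
  have hb0 : ∀ η : EnvPath T, 0 ≤ ∫ η', quenched p₀ p₁ η' L Φ y ∂(E.P (η (t : T))) :=
    fun η => integral_nonneg fun _ => quenched_nonneg hp₀ hp hp₁ _ L h0 y
  have hbM : ∀ η : EnvPath T, ∫ η', quenched p₀ p₁ η' L Φ y ∂(E.P (η (t : T))) ≤ M :=
    fun η => integral_le_of_forall_le (fun _ => quenched_nonneg hp₀ hp hp₁ _ L h0 y)
      (fun _ => quenched_le hp₀ hp hp₁ _ L hM y)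
  have := hQ.integral_le hm hm (d := M * (20 * Real.exp (-(ν * L / 4)))) hb0 hbM hb0 hbM
    (by positivity) hM0 he fun ω hω => integral_quenched_le_of_drift hdrift hp₀ hp hp₁ hH'
      (fun x hx => hω x (le_trans (by exact_mod_cast hx) hH)) hΦ h0 hM
  linarith

/-- Stationarity removes the delay and translation invariance moves `y` to the origin. Averaged over
a fresh initial configuration, the delayed walk thus has the law of a new walk, which is where the
independence of the new increment comes from. -/
lemma integral_delayed (hp₀ : 0 ≤ p₀) (hp : p₀ ≤ p₁) (hp₁ : p₁ ≤ 1) {ρ : ℝ} (hρ : ρ ∈ E.J)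
    (t L : ℕ) {Φ : ℤ → ℝ} {M : ℝ} (h0 : ∀ x, 0 ≤ Φ x) (hM : ∀ x, Φ x ≤ M) (y : ℤ) :
    ∫ ζ, E.delayed p₀ p₁ t L Φ y ζ ∂(E.μ ρ) = ∫ x, Φ (y + x) ∂(E.walkLaw p₀ p₁ ρ L) := by
  have hab : ∀ x, |Φ x| ≤ M := fun x => by rw [abs_of_nonneg (h0 x)]; exact hM x
  have hq : ∀ (η : EnvPath T), |quenched p₀ p₁ η L Φ y| ≤ M := fun η => by
    rw [abs_of_nonneg (quenched_nonneg hp₀ hp hp₁ η L h0 y)]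
    exact quenched_le hp₀ hp hp₁ η L hM y
  have hm := measurable_quenched (T := T) (p₀ := p₀) (p₁ := p₁) L Φ y
  have hm' := measurable_quenched (T := T) (p₀ := p₀) (p₁ := p₁) L (fun x => Φ (y + x)) 0
  rw [E.integral_walkLaw hp₀ hp hp₁ hρ L fun x => hab (y + x)]
  simp only [delayed]
  rw [← E.integral_envLaw hρ (f := fun η => quenched p₀ p₁ (shift (t : T) 0 η) L Φ y)
    (hm.comp (measurable_shift (t : T) 0)) fun η => hq _]
  rw [← integral_map (φ := shift (t : T) 0) (f := fun η => quenched p₀ p₁ η L Φ y)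
    (measurable_shift _ _).aemeasurable hm.aestronglyMeasurable, E.map_shift_envLaw hρ]
  conv_rhs => rw [← E.map_shift_zero_envLaw hρ y]
  rw [integral_map (measurable_shift _ _).aemeasurable hm'.aestronglyMeasurable]
  simp [quenched_shift_zero]

/-- Conditionally on the environment up to time `n`, the future depends on the configuration at time
`n`, whose law is again `μ ρ`. It is seen from the origin rather than from the walk, so stationarity
applies directly. Since the weights of the positions sum to `1`, the exceptional set `B` is paid for
once and not once per site. -/
lemma integral_walkLaw_add_le [IsStrictOrderedRing T]
    (hp₀ : 0 ≤ p₀) (hp : p₀ ≤ p₁) (hp₁ : p₁ ≤ 1) {ρ : ℝ}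
    (hρ : ρ ∈ E.J) (n m : ℕ) {Φ : ℤ → ℝ} {M : ℝ} (h0 : ∀ x, 0 ≤ Φ x) (hM : ∀ x, Φ x ≤ M)
    {c : ℤ → ℝ} (hc0 : ∀ x, 0 ≤ c x) (hcM : ∀ x, c x ≤ M) {e : ℝ} {B : Set Config}
    (hB : MeasurableSet B)
    (h : ∀ x : ℤ, |x| ≤ n → ∀ ζ ∉ B, ∫ η, quenched p₀ p₁ η m Φ x ∂(E.P ζ) ≤ c x + e) (he : 0 ≤ e) :
    ∫ x, Φ x ∂(E.walkLaw p₀ p₁ ρ (n + m))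
      ≤ ∫ x, c x ∂(E.walkLaw p₀ p₁ ρ n) + e + M * (E.μ ρ).real B := by
  have := E.isProbabilityMeasure_envLaw hρ
  have hab : ∀ {f : ℤ → ℝ}, (∀ x, 0 ≤ f x) → (∀ x, f x ≤ M) → ∀ x, |f x| ≤ M :=
    fun h0 hM x => by rw [abs_of_nonneg (h0 x)]; exact hM x
  rw [E.integral_walkLaw hp₀ hp hp₁ hρ _ (hab h0 hM),
    E.integral_walkLaw hp₀ hp hp₁ hρ _ (hab hc0 hcM)]
  set F : ℤ → Config → ℝ := fun x ζ => ∫ η, quenched p₀ p₁ η m Φ x ∂(E.P ζ) with hF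
  have hFm : ∀ x, Measurable (F x) := fun x => measurable_integral_P (measurable_quenched m Φ x)
  have hF0 : ∀ x ζ, 0 ≤ F x ζ :=
    fun x ζ => integral_nonneg fun _ => quenched_nonneg hp₀ hp hp₁ _ m h0 x
  have hFM : ∀ x ζ, F x ζ ≤ M := fun x ζ => integral_le_of_forall_le
    (fun _ => quenched_nonneg hp₀ hp hp₁ _ m h0 x) (fun _ => quenched_le hp₀ hp hp₁ _ m hM x)
  have hw : ∀ x : ℤ, Measurable fun η : EnvPath T => weight p₀ p₁ η n x :=
    fun x => measurable_quenched n _ 0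
  -- the environment after time `n` is replaced by its conditional law
  set S : EnvPath T → ℝ := fun η =>
    ∑ x ∈ Finset.Icc (-(n : ℤ)) n, weight p₀ p₁ η n x * F x (η n) with hS
  have hSm : Measurable S := Finset.measurable_sum _ fun x _ =>
    (hw x).mul ((hFm x).comp (measurable_pi_apply _))
  have hS0 : ∀ η, 0 ≤ S η := fun η => Finset.sum_nonneg fun x _ =>
    mul_nonneg (weight_nonneg hp₀ hp hp₁ η n x) (hF0 _ _)
  have hSM : ∀ η, S η ≤ M := fun η => by
    calc S η ≤ ∑ x ∈ Finset.Icc (-(n : ℤ)) n, weight p₀ p₁ η n x * M :=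
          Finset.sum_le_sum fun x _ =>
            mul_le_mul_of_nonneg_left (hFM _ _) (weight_nonneg hp₀ hp hp₁ η n x)
      _ = M := by rw [← Finset.sum_mul, sum_weight, one_mul]
  have hcond : ∫ η, quenched p₀ p₁ η (n + m) Φ 0 ∂(E.envLaw ρ) = ∫ η, S η ∂(E.envLaw ρ) := by
    rw [E.integral_envLaw hρ (measurable_quenched _ _ _) (M := M) fun η => by
        rw [abs_of_nonneg (quenched_nonneg hp₀ hp hp₁ η _ h0 _)]
        exact quenched_le hp₀ hp hp₁ η _ hM _,
      E.integral_envLaw hρ hSm (M := M) fun η => by rw [abs_of_nonneg (hS0 η)]; exact hSM η]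
    congr 1
    funext ζ
    simp only [quenched_add]
    simp only [quenched_eq_sum, hS]
    rw [integral_finsetSum, integral_finsetSum]
    · refine Finset.sum_congr rfl fun x _ => ?_
      exact E.integral_markov ζ (n : T) (f := fun η => weight p₀ p₁ η n x)
        (g := fun η => quenched p₀ p₁ η m Φ x) (measurable_weight_past n x)
        (fun η => weight_nonneg hp₀ hp hp₁ η n x) (measurable_quenched m Φ x)
        (fun η => quenched_nonneg hp₀ hp hp₁ η m h0 x) (fun η => quenched_le hp₀ hp hp₁ η m hM x)
    · intro x _
      refine integrable_of_bounded (M := 1 * M) ((hw x).mul ((hFm x).comp (measurable_pi_apply _)))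
        (fun η => mul_nonneg (weight_nonneg hp₀ hp hp₁ η n x) (hF0 _ _)) fun η => ?_
      exact mul_le_mul (weight_le_one hp₀ hp hp₁ η n x) (hFM _ _) (hF0 _ _) zero_le_one
    · intro x _
      refine integrable_of_bounded (M := 1 * M)
        ((hw x).mul ((measurable_quenched m Φ x).comp (measurable_shift _ _)))
        (fun η => mul_nonneg (weight_nonneg hp₀ hp hp₁ η n x)
          (quenched_nonneg hp₀ hp hp₁ _ m h0 x)) fun η => ?_
      exact mul_le_mul (weight_le_one hp₀ hp hp₁ η n x) (quenched_le hp₀ hp hp₁ _ m hM x)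
        (quenched_nonneg hp₀ hp hp₁ _ m h0 x) zero_le_one
  have hBm : MeasurableSet ((fun η : EnvPath T => η (n : T)) ⁻¹' B) := measurable_pi_apply _ hB
  have hBr : (E.envLaw ρ).real ((fun η : EnvPath T => η (n : T)) ⁻¹' B) = (E.μ ρ).real B := by
    rw [← map_measureReal_apply (measurable_pi_apply (n : T)) hB, E.map_eval_envLaw hρ]
  rw [hcond, ← hBr]
  refine integral_le_add_measureReal hS0 (integrable_of_bounded (measurable_quenched n c 0)
    (fun η => quenched_nonneg hp₀ hp hp₁ η n hc0 0) fun η => quenched_le hp₀ hp hp₁ η n hcM 0)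
    hBm fun η => ?_
  by_cases hη : η n ∈ B
  · have : 0 ≤ quenched p₀ p₁ η n c 0 := quenched_nonneg hp₀ hp hp₁ η n hc0 0
    have h2 : ((fun η : EnvPath T => η (n : T)) ⁻¹' B).indicator (fun _ => M) η = M := by
      rw [indicator_of_mem]; exact hη
    rw [h2]
    linarith [hSM η]
  · have h2 : ((fun η : EnvPath T => η (n : T)) ⁻¹' B).indicator (fun _ => M) η = 0 := by
      rw [indicator_of_notMem]; exact hη
    rw [h2, add_zero, quenched_eq_sum]
    calc S η ≤ ∑ x ∈ Finset.Icc (-(n : ℤ)) n, weight p₀ p₁ η n x * (c x + e) :=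
          Finset.sum_le_sum fun x hx => mul_le_mul_of_nonneg_left
            (h x (abs_le.2 (Finset.mem_Icc.1 hx)) _ hη) (weight_nonneg hp₀ hp hp₁ η n x)
      _ = _ := by
          simp_rw [mul_add, Finset.sum_add_distrib]
          rw [← Finset.sum_mul, sum_weight, one_mul]

end Environment

/-! ### Refreshing the environment by sprinkling -/

namespace Environment

variable {T : Type} [CommSemiring T] [LinearOrder T] {E : Environment T} {p₀ p₁ ν : ℝ}

/-- Up to probability `e`, a regular configuration of density `ρ + ε` can be made to dominate a
regular configuration of density `ρ` at time `t`, away from the boundary of `[-H, H]`. -/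
def Covers (E : Environment T) (ν ρ ε : ℝ) (H t ℓ : ℕ) (e : ℝ) : Prop :=
  ∀ ζ' ∉ irregular ρ (ε / 4) H ℓ, ∀ ζ ∉ irregular (ρ + ε) (ε / 4) H ℓ,
    ∃ Q : Measure (EnvPath T × EnvPath T), IsCoupling Q (E.P ζ) (E.P ζ') ∧
      1 - e ≤ Q.real {ω | ∀ x : ℤ, |(x : ℝ)| ≤ H - 4 * ν * t → ω.2 (t : T) x ≤ ω.1 (t : T) x}

/-- The total error made when the environment is refreshed. -/
def refreshError (E : Environment T) (ν ρ ε : ℝ) (H L ℓ : ℕ) (e : ℝ) : ℝ :=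
  20 * Real.exp (-(ν * L / 4)) + e + (E.μ ρ).real (irregular ρ (ε / 4) H ℓ)
    + (E.μ (ρ + ε)).real (irregular (ρ + ε) (ε / 4) H ℓ)

lemma window_le {n t L H' : ℕ} (hH' : (n : ℝ) + t + L + 2 * ν * L ≤ H') {x y : ℤ}
    (hx : |x| ≤ (n : ℤ)) (hy : |y| ≤ (t : ℤ)) : |((x + y : ℤ) : ℝ)| + L + 2 * ν * L ≤ H' := by
  have h1 : |((x + y : ℤ) : ℝ)| ≤ n + t := by
    have := (abs_add_le x y).trans (add_le_add hx hy)
    exact_mod_cast this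
  linarith

/-- The law of the walk at density `ρ` after a refreshment of its environment is dominated by that
of a walk in an independent environment of density `ρ + ε`. -/
lemma integral_walkLaw_le_of_covers [IsStrictOrderedRing T] (hdrift : E.NoDriftingIn ν)
    (hp₀ : 0 ≤ p₀) (hp : p₀ ≤ p₁) (hp₁ : p₁ ≤ 1) {ρ ε : ℝ} (hρ : ρ ∈ E.J) (hρε : ρ + ε ∈ E.J)
    {n t L H H' ℓ : ℕ} {e : ℝ} (he : 0 ≤ e) (hcov : E.Covers ν ρ ε H t ℓ e)
    (hH' : (n : ℝ) + t + L + 2 * ν * L ≤ H') (hH : (H' : ℝ) ≤ H - 4 * ν * t)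
    {Φ : ℤ → ℝ} (hΦ : Monotone Φ) {M : ℝ} (h0 : ∀ x, 0 ≤ Φ x) (hM : ∀ x, Φ x ≤ M) :
    ∫ x, Φ x ∂(E.walkLaw p₀ p₁ ρ (n + (t + L)))
      ≤ ∫ x, ∫ y, Φ (x + t + y) ∂(E.walkLaw p₀ p₁ (ρ + ε) L) ∂(E.walkLaw p₀ p₁ ρ n)
        + M * E.refreshError ν ρ ε H L ℓ e := by
  have hM0 : 0 ≤ M := (h0 0).trans (hM 0)
  have := E.isProbabilityMeasure_walkLaw (p₀ := p₀) (p₁ := p₁) hρε L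
  have := E.isProbabilityMeasure_μ _ hρε
  have hpm := hΦ.parityMono
  refine (integral_walkLaw_add_le hp₀ hp hp₁ hρ n (t + L) h0 hM
    (c := fun x => ∫ y, Φ (x + t + y) ∂(E.walkLaw p₀ p₁ (ρ + ε) L))
    (e := M * (20 * Real.exp (-(ν * L / 4)) + e)
      + M * (E.μ (ρ + ε)).real (irregular (ρ + ε) (ε / 4) H ℓ))
    (fun x => integral_nonneg fun y => h0 _)
    (fun x => integral_le_of_forall_le (fun y => h0 _) fun y => hM _)
    (measurableSet_irregular ρ (ε / 4) H ℓ) (fun x hx ζ' hζ' => ?_) (by positivity)).trans_eq ?_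
  -- During the refreshment the walk is credited with its largest possible displacement `t`.
  · have h1 : ∫ η, quenched p₀ p₁ η (t + L) Φ x ∂(E.P ζ') ≤ E.delayed p₀ p₁ t L Φ (x + t) ζ' := by
      refine integral_mono_of_nonneg
        (Eventually.of_forall fun η => quenched_nonneg hp₀ hp hp₁ η _ h0 x)
        (integrable_of_bounded ((measurable_quenched L Φ _).comp (measurable_shift _ _))
          (fun η => quenched_nonneg hp₀ hp hp₁ _ L h0 _)
          fun η => quenched_le hp₀ hp hp₁ _ L hM _)
        (Eventually.of_forall fun η => ?_)
      simp only [quenched_add]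
      exact quenched_le_add hp₀ hp hp₁ η t (hpm.quenched hp₀ hp hp₁ _ L) x
    refine h1.trans ?_
    rw [← integral_delayed hp₀ hp hp₁ hρε t L h0 hM, ← add_assoc]
    -- The value at `ζ'` is averaged over an independent `ζ` of density `ρ + ε`, so that it can be
    -- compared pointwise with the value at a regular `ζ`.
    have h2 : E.delayed p₀ p₁ t L Φ (x + t) ζ'
        = ∫ _, E.delayed p₀ p₁ t L Φ (x + t) ζ' ∂(E.μ (ρ + ε)) := by simp
    rw [h2]
    refine integral_le_add_measureReal (fun _ => delayed_nonneg hp₀ hp hp₁ t L h0 _ _)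
      (integrable_of_bounded (measurable_delayed t L Φ _)
        (fun _ => delayed_nonneg hp₀ hp hp₁ t L h0 _ _)
        fun _ => delayed_le hp₀ hp hp₁ t L h0 hM _ _)
      (measurableSet_irregular (ρ + ε) (ε / 4) H ℓ) fun ζ => ?_
    by_cases hζ : ζ ∈ irregular (ρ + ε) (ε / 4) H ℓ
    · rw [indicator_of_mem hζ]
      have := delayed_le hp₀ hp hp₁ t L h0 hM (x + t) ζ' (E := E)
      have := delayed_nonneg hp₀ hp hp₁ t L h0 (x + t) ζ (E := E)
      have : 0 ≤ M * (20 * Real.exp (-(ν * L / 4)) + e) := by positivity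
      linarith
    · rw [indicator_of_notMem hζ, add_zero]
      obtain ⟨Q, hQ, hQe⟩ := hcov ζ' hζ' ζ hζ
      exact delayed_le_of_coupling hdrift hp₀ hp hp₁ (window_le hH' hx (by simp)) hH hQ hQe hpm
        h0 hM
  · rw [refreshError]; ring

/-- The law of the walk at density `ρ + ε` after a refreshment of its environment dominates that
of a walk in an independent environment of density `ρ`. -/
lemma integral_walkLaw_le_of_covers' [IsStrictOrderedRing T] (hdrift : E.NoDriftingIn ν)
    (hp₀ : 0 ≤ p₀) (hp : p₀ ≤ p₁) (hp₁ : p₁ ≤ 1) {ρ ε : ℝ} (hρ : ρ ∈ E.J) (hρε : ρ + ε ∈ E.J)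
    {n t L H H' ℓ : ℕ} {e : ℝ} (he : 0 ≤ e) (hcov : E.Covers ν ρ ε H t ℓ e)
    (hH' : (n : ℝ) + t + L + 2 * ν * L ≤ H') (hH : (H' : ℝ) ≤ H - 4 * ν * t)
    {Φ : ℤ → ℝ} (hΦ : Antitone Φ) {M : ℝ} (h0 : ∀ x, 0 ≤ Φ x) (hM : ∀ x, Φ x ≤ M) :
    ∫ x, Φ x ∂(E.walkLaw p₀ p₁ (ρ + ε) (n + (t + L)))
      ≤ ∫ x, ∫ y, Φ (x - t + y) ∂(E.walkLaw p₀ p₁ ρ L) ∂(E.walkLaw p₀ p₁ (ρ + ε) n)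
        + M * E.refreshError ν ρ ε H L ℓ e := by
  have hM0 : 0 ≤ M := (h0 0).trans (hM 0)
  have := E.isProbabilityMeasure_walkLaw (p₀ := p₀) (p₁ := p₁) hρ L
  have := E.isProbabilityMeasure_μ _ hρ
  -- Domination pushes `M - Φ` upwards, hence `Φ` downwards. The complement stays in `[0, M]`.
  have hpm : ParityMono fun x => M - Φ x := fun x => by
    have := hΦ (show x ≤ x + 2 by omega)
    dsimp only; linarith
  have h0' : ∀ x, 0 ≤ M - Φ x := fun x => sub_nonneg.2 (hM x)
  have hM' : ∀ x, M - Φ x ≤ M := fun x => sub_le_self _ (h0 x)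
  have hsub : ∀ (η : EnvPath T) (m : ℕ) (x : ℤ),
      quenched p₀ p₁ η m (fun x => M - Φ x) x = M - quenched p₀ p₁ η m Φ x := fun η m x => by
    rw [quenched_sub, quenched_const]
  have hdel : ∀ (y : ℤ) (ζ : Config),
      E.delayed p₀ p₁ t L (fun x => M - Φ x) y ζ = M - E.delayed p₀ p₁ t L Φ y ζ := fun y ζ => by
    have hi : Integrable (fun η => quenched p₀ p₁ (shift (t : T) 0 η) L Φ y) (E.P ζ) :=
      integrable_of_bounded ((measurable_quenched L Φ y).comp (measurable_shift _ _))
        (fun η => quenched_nonneg hp₀ hp hp₁ _ L h0 _) fun η => quenched_le hp₀ hp hp₁ _ L hM _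
    simp only [delayed, hsub]
    rw [integral_sub (integrable_const _) hi]
    simp
  refine (integral_walkLaw_add_le hp₀ hp hp₁ hρε n (t + L) h0 hM
    (c := fun x => ∫ y, Φ (x - t + y) ∂(E.walkLaw p₀ p₁ ρ L))
    (e := M * (20 * Real.exp (-(ν * L / 4)) + e)
      + M * (E.μ ρ).real (irregular ρ (ε / 4) H ℓ))
    (fun x => integral_nonneg fun y => h0 _)
    (fun x => integral_le_of_forall_le (fun y => h0 _) fun y => hM _)
    (measurableSet_irregular (ρ + ε) (ε / 4) H ℓ) (fun x hx ζ hζ => ?_)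
    (by positivity)).trans_eq ?_
  · have h1 : ∫ η, quenched p₀ p₁ η (t + L) Φ x ∂(E.P ζ) ≤ E.delayed p₀ p₁ t L Φ (x - t) ζ := by
      refine integral_mono_of_nonneg
        (Eventually.of_forall fun η => quenched_nonneg hp₀ hp hp₁ η _ h0 x)
        (integrable_of_bounded ((measurable_quenched L Φ _).comp (measurable_shift _ _))
          (fun η => quenched_nonneg hp₀ hp hp₁ _ L h0 _)
          fun η => quenched_le hp₀ hp hp₁ _ L hM _)
        (Eventually.of_forall fun η => ?_)
      have h := le_quenched_sub hp₀ hp hp₁ η t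
        (hpm.quenched hp₀ hp hp₁ (shift (t : T) 0 η) L) x
      rw [← quenched_add, hsub, hsub] at h
      dsimp only; linarith
    refine h1.trans ?_
    rw [← integral_delayed hp₀ hp hp₁ hρ t L h0 hM, ← add_assoc]
    have h2 : E.delayed p₀ p₁ t L Φ (x - t) ζ
        = ∫ _, E.delayed p₀ p₁ t L Φ (x - t) ζ ∂(E.μ ρ) := by simp
    rw [h2]
    refine integral_le_add_measureReal (fun _ => delayed_nonneg hp₀ hp hp₁ t L h0 _ _)
      (integrable_of_bounded (measurable_delayed t L Φ _)
        (fun _ => delayed_nonneg hp₀ hp hp₁ t L h0 _ _)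
        fun _ => delayed_le hp₀ hp hp₁ t L h0 hM _ _)
      (measurableSet_irregular ρ (ε / 4) H ℓ) fun ζ' => ?_
    by_cases hζ' : ζ' ∈ irregular ρ (ε / 4) H ℓ
    · rw [indicator_of_mem hζ']
      have := delayed_le hp₀ hp hp₁ t L h0 hM (x - t) ζ (E := E)
      have := delayed_nonneg hp₀ hp hp₁ t L h0 (x - t) ζ' (E := E)
      have : 0 ≤ M * (20 * Real.exp (-(ν * L / 4)) + e) := by positivity
      linarith
    · rw [indicator_of_notMem hζ', add_zero]
      obtain ⟨Q, hQ, hQe⟩ := hcov ζ' hζ' ζ hζ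
      have := delayed_le_of_coupling hdrift hp₀ hp hp₁
        (window_le hH' hx (y := -t) (by simp)) hH hQ hQe hpm h0' hM'
      rw [hdel, hdel, ← sub_eq_add_neg] at this
      linarith
  · rw [refreshError]; ring

/-- Deviations below `ε / 4` from `ρ + ε` and from `ρ` are exactly what the thresholds `ρ + 3ε/4`
and `ρ + ε/4` tolerate. -/
lemma covers_of_covering {ν ρ ε e : ℝ} {H t : ℕ}
    (h : ∀ η₀ η₀' : Config,
      (∀ a b : ℤ, -(H : ℤ) ≤ a → a ≤ b → b ≤ H →
        ⌊(t : ℝ) ^ (1 / 4 : ℝ)⌋ / 2 ≤ b - a + 1 → b - a + 1 ≤ ⌊(t : ℝ) ^ (1 / 4 : ℝ)⌋ →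
          (ρ + 3 * ε / 4) * ((b - a + 1 : ℤ) : ℝ) ≤ count η₀ a b ∧
          (count η₀' a b : ℝ) ≤ (ρ + ε / 4) * ((b - a + 1 : ℤ) : ℝ)) →
      ∃ Q : Measure (EnvPath T × EnvPath T), IsCoupling Q (E.P η₀) (E.P η₀') ∧
        1 - e ≤ Q.real {ω | ∀ x : ℤ, |(x : ℝ)| ≤ H - 4 * ν * t →
            ω.2 (t : T) x ≤ ω.1 (t : T) x}) :
    E.Covers ν ρ ε H t ⌊(t : ℝ) ^ (1 / 4 : ℝ)⌋₊ e := by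
  have hℓ : ((⌊(t : ℝ) ^ (1 / 4 : ℝ)⌋₊ : ℕ) : ℤ) = ⌊(t : ℝ) ^ (1 / 4 : ℝ)⌋ :=
    Int.natCast_floor_eq_floor (by positivity)
  intro ζ' hζ' ζ hζ
  refine h ζ ζ' fun a b ha hab hb h1 h2 => ?_
  rw [← hℓ] at h1 h2
  have k1 := (abs_lt.1 (abs_count_sub_lt hζ ha hab hb h1 h2)).1
  have k2 := (abs_lt.1 (abs_count_sub_lt hζ' ha hab hb h1 h2)).2
  constructor <;> linarith

end Environment

/-! ### Asymptotic estimates -/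

lemma tendsto_natCast_rpow {a : ℝ} (ha : 0 < a) :
    Tendsto (fun L : ℕ => (L : ℝ) ^ a) atTop atTop :=
  (tendsto_rpow_atTop ha).comp tendsto_natCast_atTop_atTop

lemma eventually_sq_mul_exp_le {c : ℝ} (hc : 0 < c) (D : ℝ) :
    ∀ᶠ L : ℕ in atTop, D * (L : ℝ) ^ 2 * Real.exp (-(c * (L : ℝ) ^ (1 / 10 : ℝ)))
      ≤ Real.exp (-(L : ℝ) ^ (1 / 20 : ℝ)) := by
  have h1 : ∀ᶠ y : ℝ in atTop, D * (y ^ 40 * Real.exp (-y)) < 1 := by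
    have := (Real.tendsto_pow_mul_exp_neg_atTop_nhds_zero 40).const_mul D
    rw [mul_zero] at this
    exact this.eventually_lt_const one_pos
  have h2 : ∀ᶠ y : ℝ in atTop, 2 / c ≤ y := eventually_ge_atTop _
  filter_upwards [(tendsto_natCast_rpow (a := 1 / 20) (by norm_num)).eventually (h1.and h2)]
    with L ⟨h, hy⟩
  set y := (L : ℝ) ^ (1 / 20 : ℝ) with hyd
  have e1 : (L : ℝ) ^ 2 = y ^ 40 := by
    rw [hyd, ← Real.rpow_natCast (_ ^ _), ← Real.rpow_mul (by positivity), ← Real.rpow_natCast]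
    norm_num
  have e2 : (L : ℝ) ^ (1 / 10 : ℝ) = y ^ 2 := by
    rw [hyd, ← Real.rpow_natCast (_ ^ _), ← Real.rpow_mul (by positivity)]
    norm_num
  have hy0 : 0 ≤ y := by positivity
  have h3 : Real.exp (-(c * y ^ 2)) ≤ Real.exp (-y) * Real.exp (-y) := by
    rw [← Real.exp_add, Real.exp_le_exp]
    rw [div_le_iff₀ hc] at hy
    nlinarith
  rw [e1, e2]
  by_cases hD : 0 ≤ D
  · calc D * y ^ 40 * Real.exp (-(c * y ^ 2))
        ≤ D * y ^ 40 * (Real.exp (-y) * Real.exp (-y)) := by gcongr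
      _ = D * (y ^ 40 * Real.exp (-y)) * Real.exp (-y) := by ring
      _ ≤ 1 * Real.exp (-y) := by gcongr
      _ = _ := one_mul _
  · have : D * y ^ 40 * Real.exp (-(c * y ^ 2)) ≤ 0 := by
      have : 0 ≤ y ^ 40 * Real.exp (-(c * y ^ 2)) := by positivity
      rw [mul_assoc]; exact mul_nonpos_of_nonpos_of_nonneg (le_of_not_ge hD) this
    exact this.trans (Real.exp_pos _).le

lemma half_rpow_le_sqrt {L : ℕ} (hL : 16 ≤ L) : (L : ℝ) ^ (1 / 2 : ℝ) / 2 ≤ Nat.sqrt L := by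
  have h1 : L < (Nat.sqrt L + 1) ^ 2 := by rw [sq]; exact Nat.lt_succ_sqrt L
  have h2 : 4 ≤ Nat.sqrt L := Nat.le_sqrt.2 hL
  have h3 : (L : ℝ) ≤ (2 * Nat.sqrt L) ^ 2 := by
    have : L ≤ (2 * Nat.sqrt L) ^ 2 := h1.le.trans (Nat.pow_le_pow_left (by omega) 2)
    exact_mod_cast this
  have := Real.sqrt_le_sqrt h3
  rw [Real.sqrt_sq (by positivity), Real.sqrt_eq_rpow] at this
  linarith

lemma rpow_eighth_le_sqrt_rpow {L : ℕ} (hL : 16 ≤ L) :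
    (L : ℝ) ^ (1 / 8 : ℝ) / 2 ≤ (Nat.sqrt L : ℝ) ^ (1 / 4 : ℝ) := by
  have h1 := Real.rpow_le_rpow (by positivity) (half_rpow_le_sqrt hL)
    (show (0 : ℝ) ≤ 1 / 4 by norm_num)
  rw [Real.div_rpow (by positivity) (by norm_num), ← Real.rpow_mul (by positivity)] at h1
  norm_num at h1 ⊢
  refine le_trans ?_ h1
  gcongr
  calc (2 : ℝ) ^ (1 / 4 : ℝ) ≤ 2 ^ (1 : ℝ) :=
        Real.rpow_le_rpow_of_exponent_le (by norm_num) (by norm_num)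
    _ = 2 := by norm_num

/-- The growth condition of the covering property for `t = √L`, with `ε⁻²` replaced by its largest
value `L ^ (1/50)`. The cubed logarithm costs at most a power `1/20`, through `log x ≤ 30 x ^
(1/30)`, and `1/50 + 1/20 = 7/100` falls short of the exponent `1/8` of `t ^ (1/4)` by `11/200`. -/
lemma eventually_log_cond {ν : ℝ} (hν : 0 < ν) {C : ℝ} (hC : 0 < C) :
    ∀ᶠ L : ℕ in atTop, C * (L : ℝ) ^ (1 / 50 : ℝ) * (1 + |Real.log (ν * Nat.sqrt L) ^ 3|)
      < ν * (Nat.sqrt L : ℝ) ^ (1 / 4 : ℝ) := by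
  have hsq : Tendsto (fun L : ℕ => ν * (L : ℝ) ^ (1 / 2 : ℝ) / 2) atTop atTop :=
    ((tendsto_natCast_rpow (by norm_num)).const_mul_atTop hν).atTop_div_const (by norm_num)
  have hbig := (tendsto_natCast_rpow (a := 11 / 200) (by norm_num)).eventually_gt_atTop
    (2 * C * (1 + 27000 * ν ^ (1 / 10 : ℝ)) / ν)
  filter_upwards [eventually_ge_atTop 16, hsq.eventually_ge_atTop 1, hbig] with L hL h1 h2
  have hL1 : (1 : ℝ) ≤ L := by exact_mod_cast (by omega : 1 ≤ L)
  have hL0 : (0 : ℝ) < L := by linarith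
  have ht := half_rpow_le_sqrt hL
  have hs1 : 1 ≤ ν * Nat.sqrt L := by
    refine h1.trans ?_
    rw [mul_div_assoc]; gcongr
  have hlog0 : 0 ≤ Real.log (ν * Nat.sqrt L) := Real.log_nonneg hs1
  have htL : (Nat.sqrt L : ℝ) ≤ L ^ (1 / 2 : ℝ) := by
    rw [← Real.sqrt_eq_rpow]; exact Real.nat_sqrt_le_real_sqrt
  have hlog : Real.log (ν * Nat.sqrt L) ^ 3
      ≤ 27000 * (ν ^ (1 / 10 : ℝ) * (L : ℝ) ^ (1 / 20 : ℝ)) := by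
    have h3 := Real.log_le_rpow_div (show 0 ≤ ν * Nat.sqrt L by linarith)
      (show (0 : ℝ) < 1 / 30 by norm_num)
    have h4 := pow_le_pow_left₀ hlog0 h3 3
    refine h4.trans ?_
    rw [div_pow, ← Real.rpow_natCast, ← Real.rpow_mul (by linarith)]
    have h5 : (ν * Nat.sqrt L) ^ (1 / 30 * ((3 : ℕ) : ℝ))
        ≤ (ν * (L : ℝ) ^ (1 / 2 : ℝ)) ^ (1 / 30 * ((3 : ℕ) : ℝ)) := by gcongr
    have h6 : (ν * (L : ℝ) ^ (1 / 2 : ℝ)) ^ (1 / 30 * ((3 : ℕ) : ℝ))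
        = ν ^ (1 / 10 : ℝ) * (L : ℝ) ^ (1 / 20 : ℝ) := by
      rw [Real.mul_rpow hν.le (by positivity), ← Real.rpow_mul hL0.le]; norm_num
    rw [h6] at h5
    norm_num at h5 ⊢
    linarith
  have hone : (1 : ℝ) ≤ (L : ℝ) ^ (1 / 20 : ℝ) := Real.one_le_rpow hL1 (by norm_num)
  rw [abs_of_nonneg (pow_nonneg hlog0 3)]
  rw [div_lt_iff₀ hν] at h2
  calc C * (L : ℝ) ^ (1 / 50 : ℝ) * (1 + Real.log (ν * Nat.sqrt L) ^ 3)
      ≤ C * (L : ℝ) ^ (1 / 50 : ℝ) * ((L : ℝ) ^ (1 / 20 : ℝ)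
          + 27000 * (ν ^ (1 / 10 : ℝ) * (L : ℝ) ^ (1 / 20 : ℝ))) := by gcongr
    _ = C * (1 + 27000 * ν ^ (1 / 10 : ℝ)) * ((L : ℝ) ^ (1 / 50 : ℝ) * (L : ℝ) ^ (1 / 20 : ℝ)) := by
        ring
    _ = C * (1 + 27000 * ν ^ (1 / 10 : ℝ)) * (L : ℝ) ^ (7 / 100 : ℝ) := by
        rw [← Real.rpow_add hL0]; norm_num
    _ < (L : ℝ) ^ (11 / 200 : ℝ) * ν / 2 * (L : ℝ) ^ (7 / 100 : ℝ) := by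
        gcongr
        linarith
    _ = ν * ((L : ℝ) ^ (11 / 200 : ℝ) * (L : ℝ) ^ (7 / 100 : ℝ) / 2) := by ring
    _ = ν * ((L : ℝ) ^ (1 / 8 : ℝ) / 2) := by
        rw [← Real.rpow_add hL0]; norm_num
    _ ≤ _ := by gcongr; exact rpow_eighth_le_sqrt_rpow hL

namespace Environment

variable {T : Type} [CommSemiring T] [LinearOrder T] {E : Environment T} {p₀ p₁ ν : ℝ}

/-- For a sprinkling `ε ≥ L ^ (-1/100)`, the environment can be refreshed in time `√L` up to a
stretched exponentially small error. -/
lemma exists_refreshError_le (hν : 0 < ν) (hcover : E.Covering ν) :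
    ∃ L₀ : ℕ, ∀ L : ℕ, L₀ ≤ L → ∀ ρ ε : ℝ, ρ ∈ E.J → ρ + ε ∈ E.J → ε < 1 →
      (L : ℝ) ^ (-(1 / 100) : ℝ) ≤ ε → ∀ n : ℕ, ∃ (ℓ H H' : ℕ) (e : ℝ), 0 ≤ e ∧
        E.Covers ν ρ ε H (Nat.sqrt L) ℓ e ∧
        (n : ℝ) + Nat.sqrt L + L + 2 * ν * L ≤ H' ∧ (H' : ℝ) ≤ H - 4 * ν * Nat.sqrt L ∧
        E.refreshError ν ρ ε H L ℓ e ≤ (n + 1) * Real.exp (-(L : ℝ) ^ (1 / 20 : ℝ)) := by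
  obtain ⟨C, C', hC, hC', hcov⟩ := hcover
  obtain ⟨c₁, hc₁, hdens⟩ := E.density
  set c₂ := (C' * (1 + ν⁻¹))⁻¹ with hc₂d
  have hc₂ : 0 < c₂ := by positivity
  set A := 6 * ν + 5 with hA
  have hA0 : 0 < A := by positivity
  -- One rate for the three kinds of error: drift from the side, failed covering, irregular density.
  -- The `128` collects `(ε/4) ^ 2`, the bound `t ^ (1/4) / 4` on half the interval length, and the
  -- `2` of `hexp`.
  set c := min (ν / 4) (min (c₂ / 2) (c₁ / 128)) with hcd
  have hc : 0 < c := lt_min (by positivity) (lt_min (by positivity) (by positivity))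
  clear_value c c₂ A
  have hev : ∀ᶠ L : ℕ in atTop, 1 < ν ^ 8 * (Nat.sqrt L : ℝ) := by
    have hsq : Tendsto (fun L : ℕ => ν ^ 8 * ((L : ℝ) ^ (1 / 2 : ℝ) / 2)) atTop atTop :=
      ((tendsto_natCast_rpow (by norm_num)).atTop_div_const (by norm_num)).const_mul_atTop
        (by positivity)
    filter_upwards [hsq.eventually_gt_atTop 1, eventually_ge_atTop 16] with L h hL
    refine h.trans_le ?_
    gcongr; exact half_rpow_le_sqrt hL
  have hev2 : ∀ᶠ L : ℕ in atTop, (8 : ℝ) ≤ (L : ℝ) ^ (1 / 8 : ℝ) :=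
    (tendsto_natCast_rpow (by norm_num)).eventually_ge_atTop 8
  obtain ⟨L₀, hL₀⟩ := eventually_atTop.1 ((eventually_log_cond hν hC).and (hev.and (hev2.and
    ((eventually_sq_mul_exp_le hc (20 + C' * A + (8 * A + 4))).and (eventually_ge_atTop 16)))))
  refine ⟨L₀, fun L hL ρ ε hρ hρε hε1 hε n => ?_⟩
  obtain ⟨hlog, hν8, h8, herr, hL16⟩ := hL₀ L hL
  have hL1 : (1 : ℝ) ≤ L := by exact_mod_cast (by omega : 1 ≤ L)
  have hL0 : (0 : ℝ) < L := by linarith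
  have hε0 : 0 < ε := lt_of_lt_of_le (by positivity) hε
  set t := Nat.sqrt L with ht
  have ht1 : 1 ≤ t := (by norm_num : 1 ≤ 4).trans (Nat.le_sqrt.2 hL16)
  have htL : (t : ℝ) ≤ L := by exact_mod_cast Nat.sqrt_le_self L
  have ht4 := rpow_eighth_le_sqrt_rpow hL16
  rw [← ht] at ht4
  clear_value t
  have hε2 : (L : ℝ) ^ (-(1 / 50) : ℝ) ≤ ε ^ 2 := by
    have := pow_le_pow_left₀ (by positivity) hε 2
    rw [← Real.rpow_natCast, ← Real.rpow_mul hL0.le] at this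
    norm_num at this ⊢
    exact this
  -- This fixes the exponents: `ε² ≥ L ^ (-1/50)` and `t ^ (1/4)` is of order `L ^ (1/8)`, so their
  -- product is of order at least `L ^ (21/200)`, above `L ^ (1/10)`.
  have hexp : (L : ℝ) ^ (1 / 10 : ℝ) / 2 ≤ ε ^ 2 * (t : ℝ) ^ (1 / 4 : ℝ) := by
    calc (L : ℝ) ^ (1 / 10 : ℝ) / 2 ≤ (L : ℝ) ^ (-(1 / 50) + 1 / 8 : ℝ) / 2 := by
          gcongr
          norm_num
      _ = (L : ℝ) ^ (-(1 / 50) : ℝ) * ((L : ℝ) ^ (1 / 8 : ℝ) / 2) := by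
          rw [Real.rpow_add hL0]; ring
      _ ≤ _ := by gcongr
  set ℓ := ⌊(t : ℝ) ^ (1 / 4 : ℝ)⌋₊ with hℓ
  have hℓt : (t : ℝ) ^ (1 / 4 : ℝ) - 1 ≤ ℓ := (Nat.sub_one_lt_floor _).le
  have hℓL : (ℓ : ℝ) ≤ L := by
    refine (Nat.floor_le (by positivity)).trans (le_trans ?_ htL)
    calc (t : ℝ) ^ (1 / 4 : ℝ) ≤ (t : ℝ) ^ (1 : ℝ) :=
          Real.rpow_le_rpow_of_exponent_le (by exact_mod_cast ht1) (by norm_num)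
      _ = t := Real.rpow_one _
  -- Absorbing the two roundings needs `t ^ (1/4) ≥ 4`, which is what `h8` provides.
  have hℓ1 : (t : ℝ) ^ (1 / 4 : ℝ) / 4 ≤ ((ℓ : ℝ) - 1) / 2 := by linarith
  set H' := ⌈(n : ℝ) + t + L + 2 * ν * L⌉₊ with hH'
  have hH'1 : (n : ℝ) + t + L + 2 * ν * L ≤ H' := Nat.le_ceil _
  have hH'2 : (H' : ℝ) < (n : ℝ) + t + L + 2 * ν * L + 1 := Nat.ceil_lt_add_one (by positivity)
  set H := ⌈(H' : ℝ) + 4 * ν * t⌉₊ with hH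
  have hH1 : (H' : ℝ) + 4 * ν * t ≤ H := Nat.le_ceil _
  have hH2 : (H : ℝ) < (H' : ℝ) + 4 * ν * t + 1 := Nat.ceil_lt_add_one (by positivity)
  have hνL : 0 < ν * L := by positivity
  have hHpos : 4 * ν * t < H := by
    have : (0 : ℝ) ≤ n := by positivity
    have : (0 : ℝ) ≤ t := by positivity
    linarith
  have hHA : (H : ℝ) ≤ (n + 1) * A * L := by
    have h1 : ν * t ≤ ν * L := by gcongr
    have h2 : (0 : ℝ) ≤ n * (A * L - 1) := by
      have : 1 ≤ A * L := one_le_mul_of_one_le_of_one_le (by linarith) hL1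
      have := sub_nonneg.2 this
      positivity
    have h3 : ((n : ℝ) + 1) * A * L = n * (A * L - 1) + n + 6 * (ν * L) + 5 * L := by
      rw [hA]; ring
    linarith
  have hH0 : 1 ≤ H := by
    have : (0 : ℝ) < H := lt_of_le_of_lt (by positivity) hHpos
    exact_mod_cast this
  have hcond : C * (ε ^ 2)⁻¹ * (1 + |Real.log (ν * t) ^ 3|) < ν * (t : ℝ) ^ (1 / 4 : ℝ) := by
    refine lt_of_le_of_lt ?_ hlog
    gcongr
    rw [inv_le_comm₀ (by positivity) (by positivity), ← Real.rpow_neg hL0.le]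
    exact hε2
  have hcv := covers_of_covering (hcov ρ hρ ε ⟨hε0, hε1⟩ hρε H t hH0 ht1 hHpos hν8 hcond)
  refine ⟨ℓ, H, H', _, by positivity, hcv, hH'1, by linarith, ?_⟩
  set X := Real.exp (-(c * (L : ℝ) ^ (1 / 10 : ℝ))) with hX
  have hX0 : 0 < X := Real.exp_pos _
  clear_value X H H' ℓ
  have hL10 : (0 : ℝ) ≤ (L : ℝ) ^ (1 / 10 : ℝ) := by positivity
  have b1 : Real.exp (-(ν * L / 4)) ≤ X := by
    rw [hX, Real.exp_le_exp, neg_le_neg_iff]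
    have h1 : (L : ℝ) ^ (1 / 10 : ℝ) ≤ L := by
      calc (L : ℝ) ^ (1 / 10 : ℝ) ≤ (L : ℝ) ^ (1 : ℝ) :=
            Real.rpow_le_rpow_of_exponent_le hL1 (by norm_num)
        _ = L := Real.rpow_one _
    calc c * (L : ℝ) ^ (1 / 10 : ℝ) ≤ ν / 4 * L :=
          mul_le_mul (hcd ▸ min_le_left _ _) h1 hL10 (by positivity)
      _ = ν * L / 4 := by ring
  have b2 : Real.exp (-(c₂ * ε ^ 2 * (t : ℝ) ^ (1 / 4 : ℝ))) ≤ X := by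
    rw [hX, Real.exp_le_exp, neg_le_neg_iff]
    calc c * (L : ℝ) ^ (1 / 10 : ℝ) ≤ c₂ / 2 * (L : ℝ) ^ (1 / 10 : ℝ) := by
          gcongr; rw [hcd]; exact (min_le_right _ _).trans (min_le_left _ _)
      _ = c₂ * ((L : ℝ) ^ (1 / 10 : ℝ) / 2) := by ring
      _ ≤ c₂ * (ε ^ 2 * (t : ℝ) ^ (1 / 4 : ℝ)) := by gcongr
      _ = _ := by ring
  have b3 : Real.exp (-c₁ * (ε / 4) ^ 2 * (((ℓ : ℝ) - 1) / 2)) ≤ X := by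
    rw [hX, Real.exp_le_exp]
    have : c * (L : ℝ) ^ (1 / 10 : ℝ) ≤ c₁ * (ε / 4) ^ 2 * (((ℓ : ℝ) - 1) / 2) := by
      calc c * (L : ℝ) ^ (1 / 10 : ℝ) ≤ c₁ / 128 * (L : ℝ) ^ (1 / 10 : ℝ) := by
            gcongr; rw [hcd]; exact (min_le_right _ _).trans (min_le_right _ _)
        _ = c₁ / 64 * ((L : ℝ) ^ (1 / 10 : ℝ) / 2) := by ring
        _ ≤ c₁ / 64 * (ε ^ 2 * (t : ℝ) ^ (1 / 4 : ℝ)) := by gcongr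
        _ = c₁ * (ε / 4) ^ 2 * ((t : ℝ) ^ (1 / 4 : ℝ) / 4) := by ring
        _ ≤ _ := by gcongr
    linarith
  have hε4 : ε / 4 ∈ Ioo (0 : ℝ) 1 := ⟨by positivity, by linarith⟩
  have hn0 : (0 : ℝ) ≤ n := by positivity
  have irr : ∀ ρ' ∈ E.J, (E.μ ρ').real (irregular ρ' (ε / 4) H ℓ)
      ≤ (n + 1) * ((4 * A + 2) * L ^ 2) * X := by
    intro ρ' hρ'
    refine (E.measureReal_irregular_le hc₁ hρ' hε4 (hdens ρ' hρ') H ℓ).trans ?_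
    calc (2 * (H : ℝ) + 1) * (ℓ * (2 * Real.exp (-c₁ * (ε / 4) ^ 2 * (((ℓ : ℝ) - 1) / 2))))
        ≤ (2 * ((n + 1) * A * L) + (n + 1) * L) * (L * (2 * X)) := by
          gcongr
          exact one_le_mul_of_one_le_of_one_le (by linarith) hL1
      _ = _ := by ring
  have i1 := irr ρ hρ
  have i2 := irr (ρ + ε) hρε
  have b4 : C' * t * H * Real.exp (-(c₂ * ε ^ 2 * (t : ℝ) ^ (1 / 4 : ℝ)))
      ≤ (n + 1) * (C' * A * L ^ 2) * X := by
    calc _ ≤ C' * L * ((n + 1) * A * L) * X := by gcongr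
      _ = _ := by ring
  have b5 : 20 * Real.exp (-(ν * L / 4)) ≤ (n + 1) * (20 * L ^ 2) * X := by
    have h1 : (1 : ℝ) ≤ (n + 1) * L ^ 2 :=
      one_le_mul_of_one_le_of_one_le (by linarith) (one_le_pow₀ hL1)
    have h2 : 1 * X ≤ (n + 1) * L ^ 2 * X := by gcongr
    linarith
  rw [refreshError]
  calc _ ≤ (n + 1) * (20 * L ^ 2) * X + (n + 1) * (C' * A * L ^ 2) * X
        + (n + 1) * ((4 * A + 2) * L ^ 2) * X + (n + 1) * ((4 * A + 2) * L ^ 2) * X :=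
        add_le_add (add_le_add (add_le_add b5 b4) i1) i2
    _ = (n + 1) * ((20 + C' * A + (8 * A + 4)) * L ^ 2 * X) := by ring
    _ ≤ _ := by gcongr

end Environment

/-! ### Refreshment inequalities between families of laws on `ℤ` -/

/-- A family of probability measures on `ℤ`, the `n`-th of which is carried by `[-n, n]`. -/
structure IsWalkLaw (A : ℕ → Measure ℤ) : Prop where
  prob : ∀ n, IsProbabilityMeasure (A n)
  ae_abs_le : ∀ n : ℕ, ∀ᵐ x ∂(A n), |x| ≤ (n : ℤ)

lemma IsWalkLaw.integrable {A : ℕ → Measure ℤ} (hA : IsWalkLaw A) (n : ℕ) (f : ℤ → ℝ) :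
    Integrable f (A n) := by
  have := hA.prob n
  refine Integrable.of_bound (measurable_of_countable f).aestronglyMeasurable
    (∑ x ∈ Finset.Icc (-(n : ℤ)) n, ‖f x‖) ?_
  filter_upwards [hA.ae_abs_le n] with x hx
  exact Finset.single_le_sum (f := fun x => ‖f x‖) (fun _ _ => norm_nonneg _)
    (Finset.mem_Icc.2 (abs_le.1 hx))

/-- The family of laws of the reflected walk. -/
def reflect (A : ℕ → Measure ℤ) (n : ℕ) : Measure ℤ := (A n).map Neg.neg

lemma integral_reflect (A : ℕ → Measure ℤ) (n : ℕ) (f : ℤ → ℝ) :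
    ∫ x, f x ∂(reflect A n) = ∫ x, f (-x) ∂(A n) :=
  integral_map (measurable_of_countable _).aemeasurable
    (measurable_of_countable f).aestronglyMeasurable

lemma IsWalkLaw.reflect {A : ℕ → Measure ℤ} (hA : IsWalkLaw A) : IsWalkLaw (reflect A) where
  prob n := by
    have := hA.prob n
    exact Measure.isProbabilityMeasure_map (measurable_of_countable _).aemeasurable
  ae_abs_le n := by
    rw [RWDRE.reflect, ae_map_iff (measurable_of_countable _).aemeasurable
      MeasurableSet.of_discrete]
    filter_upwards [hA.ae_abs_le n] with x hx
    rwa [abs_neg]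

/-- The error made when the environment is refreshed at time `n` for a duration of order `L`. -/
def refreshRate (n L : ℕ) : ℝ := (n + 1) * Real.exp (-(L : ℝ) ^ (1 / 20 : ℝ))

lemma refreshRate_nonneg (n L : ℕ) : 0 ≤ refreshRate n L := by unfold refreshRate; positivity

/-- Up to a small error, the increment over a time `√L + L` under `A` is dominated by `√L` plus an
independent increment over a time `L` under `A'`. -/
def Refreshes (A A' : ℕ → Measure ℤ) (L : ℕ) : Prop :=
  ∀ n : ℕ, ∀ Φ : ℤ → ℝ, Monotone Φ →
    ∫ x, Φ x ∂(A (n + (Nat.sqrt L + L)))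
      ≤ ∫ x, ∫ y, Φ (x + Nat.sqrt L + y) ∂(A' L) ∂(A n)
        + (Φ ((n + (Nat.sqrt L + L) : ℕ) : ℤ) - Φ (-((n + (Nat.sqrt L + L) : ℕ) : ℤ)))
          * refreshRate n L

/-- It suffices to consider bounded functions. -/
lemma refreshes_of_bounded {A A' : ℕ → Measure ℤ} (hA : IsWalkLaw A) (hA' : IsWalkLaw A') {L : ℕ}
    (h : ∀ n : ℕ, ∀ Φ : ℤ → ℝ, Monotone Φ → ∀ M, (∀ x, 0 ≤ Φ x) → (∀ x, Φ x ≤ M) →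
      ∫ x, Φ x ∂(A (n + (Nat.sqrt L + L)))
        ≤ ∫ x, ∫ y, Φ (x + Nat.sqrt L + y) ∂(A' L) ∂(A n) + M * refreshRate n L) :
    Refreshes A A' L := by
  intro n Φ hΦ
  set R : ℤ := ((n + (Nat.sqrt L + L) : ℕ) : ℤ) with hR
  have hR0 : 0 ≤ R := by positivity
  -- Truncating `Φ` at `±R` changes nothing on the range of the walk. It leaves a bounded function
  -- whose oscillation is the factor in front of the error.
  set Ψ : ℤ → ℝ := fun x => Φ (max (-R) (min x R)) - Φ (-R) with hΨ
  have hΨm : Monotone Ψ := fun x y hxy =>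
    sub_le_sub_right (hΦ (max_le_max le_rfl (min_le_min hxy le_rfl))) _
  have hΨR : ∀ x, |x| ≤ R → Ψ x = Φ x - Φ (-R) := fun x hx => by
    rw [abs_le] at hx
    simp only [hΨ, min_eq_left hx.2, max_eq_right hx.1]
  have key := h n Ψ hΨm (Φ R - Φ (-R)) (fun x => sub_nonneg.2 (hΦ (le_max_left _ _)))
    (fun x => sub_le_sub_right (hΦ (max_le (by omega) (min_le_right _ _))) _)
  have := hA.prob (n + (Nat.sqrt L + L))
  have := hA.prob n
  have := hA'.prob L
  have e1 : ∫ x, Ψ x ∂(A (n + (Nat.sqrt L + L)))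
      = ∫ x, Φ x ∂(A (n + (Nat.sqrt L + L))) - Φ (-R) := by
    rw [integral_congr_ae (g := fun x => Φ x - Φ (-R)),
      integral_sub (hA.integrable _ _) (integrable_const _)]
    · simp
    · filter_upwards [hA.ae_abs_le _] with x hx using hΨR x hx
  have e2 : ∫ x, ∫ y, Ψ (x + Nat.sqrt L + y) ∂(A' L) ∂(A n)
      = ∫ x, ∫ y, Φ (x + Nat.sqrt L + y) ∂(A' L) ∂(A n) - Φ (-R) := by
    rw [integral_congr_ae (g := fun x => ∫ y, Φ (x + Nat.sqrt L + y) ∂(A' L) - Φ (-R)),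
      integral_sub (hA.integrable _ _) (integrable_const _)]
    · simp
    · filter_upwards [hA.ae_abs_le n] with x hx
      rw [integral_congr_ae (g := fun y => Φ (x + Nat.sqrt L + y) - Φ (-R)),
        integral_sub (hA'.integrable _ _) (integrable_const _)]
      · simp
      · filter_upwards [hA'.ae_abs_le L] with y hy
        refine hΨR _ ?_
        rw [abs_le] at *
        rw [hR]; push_cast
        constructor <;> omega
  rw [e1, e2] at key
  linarith

namespace Environment

variable {T : Type} [CommSemiring T] [LinearOrder T] {E : Environment T} {p₀ p₁ ν : ℝ}

lemma isWalkLaw_walkLaw {ρ : ℝ} (hρ : ρ ∈ E.J) : IsWalkLaw (E.walkLaw p₀ p₁ ρ) :=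
  ⟨fun n => E.isProbabilityMeasure_walkLaw hρ n, fun n => E.ae_walkLaw ρ n⟩

/-- The second half is the comparison from below. Reflection turns it into a comparison from above,
so that all later arguments are made once. -/
lemma exists_refreshes [IsStrictOrderedRing T] (hν : 0 < ν) (hdrift : E.NoDriftingIn ν)
    (hcover : E.Covering ν) (hp₀ : 0 ≤ p₀) (hp : p₀ ≤ p₁) (hp₁ : p₁ ≤ 1) :
    ∃ L₀ : ℕ, ∀ L : ℕ, L₀ ≤ L → ∀ ρ ε : ℝ, ρ ∈ E.J → ρ + ε ∈ E.J → ε < 1 →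
      (L : ℝ) ^ (-(1 / 100) : ℝ) ≤ ε →
      Refreshes (E.walkLaw p₀ p₁ ρ) (E.walkLaw p₀ p₁ (ρ + ε)) L ∧
      Refreshes (reflect (E.walkLaw p₀ p₁ (ρ + ε))) (reflect (E.walkLaw p₀ p₁ ρ)) L := by
  obtain ⟨L₀, h⟩ := E.exists_refreshError_le hν hcover
  refine ⟨L₀, fun L hL ρ ε hρ hρε hε1 hε => ⟨?_, ?_⟩⟩
  · refine refreshes_of_bounded (isWalkLaw_walkLaw hρ) (isWalkLaw_walkLaw hρε)
      fun n Φ hΦ M h0 hM => ?_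
    obtain ⟨ℓ, H, H', e, he, hcov, hH', hH, herr⟩ := h L hL ρ ε hρ hρε hε1 hε n
    exact (integral_walkLaw_le_of_covers hdrift hp₀ hp hp₁ hρ hρε he hcov hH' hH hΦ h0 hM).trans
      (add_le_add_right (mul_le_mul_of_nonneg_left herr ((h0 0).trans (hM 0))) _)
  · refine refreshes_of_bounded (isWalkLaw_walkLaw hρε).reflect (isWalkLaw_walkLaw hρ).reflect
      fun n Φ hΦ M h0 hM => ?_
    obtain ⟨ℓ, H, H', e, he, hcov, hH', hH, herr⟩ := h L hL ρ ε hρ hρε hε1 hε n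
    have := integral_walkLaw_le_of_covers' hdrift hp₀ hp hp₁ hρ hρε he hcov hH' hH
      (Φ := fun x => Φ (-x)) (fun x y hxy => hΦ (neg_le_neg hxy)) (fun x => h0 _) (fun x => hM _)
    simp only [integral_reflect]
    refine this.trans ((add_le_add_right
      (mul_le_mul_of_nonneg_left herr ((h0 0).trans (hM 0))) _).trans_eq ?_)
    simp only [refreshRate]
    congr 3
    funext x
    congr 1
    funext y
    congr 1
    ring

end Environment

/-! ### Comparison of the mean speeds at different scales -/

/-- The expectation under the `n`-th law. -/
def mean (A : ℕ → Measure ℤ) (n : ℕ) : ℝ := ∫ x, (x : ℝ) ∂(A n)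

lemma IsWalkLaw.abs_mean_le {A : ℕ → Measure ℤ} (hA : IsWalkLaw A) (n : ℕ) : |mean A n| ≤ n := by
  have := hA.prob n
  have h := norm_integral_le_of_norm_le_const (μ := A n) (f := fun x : ℤ => (x : ℝ)) (C := n) (by
    filter_upwards [hA.ae_abs_le n] with x hx
    rw [Real.norm_eq_abs]; exact_mod_cast hx)
  simpa [mean] using h

lemma Refreshes.mean_le {A A' : ℕ → Measure ℤ} (hA : IsWalkLaw A) (hA' : IsWalkLaw A') {L : ℕ}
    (h : Refreshes A A' L) (n : ℕ) :
    mean A (n + (Nat.sqrt L + L)) ≤ mean A n + (Nat.sqrt L + mean A' L)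
      + 2 * (n + (Nat.sqrt L + L) : ℕ) * refreshRate n L := by
  have := hA.prob n
  have := hA'.prob L
  have key := h n (fun x => (x : ℝ)) Int.cast_mono
  have e : ∫ x, ∫ y, ((x + Nat.sqrt L + y : ℤ) : ℝ) ∂(A' L) ∂(A n)
      = mean A n + (Nat.sqrt L + mean A' L) := by
    have e1 : ∀ x : ℤ, ∫ y, ((x + Nat.sqrt L + y : ℤ) : ℝ) ∂(A' L)
        = x + (Nat.sqrt L + mean A' L) := fun x => by
      push_cast
      rw [integral_add (integrable_const _) (hA'.integrable _ _)]
      simp [mean, add_assoc]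
    simp_rw [e1]
    rw [integral_add (hA.integrable _ _) (integrable_const _)]
    simp [mean]
  rw [e] at key
  refine key.trans (le_of_eq ?_)
  push_cast
  ring

lemma Refreshes.mean_iterate_le {A A' : ℕ → Measure ℤ} (hA : IsWalkLaw A) (hA' : IsWalkLaw A')
    {L : ℕ} (h : Refreshes A A' L) (r k N : ℕ) (hN : r + k * (Nat.sqrt L + L) ≤ N) :
    mean A (r + k * (Nat.sqrt L + L)) ≤ r + k * (Nat.sqrt L + mean A' L)
      + k * (2 * N * refreshRate N L) := by
  induction k with
  | zero => simpa using (abs_le.1 (hA.abs_mean_le r)).2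
  | succ k ih =>
    rw [Nat.succ_mul] at hN
    have h1 := ih (by omega)
    have h2 := h.mean_le hA hA' (r + k * (Nat.sqrt L + L))
    have h3 : 2 * ((r + k * (Nat.sqrt L + L) + (Nat.sqrt L + L) : ℕ) : ℝ)
        * refreshRate (r + k * (Nat.sqrt L + L)) L ≤ 2 * N * refreshRate N L := by
      have e1 : ((r + k * (Nat.sqrt L + L) + (Nat.sqrt L + L) : ℕ) : ℝ) ≤ N := by
        exact_mod_cast (by omega)
      have e2 : ((r + k * (Nat.sqrt L + L) : ℕ) : ℝ) ≤ N := by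
        exact_mod_cast (by omega)
      unfold refreshRate
      gcongr
    rw [show r + (k + 1) * (Nat.sqrt L + L) = r + k * (Nat.sqrt L + L) + (Nat.sqrt L + L) by ring]
    push_cast at h1 h2 h3 ⊢
    linarith

lemma eventually_mean_error_le :
    ∀ᶠ L : ℕ in atTop, 6 * (L : ℝ) ^ (-(1 / 2) : ℝ)
      + 4 * (L : ℝ) ^ 8 * Real.exp (-(L : ℝ) ^ (1 / 20 : ℝ)) ≤ (L : ℝ) ^ (-(1 / 100) : ℝ) := by
  have h1 : ∀ᶠ y : ℝ in atTop, 8 * (y ^ 180 * Real.exp (-y)) < 1 := by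
    have := (Real.tendsto_pow_mul_exp_neg_atTop_nhds_zero 180).const_mul 8
    rw [mul_zero] at this
    exact this.eventually_lt_const one_pos
  filter_upwards [(tendsto_natCast_rpow (a := 1 / 20) (by norm_num)).eventually h1,
    (tendsto_natCast_rpow (a := 49 / 100) (by norm_num)).eventually_ge_atTop 12,
    eventually_ge_atTop 1] with L h h' hL
  have hL1 : (1 : ℝ) ≤ L := by exact_mod_cast hL
  have hL0 : (0 : ℝ) < L := by linarith
  have e1 : ((L : ℝ) ^ (1 / 20 : ℝ)) ^ 180 = (L : ℝ) ^ 9 := by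
    rw [← Real.rpow_natCast (_ ^ _), ← Real.rpow_mul hL0.le, ← Real.rpow_natCast]
    norm_num
  rw [e1] at h
  have b1 : 12 * (L : ℝ) ^ (-(1 / 2) : ℝ) ≤ (L : ℝ) ^ (-(1 / 100) : ℝ) := by
    calc 12 * (L : ℝ) ^ (-(1 / 2) : ℝ) ≤ (L : ℝ) ^ (49 / 100 : ℝ) * (L : ℝ) ^ (-(1 / 2) : ℝ) := by
          gcongr
      _ = _ := by rw [← Real.rpow_add hL0]; norm_num
  have b2 : (L : ℝ)⁻¹ ≤ (L : ℝ) ^ (-(1 / 100) : ℝ) := by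
    rw [← Real.rpow_neg_one]
    exact Real.rpow_le_rpow_of_exponent_le hL1 (by norm_num)
  have b3 : 8 * (L : ℝ) ^ 8 * Real.exp (-(L : ℝ) ^ (1 / 20 : ℝ)) ≤ (L : ℝ)⁻¹ := by
    rw [le_inv_comm₀ (by positivity) hL0]
    rw [← one_div, le_div_iff₀ (by positivity)]
    linarith [h.le, show (L : ℝ) * (8 * (L : ℝ) ^ 8 * Real.exp (-(L : ℝ) ^ (1 / 20 : ℝ)))
      = 8 * ((L : ℝ) ^ 9 * Real.exp (-(L : ℝ) ^ (1 / 20 : ℝ))) by ring]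
  linarith

/-- Cut time into blocks of length `√L + L`. The bound `L ^ 2 ≤ N` makes the incomplete block and
the waiting times `√L` negligible, while `N ≤ L ^ 4` keeps the accumulated error a polynomial in `L`
times `exp (-L ^ (1/20))`. -/
lemma exists_mean_div_le :
    ∃ L₁ : ℕ, ∀ L : ℕ, L₁ ≤ L → ∀ N : ℕ, L ^ 2 ≤ N → N ≤ L ^ 4 → ∀ A A' : ℕ → Measure ℤ,
      IsWalkLaw A → IsWalkLaw A' → Refreshes A A' L →
        mean A N / N ≤ mean A' L / L + (L : ℝ) ^ (-(1 / 100) : ℝ) := by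
  obtain ⟨L₁, hL₁⟩ := eventually_atTop.1 (eventually_mean_error_le.and (eventually_ge_atTop 1))
  refine ⟨L₁, fun L hL N hN1 hN2 A A' hA hA' h => ?_⟩
  obtain ⟨herr, hL1⟩ := hL₁ L hL
  refine le_trans ?_ (add_le_add_right herr _)
  have hL0 : (0 : ℝ) < L := by exact_mod_cast hL1
  have hN0 : 1 ≤ N := (Nat.one_le_pow 2 L hL1).trans hN1
  have hN0' : (1 : ℝ) ≤ N := by exact_mod_cast hN0
  set t := Nat.sqrt L with ht
  set S := t + L with hS
  set k := N / S with hk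
  set r := N % S with hr
  have hdiv : r + k * S = N := by rw [hr, hk, mul_comm]; exact Nat.mod_add_div N S
  have hrS : r < S := Nat.mod_lt _ (by omega)
  have htL : t ≤ L := Nat.sqrt_le_self L
  have hkL : k * L ≤ N := (Nat.mul_le_mul_left k (by omega : L ≤ S)).trans (by omega)
  have hkN : k ≤ N := Nat.div_le_self _ _
  have key := h.mean_iterate_le hA hA' r k N hdiv.le
  rw [← ht, ← hS, hdiv] at key
  set u' := mean A' L / L with hu'
  have hmean : mean A' L = u' * L := by rw [hu']; field_simp
  have habs : |u'| ≤ 1 := by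
    rw [hu', abs_div, abs_of_pos hL0, div_le_one hL0]; exact hA'.abs_mean_le L
  have hu1 := (abs_le.1 habs).1
  have hsqrt : (t : ℝ) ≤ L ^ (1 / 2 : ℝ) := by
    rw [← Real.sqrt_eq_rpow]; exact Real.nat_sqrt_le_real_sqrt
  set s := (L : ℝ) ^ (-(1 / 2) : ℝ) with hs
  have hs0 : 0 < s := by positivity
  have hts : (t : ℝ) ≤ s * L := by
    refine hsqrt.trans_eq ?_
    rw [hs, ← Real.rpow_add_one hL0.ne']; norm_num
  have hLs : (L : ℝ) ≤ s * N := by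
    have h1 : (L : ℝ) ^ 2 ≤ N := by exact_mod_cast hN1
    have h2 : 1 ≤ s * L := by
      rw [hs, ← Real.rpow_add_one hL0.ne']
      exact Real.one_le_rpow (by exact_mod_cast hL1) (by norm_num)
    calc (L : ℝ) = 1 * L := by ring
      _ ≤ s * L * L := by gcongr
      _ = s * L ^ 2 := by ring
      _ ≤ s * N := by gcongr
  have hkt : (k : ℝ) * t ≤ s * N := by
    calc (k : ℝ) * t ≤ k * (s * L) := by gcongr
      _ = s * (k * L : ℕ) := by push_cast; ring
      _ ≤ s * N := by gcongr
  have hr2 : (r : ℝ) ≤ 2 * (s * N) := by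
    have : (r : ℝ) ≤ 2 * L := by exact_mod_cast (by omega : r ≤ 2 * L)
    linarith
  have hNe : (N : ℝ) = r + k * (t + L) := by
    rw [← hdiv, hS]; push_cast; ring
  have hNL : (N : ℝ) ≤ (L : ℝ) ^ 4 := by exact_mod_cast hN2
  have herr2 : (k : ℝ) * (2 * N * refreshRate N L)
      ≤ N * (4 * (L : ℝ) ^ 8 * Real.exp (-(L : ℝ) ^ (1 / 20 : ℝ))) := by
    unfold refreshRate
    calc (k : ℝ) * (2 * N * ((N + 1) * Real.exp (-(L : ℝ) ^ (1 / 20 : ℝ))))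
        ≤ N * (2 * L ^ 4 * ((2 * L ^ 4) * Real.exp (-(L : ℝ) ^ (1 / 20 : ℝ)))) := by
          gcongr
          linarith
      _ = _ := by ring
  rw [div_le_iff₀ (by linarith)]
  rw [hmean] at key
  have hr0 : (0 : ℝ) ≤ r := by positivity
  have hkt0 : (0 : ℝ) ≤ k * t := by positivity
  -- The lost time `r + k t` is at most `3 s N`. It counts twice, once as displacement at speed `1`
  -- and once as missing time at speed `u'`, which gives the constant `6`.
  have f1 : (r + k * t) * (-u') ≤ (r + k * t) * 1 := by
    gcongr
    linarith
  have f2 : (r : ℝ) + k * (t + u' * L) = u' * N + (r + k * t) + (r + k * t) * (-u') := by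
    rw [hNe]; ring
  rw [f2] at key
  have f3 : (u' + (6 * s + 4 * (L : ℝ) ^ 8 * Real.exp (-(L : ℝ) ^ (1 / 20 : ℝ)))) * N
      = u' * N + 6 * (s * N) + N * (4 * (L : ℝ) ^ 8 * Real.exp (-(L : ℝ) ^ (1 / 20 : ℝ))) := by
    ring
  rw [f3]
  linarith

namespace Environment

variable {T : Type} [CommSemiring T] [LinearOrder T] {E : Environment T} {p₀ p₁ ν : ℝ}

lemma abs_meanSpeed_le {ρ : ℝ} (hρ : ρ ∈ E.J) (L : ℕ) : |E.meanSpeed p₀ p₁ ρ L| ≤ 1 := by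
  rw [meanSpeed_eq, abs_div, Nat.abs_cast]
  exact div_le_one_of_le₀ ((isWalkLaw_walkLaw hρ).abs_mean_le L) (by positivity)

lemma mem_J_of_mem_Icc {ρ ρ' x : ℝ} (hρ : ρ ∈ E.J) (hρ' : ρ' ∈ E.J) (h : ρ ≤ x) (h' : x ≤ ρ') :
    x ∈ E.J := ⟨hρ.1.trans_le h, h'.trans_lt hρ'.2⟩

/-- One comparison reaches only times between `L ^ 2` and `L ^ 4`. Larger times are reached by
squaring the scale repeatedly. With `e = L ^ (-1/100)`, the sprinkling and the error become `e ^ 2`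
at scale `L ^ 2`, so their sums over scales stay below `2 e`. -/
lemma exists_meanSpeed_le [IsStrictOrderedRing T] (hν : 0 < ν) (hdrift : E.NoDriftingIn ν)
    (hcover : E.Covering ν) (hp₀ : 0 ≤ p₀) (hp : p₀ ≤ p₁) (hp₁ : p₁ ≤ 1) :
    ∃ L₁ : ℕ, ∀ L : ℕ, L₁ ≤ L → ∀ ρ ε : ℝ, ρ ∈ E.J → ρ + ε ∈ E.J → ε < 1 →
      2 * (L : ℝ) ^ (-(1 / 100) : ℝ) ≤ ε → ∀ N : ℕ, L ^ 2 ≤ N →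
        E.meanSpeed p₀ p₁ ρ N ≤ E.meanSpeed p₀ p₁ (ρ + ε) L + 2 * (L : ℝ) ^ (-(1 / 100) : ℝ) := by
  obtain ⟨L₀, hL₀⟩ := E.exists_refreshes hν hdrift hcover hp₀ hp hp₁
  obtain ⟨L₁, hL₁⟩ := exists_mean_div_le
  have step : ∀ L : ℕ, max L₀ L₁ ≤ L → ∀ ρ ε : ℝ, ρ ∈ E.J → ρ + ε ∈ E.J → ε < 1 →
      (L : ℝ) ^ (-(1 / 100) : ℝ) ≤ ε → ∀ N : ℕ, L ^ 2 ≤ N → N ≤ L ^ 4 →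
        E.meanSpeed p₀ p₁ ρ N ≤ E.meanSpeed p₀ p₁ (ρ + ε) L + (L : ℝ) ^ (-(1 / 100) : ℝ) := by
    intro L hL ρ ε hρ hρε hε1 hε N hN1 hN2
    rw [meanSpeed_eq, meanSpeed_eq]
    exact hL₁ L ((le_max_right _ _).trans hL) N hN1 hN2 _ _ (isWalkLaw_walkLaw hρ)
      (isWalkLaw_walkLaw hρε) (hL₀ L ((le_max_left _ _).trans hL) ρ ε hρ hρε hε1 hε).1
  refine ⟨max 2 (max L₀ L₁), fun L hL ρ ε hρ hρε hε1 hε N hN => ?_⟩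
  obtain ⟨d, hd⟩ : ∃ d, N ≤ L + d := ⟨N, by omega⟩
  induction d generalizing L ρ ε with
  | zero =>
    have h2 : 2 ≤ L := (le_max_left _ _).trans hL
    nlinarith
  | succ d ih =>
    have h2 : 2 ≤ L := (le_max_left _ _).trans hL
    have hL' : max L₀ L₁ ≤ L := (le_max_right _ _).trans hL
    have hLL : L < L ^ 2 := by nlinarith
    set e := (L : ℝ) ^ (-(1 / 100) : ℝ) with he
    have he0 : 0 < e := by
      have : (0 : ℝ) < L := by exact_mod_cast (by omega : 0 < L)
      positivity
    by_cases hN4 : N ≤ L ^ 4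
    · have := step L hL' ρ ε hρ hρε hε1 (by linarith) N hN hN4
      linarith
    · have he2 : ((L ^ 2 : ℕ) : ℝ) ^ (-(1 / 100) : ℝ) = e ^ 2 := by
        rw [he, ← Real.rpow_natCast (_ ^ _), ← Real.rpow_mul (by positivity)]
        push_cast
        rw [← Real.rpow_natCast (L : ℝ), ← Real.rpow_mul (by positivity)]
        norm_num
      have he3 : 2 * e ^ 2 ≤ e := by nlinarith
      -- The part `2 e²` of the sprinkling is reserved for the scales from `L ^ 2` on. As `2 e ≤ ε <
      -- 1` gives `2 e² ≤ e`, at least `e` is left for the step from `L` to `L ^ 2`.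
      have hmid : ρ + 2 * e ^ 2 ∈ E.J :=
        mem_J_of_mem_Icc hρ hρε (by nlinarith) (by linarith)
      have k1 := ih (L ^ 2) (hL.trans hLL.le) ρ (2 * e ^ 2) hρ hmid (by linarith)
        (by rw [he2]) (by
          calc (L ^ 2) ^ 2 = L ^ 4 := by ring
            _ ≤ N := by omega) (by omega)
      rw [he2] at k1
      have k2 := step L hL' (ρ + 2 * e ^ 2) (ε - 2 * e ^ 2) hmid (by rwa [add_add_sub_cancel])
        (by nlinarith) (by linarith) (L ^ 2) le_rfl (Nat.pow_le_pow_right (by omega) (by norm_num))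
      rw [add_add_sub_cancel] at k2
      linarith

end Environment

/-! ### Deviation estimates by exponential moments -/

/-- The exponential moment of the centred position. -/
def expMoment (A : ℕ → Measure ℤ) (θ v : ℝ) (n : ℕ) : ℝ :=
  ∫ x, Real.exp (θ * (x - v * n)) ∂(A n)

/-- The dominating increment is independent of the past, so the exponential splits into a product.
The error is weighted by the largest value of the exponential on the range of the walk. -/
lemma Refreshes.expMoment_le {A A' : ℕ → Measure ℤ} {L : ℕ} (h : Refreshes A A' L) {θ : ℝ}
    (hθ : 0 ≤ θ) (v : ℝ) (n : ℕ) :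
    expMoment A θ v (n + (Nat.sqrt L + L))
      ≤ expMoment A θ v n
          * ∫ y, Real.exp (θ * (y + Nat.sqrt L - v * (Nat.sqrt L + L))) ∂(A' L)
        + Real.exp (θ * ((1 + |v|) * (n + (Nat.sqrt L + L) : ℕ))) * refreshRate n L := by
  set R : ℕ := n + (Nat.sqrt L + L) with hR
  have key := h n (fun x => Real.exp (θ * (x - v * R))) fun x y hxy => by
    dsimp only
    gcongr
  have e : ∫ x, ∫ y, Real.exp (θ * (((x + Nat.sqrt L + y : ℤ) : ℝ) - v * R)) ∂(A' L) ∂(A n)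
      = expMoment A θ v n
          * ∫ y, Real.exp (θ * (y + Nat.sqrt L - v * (Nat.sqrt L + L))) ∂(A' L) := by
    rw [expMoment, ← integral_mul_const]
    congr 1
    funext x
    rw [← integral_const_mul]
    congr 1
    funext y
    rw [← Real.exp_add, hR]
    congr 1
    push_cast
    ring
  rw [e] at key
  refine key.trans (add_le_add_right (mul_le_mul_of_nonneg_right ?_ (refreshRate_nonneg n L)) _)
  have h1 : Real.exp (θ * (((R : ℤ) : ℝ) - v * R)) ≤ Real.exp (θ * ((1 + |v|) * R)) := by
    rw [Real.exp_le_exp]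
    gcongr
    have := neg_abs_le v
    have hR0 : (0 : ℝ) ≤ R := by positivity
    push_cast
    nlinarith
  have h2 := Real.exp_pos (θ * (((-(R : ℤ) : ℤ) : ℝ) - v * R))
  linarith

/-- Since `q ≤ 1`, errors made in early blocks are not amplified by later ones and simply add up. -/
lemma Refreshes.expMoment_iterate_le {A A' : ℕ → Measure ℤ} {L : ℕ} (h : Refreshes A A' L)
    {θ : ℝ} (hθ : 0 ≤ θ) (v : ℝ) {q a : ℝ} (hq0 : 0 ≤ q) (hq1 : q ≤ 1)
    (hq : ∫ y, Real.exp (θ * (y + Nat.sqrt L - v * (Nat.sqrt L + L))) ∂(A' L) ≤ q)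
    (r k N : ℕ) (ha : expMoment A θ v r ≤ a) (hN : r + k * (Nat.sqrt L + L) ≤ N) :
    expMoment A θ v (r + k * (Nat.sqrt L + L))
      ≤ q ^ k * a + k * (Real.exp (θ * ((1 + |v|) * N)) * refreshRate N L) := by
  induction k with
  | zero => simpa using ha
  | succ k ih =>
    rw [Nat.succ_mul] at hN
    have h1 := ih (by omega)
    have h2 := h.expMoment_le hθ v (r + k * (Nat.sqrt L + L))
    set n := r + k * (Nat.sqrt L + L) with hn
    have hm0 : 0 ≤ expMoment A θ v n := integral_nonneg fun _ => (Real.exp_pos _).le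
    have h3 : Real.exp (θ * ((1 + |v|) * (n + (Nat.sqrt L + L) : ℕ))) * refreshRate n L
        ≤ Real.exp (θ * ((1 + |v|) * N)) * refreshRate N L := by
      have e1 : ((n + (Nat.sqrt L + L) : ℕ) : ℝ) ≤ N := by exact_mod_cast (by omega)
      have e2 : (n : ℝ) ≤ N := by exact_mod_cast (by omega)
      unfold refreshRate
      gcongr
    set G := Real.exp (θ * ((1 + |v|) * N)) * refreshRate N L with hG
    have hG0 : 0 ≤ G := mul_nonneg (Real.exp_pos _).le (refreshRate_nonneg N L)
    rw [show r + (k + 1) * (Nat.sqrt L + L) = n + (Nat.sqrt L + L) by rw [hn]; ring]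
    calc expMoment A θ v (n + (Nat.sqrt L + L))
        ≤ expMoment A θ v n * q + G :=
          h2.trans (add_le_add (mul_le_mul_of_nonneg_left hq hm0) h3)
      _ ≤ (q ^ k * a + k * G) * q + G := by gcongr
      _ = q ^ (k + 1) * a + k * G * q + G := by ring
      _ ≤ q ^ (k + 1) * a + k * G * 1 + G := by gcongr
      _ = _ := by push_cast; ring

/-- The exponential moment of one block is bounded away from `1`. -/
lemma exists_block_expMoment_le {A' : ℕ → Measure ℤ} (hA' : IsWalkLaw A') {v w : ℝ} (hwv : w < v)
    (hw : ∀ᶠ L : ℕ in atTop, mean A' L ≤ w * L) :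
    ∃ κ c : ℝ, 0 < κ ∧ 0 < c ∧ c ≤ 1 ∧ κ * (2 + 2 * |v|) ≤ 1 ∧ ∀ᶠ L : ℕ in atTop,
      ∫ y, Real.exp (κ / L * (y + Nat.sqrt L - v * (Nat.sqrt L + L))) ∂(A' L) ≤ Real.exp (-c) := by
  set B := 2 + 2 * |v| with hB
  have hB0 : 2 ≤ B := by rw [hB]; linarith [abs_nonneg v]
  set g := min (v - w) 1 with hg
  have hg0 : 0 < g := lt_min (by linarith) one_pos
  have hg1 : g ≤ 1 := min_le_right _ _
  have hgvw : g ≤ v - w := min_le_left _ _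
  -- With `θ = κ / L`, the exponent of one block is at most `κ B ≤ 1` in absolute value and its mean
  -- is at most `-κ g / 2`. This `κ` makes the quadratic remainder `(κ B) ^ 2` equal to `κ g / 4`,
  -- half of that gain.
  set κ := g / (4 * B ^ 2) with hκ
  have hκ0 : 0 < κ := by positivity
  have hκB : κ * (4 * B ^ 2) = g := by rw [hκ]; field_simp
  have hκB1 : κ * B ≤ 1 := by nlinarith [mul_pos hκ0 (by linarith : (0 : ℝ) < B)]
  clear_value κ g B
  refine ⟨κ, κ * g / 4, hκ0, by positivity, ?_, hκB1, ?_⟩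
  · have : κ * 1 ≤ κ * B := by gcongr; linarith
    have : κ * g ≤ κ * 1 := by gcongr
    linarith
  filter_upwards [hw, eventually_ge_atTop 1,
    (tendsto_natCast_rpow (a := 1 / 2) (by norm_num)).eventually_ge_atTop (B / g)] with L hw hL hs
  have := hA'.prob L
  have hL1 : (1 : ℝ) ≤ L := by exact_mod_cast hL
  have hL0 : (0 : ℝ) < L := by linarith
  set t : ℝ := (Nat.sqrt L : ℝ) with ht
  have ht0 : 0 ≤ t := by positivity
  have htL : t ≤ L := by rw [ht]; exact_mod_cast Nat.sqrt_le_self L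
  have htg : B * t ≤ g * L := by
    have h1 : t ≤ (L : ℝ) ^ (1 / 2 : ℝ) := by
      rw [← Real.sqrt_eq_rpow]; exact Real.nat_sqrt_le_real_sqrt
    rw [div_le_iff₀ hg0] at hs
    calc B * t ≤ (L : ℝ) ^ (1 / 2 : ℝ) * g * (L : ℝ) ^ (1 / 2 : ℝ) := by gcongr
      _ = g * ((L : ℝ) ^ (1 / 2 : ℝ) * (L : ℝ) ^ (1 / 2 : ℝ)) := by ring
      _ = g * L := by rw [← Real.rpow_add hL0]; norm_num
  set Y : ℤ → ℝ := fun y => κ / L * (y + t - v * (t + L)) with hY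
  have hYb : ∀ᵐ y ∂(A' L), Real.exp (Y y) ≤ 1 + Y y + (κ * B) ^ 2 := by
    filter_upwards [hA'.ae_abs_le L] with y hy
    have hy' : |(y : ℝ)| ≤ L := by exact_mod_cast hy
    have h1 : |(y : ℝ) + t - v * (t + L)| ≤ B * L := by
      have e1 : |(y : ℝ) + t - v * (t + L)| ≤ |(y : ℝ)| + |t| + |v * (t + L)| :=
        (abs_sub _ _).trans (add_le_add_left (abs_add_le _ _) _)
      rw [abs_mul, abs_of_nonneg ht0, abs_of_nonneg (by positivity : 0 ≤ t + L)] at e1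
      have e2 : |v| * (t + L) ≤ |v| * (2 * L) := by gcongr; linarith
      rw [hB]; linarith
    have h2 : |Y y| ≤ κ * B := by
      simp only [hY]
      rw [abs_mul, abs_of_pos (by positivity)]
      calc κ / L * |(y : ℝ) + t - v * (t + L)| ≤ κ / L * (B * L) := by gcongr
        _ = κ * B := by field_simp
    have h3 := (abs_le.1 (Real.abs_exp_sub_one_sub_id_le (h2.trans hκB1))).2
    have h4 : Y y ^ 2 ≤ (κ * B) ^ 2 := by
      rw [← sq_abs]; gcongr
    linarith
  have hmeanY : ∫ y, Y y ∂(A' L) = κ / L * (mean A' L + t - v * (t + L)) := by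
    simp only [hY]
    rw [integral_const_mul, integral_sub (hA'.integrable _ _) (integrable_const _),
      integral_add (hA'.integrable _ _) (integrable_const _)]
    simp [mean]
  have hmeanY2 : ∫ y, Y y ∂(A' L) ≤ -(κ * g / 2) := by
    rw [hmeanY]
    have h1 : mean A' L + t - v * (t + L) ≤ -(g / 2 * L) := by
      have e1 : -v * t ≤ |v| * t := by gcongr; exact neg_le_abs v
      have e2 : g * L ≤ (v - w) * L := by gcongr
      rw [hB] at htg
      linarith
    calc κ / L * (mean A' L + t - v * (t + L)) ≤ κ / L * (-(g / 2 * L)) := by gcongr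
      _ = _ := by field_simp
  calc ∫ y, Real.exp (Y y) ∂(A' L) ≤ ∫ y, (1 + Y y + (κ * B) ^ 2) ∂(A' L) :=
        integral_mono_ae (hA'.integrable _ _) (hA'.integrable _ _) hYb
    _ = 1 + ∫ y, Y y ∂(A' L) + (κ * B) ^ 2 := by
        rw [integral_add (hA'.integrable _ _) (integrable_const _),
          integral_add (integrable_const _) (hA'.integrable _ _)]
        simp
    _ ≤ -(κ * g / 4) + 1 := by
        have : (κ * B) ^ 2 = κ * g / 4 := by rw [← hκB]; ring
        linarith
    _ ≤ _ := Real.add_one_le_exp _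

lemma eventually_pow_mul_exp_le (a D : ℝ) (hD : 0 ≤ D) :
    ∀ᶠ p : ℕ in atTop, D * (p : ℝ) ^ 82 * (Real.exp (a * p) * Real.exp (-(p : ℝ) ^ 2))
      ≤ Real.exp (-(p : ℝ)) := by
  have h1 : ∀ᶠ y : ℝ in atTop, D * (y ^ 82 * Real.exp (-y)) < 1 := by
    have := (Real.tendsto_pow_mul_exp_neg_atTop_nhds_zero 82).const_mul D
    rw [mul_zero] at this
    exact this.eventually_lt_const one_pos
  filter_upwards [tendsto_natCast_atTop_atTop.eventually (h1.and (eventually_ge_atTop (a + 2)))]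
    with p ⟨h, hp⟩
  have hp0 : (0 : ℝ) ≤ p := by positivity
  have h2 : Real.exp (a * p) * Real.exp (-(p : ℝ) ^ 2)
      ≤ Real.exp (-(p : ℝ)) * Real.exp (-(p : ℝ)) := by
    rw [← Real.exp_add, ← Real.exp_add, Real.exp_le_exp]
    nlinarith
  calc D * (p : ℝ) ^ 82 * (Real.exp (a * p) * Real.exp (-(p : ℝ) ^ 2))
      ≤ D * (p : ℝ) ^ 82 * (Real.exp (-(p : ℝ)) * Real.exp (-(p : ℝ))) := by gcongr
    _ = D * ((p : ℝ) ^ 82 * Real.exp (-(p : ℝ))) * Real.exp (-(p : ℝ)) := by ring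
    _ ≤ 1 * Real.exp (-(p : ℝ)) := by gcongr
    _ = _ := one_mul _

/-- A walk whose law is refreshed by one of asymptotic speed at most `w < v` exceeds the speed `v`
with stretched exponentially small probability. -/
lemma exists_measureReal_ge_le {A A' : ℕ → Measure ℤ} (hA : IsWalkLaw A) (hA' : IsWalkLaw A')
    (hR : ∀ᶠ L : ℕ in atTop, Refreshes A A' L) {v w : ℝ} (hwv : w < v)
    (hw : ∀ᶠ L : ℕ in atTop, mean A' L ≤ w * L) :
    ∃ c D : ℝ, 0 < c ∧ ∀ᶠ p : ℕ in atTop, ∀ N : ℕ, p ^ 41 ≤ N → N ≤ (2 * p) ^ 41 →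
      (A N).real {x : ℤ | v * N ≤ x} ≤ D * Real.exp (-c * p) := by
  obtain ⟨κ, c, hκ, hc, hc1, hκv, hblock⟩ := exists_block_expMoment_le hA' hwv hw
  have hpow : Tendsto (fun p : ℕ => p ^ 40) atTop atTop := tendsto_pow_atTop (by norm_num)
  set Z : ℝ := 2 ^ 41 with hZ
  set a : ℝ := κ * ((1 + |v|) * Z) with ha
  refine ⟨c / 2, Real.exp 2 + 1, by positivity, ?_⟩
  filter_upwards [hpow.eventually (hR.and hblock), eventually_ge_atTop 1,
    eventually_pow_mul_exp_le a (2 * Z ^ 2) (by positivity)] with p ⟨hRp, hbp⟩ hp1 herr N hN1 hN2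
  have := hA.prob N
  -- There are of order `p` blocks and `θ N` is of order `p`, whereas the refreshment error is of
  -- order `exp (-L ^ (1/20)) = exp (-p ^ 2)` up to powers of `p`. So the Chernoff gain is of order
  -- `exp (-c p)` and the error survives multiplication by `exp (a p)`.
  set L := p ^ 40 with hL
  have hL1 : 1 ≤ L := Nat.one_le_pow _ _ hp1
  have hL0 : (0 : ℝ) < L := by exact_mod_cast hL1
  have hp0 : (1 : ℝ) ≤ p := by exact_mod_cast hp1
  set S := Nat.sqrt L + L with hS
  have hSL : S ≤ 2 * L := by have := Nat.sqrt_le_self L; omega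
  set k := N / S with hk
  set r := N % S with hr
  have hdiv : r + k * S = N := by rw [hr, hk, mul_comm]; exact Nat.mod_add_div N S
  have hrS : r < S := Nat.mod_lt _ (by omega)
  set θ := κ / L with hθ
  have hθ0 : 0 < θ := by positivity
  -- the initial incomplete block
  have hinit : expMoment A θ v r ≤ Real.exp 1 := by
    have := hA.prob r
    have h1 : ∀ᵐ x : ℤ ∂(A r), Real.exp (θ * (x - v * r)) ≤ Real.exp 1 := by
      filter_upwards [hA.ae_abs_le r] with x hx
      have hx' : (x : ℝ) ≤ r := by exact_mod_cast (abs_le.1 hx).2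
      have hr2 : (r : ℝ) ≤ 2 * L := by exact_mod_cast (by omega : r ≤ 2 * L)
      have e1 : (x : ℝ) - v * r ≤ (2 + 2 * |v|) * L := by
        have : -v * r ≤ |v| * (2 * L) :=
          mul_le_mul (neg_le_abs v) hr2 (by positivity) (abs_nonneg v)
        linarith
      rw [Real.exp_le_exp]
      calc θ * (x - v * r) ≤ θ * ((2 + 2 * |v|) * L) := by gcongr
        _ = κ * (2 + 2 * |v|) := by rw [hθ]; field_simp
        _ ≤ 1 := hκv
    calc expMoment A θ v r ≤ ∫ _, Real.exp 1 ∂(A r) :=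
          integral_mono_ae (hA.integrable _ _) (integrable_const _) h1
      _ = Real.exp 1 := by simp
  have key := hRp.expMoment_iterate_le hθ0.le v (Real.exp_pos _).le
    (Real.exp_le_one_iff.2 (by linarith)) hbp r k N hinit hdiv.le
  rw [← hS, hdiv] at key
  have hmarkov : (A N).real {x : ℤ | v * N ≤ x} ≤ expMoment A θ v N := by
    have h1 := mul_meas_ge_le_integral_of_nonneg (μ := A N)
      (f := fun x : ℤ => Real.exp (θ * (x - v * N)))
      (Eventually.of_forall fun _ => (Real.exp_pos _).le) (hA.integrable _ _) 1
    rw [one_mul] at h1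
    refine le_trans (measureReal_mono fun x hx => ?_) h1
    simp only [mem_ofPred_eq] at hx ⊢
    exact Real.one_le_exp (mul_nonneg hθ0.le (sub_nonneg.2 hx))
  refine hmarkov.trans (key.trans ?_)
  -- A block lasts at most `2 L`, and `N ≥ p L`.
  have hkp : (p : ℝ) / 2 - 1 ≤ k := by
    have h1 : p * L ≤ N := le_trans (by rw [hL]; exact (by ring : p * p ^ 40 = p ^ 41).le) hN1
    have h2 : N < (k + 1) * S := by rw [add_mul, one_mul]; omega
    have h3 : p * L < (k + 1) * 2 * L := by
      calc p * L ≤ N := h1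
        _ < (k + 1) * S := h2
        _ ≤ (k + 1) * (2 * L) := Nat.mul_le_mul_left _ hSL
        _ = _ := by ring
    have h4 : p < (k + 1) * 2 := lt_of_mul_lt_mul_right h3 (Nat.zero_le _)
    have h5 : (p : ℝ) < (k + 1) * 2 := by exact_mod_cast h4
    linarith
  have hNp : (N : ℝ) ≤ Z * p ^ 41 := by
    have : (N : ℝ) ≤ (2 * p) ^ 41 := by exact_mod_cast hN2
    rwa [mul_pow] at this
  have hkN : (k : ℝ) ≤ N := by exact_mod_cast Nat.div_le_self _ _
  have hN0 : (1 : ℝ) ≤ N := by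
    exact_mod_cast (Nat.one_le_pow 41 p hp1).trans hN1
  have hLp : (L : ℝ) = (p : ℝ) ^ 40 := by rw [hL]; push_cast; ring
  have hL20 : (L : ℝ) ^ (1 / 20 : ℝ) = (p : ℝ) ^ 2 := by
    rw [hLp, ← Real.rpow_natCast, ← Real.rpow_mul (by positivity), ← Real.rpow_natCast]
    norm_num
  have hfirst : Real.exp (-c) ^ k * Real.exp 1 ≤ Real.exp 2 * Real.exp (-(c / 2) * p) := by
    rw [← Real.exp_nat_mul, ← Real.exp_add, ← Real.exp_add, Real.exp_le_exp]
    nlinarith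
  have hsecond : k * (Real.exp (θ * ((1 + |v|) * N)) * refreshRate N L)
      ≤ Real.exp (-(c / 2) * p) := by
    have e1 : θ * ((1 + |v|) * N) ≤ a * p := by
      calc θ * ((1 + |v|) * N) ≤ κ / L * ((1 + |v|) * (Z * p ^ 41)) := by rw [hθ]; gcongr
        _ = a * p := by rw [ha, hLp]; field_simp
    have e2 : refreshRate N L ≤ 2 * (Z * p ^ 41) * Real.exp (-(p : ℝ) ^ 2) := by
      rw [refreshRate, hL20]
      gcongr
      linarith
    calc k * (Real.exp (θ * ((1 + |v|) * N)) * refreshRate N L)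
        ≤ (Z * p ^ 41) * (Real.exp (a * p) * (2 * (Z * p ^ 41) * Real.exp (-(p : ℝ) ^ 2))) := by
          have := refreshRate_nonneg N L
          have := hkN.trans hNp
          gcongr
      _ = 2 * Z ^ 2 * (p : ℝ) ^ 82 * (Real.exp (a * p) * Real.exp (-(p : ℝ) ^ 2)) := by ring
      _ ≤ Real.exp (-(p : ℝ)) := herr
      _ ≤ _ := by rw [Real.exp_le_exp]; nlinarith
  calc _ ≤ Real.exp 2 * Real.exp (-(c / 2) * p) + Real.exp (-(c / 2) * p) :=
        add_le_add hfirst hsecond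
    _ = _ := by ring

/-! ### From fixed times to a bound uniform in time -/

lemma eventually_le_exp_div {c : ℝ} (hc : 0 < c) {D : ℝ} (hD : 0 ≤ D) :
    ∀ᶠ p : ℕ in atTop, D * Real.exp (-c * p)
      ≤ Real.exp (-((2 * p : ℝ) ^ (1 / 2 : ℝ))) * (((2 * p : ℝ) ^ 41 + 1) ^ 2)⁻¹ := by
  have h1 : ∀ᶠ y : ℝ in atTop, D * 4 * (4 / c) ^ 82 * (y ^ 82 * Real.exp (-y)) < 1 := by
    have := (Real.tendsto_pow_mul_exp_neg_atTop_nhds_zero 82).const_mul (D * 4 * (4 / c) ^ 82)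
    rw [mul_zero] at this
    exact this.eventually_lt_const one_pos
  have h2 : Tendsto (fun p : ℕ => c / 2 * (p : ℝ)) atTop atTop :=
    tendsto_natCast_atTop_atTop.const_mul_atTop (by positivity)
  filter_upwards [h2.eventually h1, eventually_ge_atTop 1,
    tendsto_natCast_atTop_atTop.eventually_ge_atTop (8 / c ^ 2)] with p h hp1 hp
  have hp0 : (1 : ℝ) ≤ p := by exact_mod_cast hp1
  have hsq : (2 * p : ℝ) ^ (1 / 2 : ℝ) ≤ c / 2 * p := by
    rw [← Real.sqrt_eq_rpow, Real.sqrt_le_left (by positivity)]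
    rw [div_le_iff₀ (by positivity)] at hp
    nlinarith
  have hpow : ((2 * p : ℝ) ^ 41 + 1) ^ 2 ≤ 4 * (2 * p : ℝ) ^ 82 := by
    have : (1 : ℝ) ≤ (2 * p : ℝ) ^ 41 := one_le_pow₀ (by linarith)
    calc ((2 * p : ℝ) ^ 41 + 1) ^ 2 ≤ (2 * (2 * p : ℝ) ^ 41) ^ 2 := by gcongr; linarith
      _ = _ := by ring
  have hexp : Real.exp (-c * p) = Real.exp (-(c / 2 * p)) * Real.exp (-(c / 2 * p)) := by
    rw [← Real.exp_add]; congr 1; ring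
  rw [← div_eq_mul_inv, le_div_iff₀ (by positivity), hexp]
  have e : D * 4 * (4 / c) ^ 82 * ((c / 2 * p) ^ 82 * Real.exp (-(c / 2 * p)))
      = D * (4 * (2 * p : ℝ) ^ 82) * Real.exp (-(c / 2 * p)) := by
    have : (4 / c) ^ 82 * (c / 2 * p) ^ 82 = (2 * p : ℝ) ^ 82 := by
      rw [← mul_pow]; congr 1; field_simp; norm_num
    rw [← this]; ring
  rw [e] at h
  calc D * (Real.exp (-(c / 2 * p)) * Real.exp (-(c / 2 * p))) * ((2 * p : ℝ) ^ 41 + 1) ^ 2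
      ≤ D * (Real.exp (-(c / 2 * p)) * Real.exp (-(c / 2 * p))) * (4 * (2 * p : ℝ) ^ 82) := by
        gcongr
    _ = D * (4 * (2 * p : ℝ) ^ 82) * Real.exp (-(c / 2 * p)) * Real.exp (-(c / 2 * p)) := by ring
    _ ≤ 1 * Real.exp (-(c / 2 * p)) := by gcongr
    _ ≤ _ := by
        rw [one_mul, Real.exp_le_exp]
        linarith

/-- Used with `y = 2 p` and `x = N`: the exponent `1/82` is half of `1/41`. The factor `(x + 1) ^
(-2)` is kept aside to sum over times. -/
lemma exp_mul_inv_le {x y : ℝ} (hx : 0 ≤ x) (hy : 0 ≤ y) (h : x ≤ y ^ 41) :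
    Real.exp (-(y ^ (1 / 2 : ℝ))) * ((y ^ 41 + 1) ^ 2)⁻¹
      ≤ Real.exp (-(x ^ (1 / 82 : ℝ))) * ((x + 1) ^ 2)⁻¹ := by
  have h1 : x ^ (1 / 82 : ℝ) ≤ y ^ (1 / 2 : ℝ) := by
    refine (Real.rpow_le_rpow hx h (by norm_num)).trans_eq ?_
    rw [← Real.rpow_natCast, ← Real.rpow_mul hy]
    norm_num
  gcongr

/-- From bounds along `p ^ 41 ≤ N ≤ (2 p) ^ 41` to a summable bound. -/
lemma eventually_le_of_root_bound {P : ℕ → ℝ} {c D : ℝ} (hc : 0 < c)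
    (h : ∀ᶠ p : ℕ in atTop, ∀ N : ℕ, p ^ 41 ≤ N → N ≤ (2 * p) ^ 41 →
      P N ≤ D * Real.exp (-c * p)) :
    ∀ᶠ N : ℕ in atTop,
      P N ≤ Real.exp (-((N : ℝ) ^ (1 / 82 : ℝ))) * (((N : ℝ) + 1) ^ 2)⁻¹ := by
  obtain ⟨p₀, hp₀⟩ := eventually_atTop.1
    (h.and (eventually_le_exp_div hc (abs_nonneg D)))
  filter_upwards [eventually_ge_atTop ((p₀ + 1) ^ 41)] with N hN
  obtain ⟨p, h1, h2⟩ : ∃ p : ℕ, p ^ 41 ≤ N ∧ N < (p + 1) ^ 41 :=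
    ⟨Nat.nthRoot 41 N, Nat.pow_nthRoot_le (Or.inl (by norm_num)),
      Nat.lt_pow_nthRoot_add_one (by norm_num) N⟩
  have h3 : p₀ + 1 ≤ p :=
    Nat.lt_succ_iff.1 (lt_of_pow_lt_pow_left₀ 41 (Nat.zero_le _) (hN.trans_lt h2))
  have h3' : p + 1 ≤ 2 * p := by 
    rw [two_mul]; exact Nat.add_le_add_left ((Nat.le_add_left 1 p₀).trans h3) p
  have h4 : N ≤ (2 * p) ^ 41 := h2.le.trans (Nat.pow_le_pow_left h3' _)
  obtain ⟨k1, k2⟩ := hp₀ p (Nat.le_of_succ_le h3)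
  have h4' : (N : ℝ) ≤ (2 * p : ℝ) ^ 41 := by
    have := (Nat.cast_le (α := ℝ)).2 h4
    rwa [Nat.cast_pow, Nat.cast_mul, Nat.cast_ofNat] at this
  have h7 : D * Real.exp (-c * p) ≤ |D| * Real.exp (-c * p) :=
    mul_le_mul_of_nonneg_right (le_abs_self D) (Real.exp_pos _).le
  exact ((k1 N h1 h4).trans (h7.trans k2)).trans
    (exp_mul_inv_le (Nat.cast_nonneg N) (mul_nonneg zero_le_two (Nat.cast_nonneg p)) h4')

/-- The room between `1/1000` and `1/82` absorbs all constants, because `1/1000 + 1/100 < 1/82`. The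
rate can thus be taken equal to `1`. -/
lemma eventually_mul_exp_le_two_mul_exp {B : ℝ} (hB : 0 < B) (D : ℝ) :
    ∀ᶠ K : ℕ in atTop, Real.exp (-((K / B : ℝ) ^ (1 / 82 : ℝ))) * D
      ≤ 2 * Real.exp (-1 * (K : ℝ) ^ (1 / 1000 : ℝ)) := by
  filter_upwards [(tendsto_natCast_rpow (a := 1 / 100) (by norm_num)).eventually_ge_atTop
    (B ^ (1 / 82 : ℝ) * (1 + |D|)), eventually_ge_atTop 1] with K h hK
  have hK1 : (1 : ℝ) ≤ K := by exact_mod_cast hK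
  have hK0 : (0 : ℝ) < K := by linarith
  set z := (K : ℝ) ^ (1 / 1000 : ℝ) with hz
  have hz1 : 1 ≤ z := Real.one_le_rpow hK1 (by norm_num)
  have hB' : 0 < B ^ (1 / 82 : ℝ) := by positivity
  have h1 : z + |D| ≤ (K / B : ℝ) ^ (1 / 82 : ℝ) := by
    rw [Real.div_rpow hK0.le hB.le, le_div_iff₀ hB']
    calc (z + |D|) * B ^ (1 / 82 : ℝ) ≤ (z + z * |D|) * B ^ (1 / 82 : ℝ) := by
          gcongr
          exact le_mul_of_one_le_left (abs_nonneg D) hz1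
      _ = z * (B ^ (1 / 82 : ℝ) * (1 + |D|)) := by ring
      _ ≤ z * (K : ℝ) ^ (1 / 100 : ℝ) := by gcongr
      _ = (K : ℝ) ^ (1 / 1000 + 1 / 100 : ℝ) := by rw [hz, Real.rpow_add hK0]
      _ ≤ _ := Real.rpow_le_rpow_of_exponent_le hK1 (by norm_num)
  have h2 : D ≤ Real.exp |D| := by
    have := Real.add_one_le_exp |D|
    have := le_abs_self D
    linarith
  calc Real.exp (-((K / B : ℝ) ^ (1 / 82 : ℝ))) * D
      ≤ Real.exp (-((K / B : ℝ) ^ (1 / 82 : ℝ))) * Real.exp |D| := by gcongr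
    _ ≤ Real.exp (-(z + |D|)) * Real.exp |D| := by gcongr
    _ = Real.exp (-1 * z) := by rw [← Real.exp_add]; congr 1; ring
    _ ≤ _ := by linarith [Real.exp_pos (-1 * z)]

lemma measureReal_iUnion_le_of_summable {Ω : Type*} [MeasurableSpace Ω] {m : Measure Ω}
    [IsFiniteMeasure m] {s : ℕ → Set Ω} {f : ℕ → ℝ} (hf : Summable f)
    (h : ∀ n, m.real (s n) ≤ f n) : m.real (⋃ n, s n) ≤ ∑' n, f n := by
  have h0 : ∀ n, 0 ≤ f n := fun n => measureReal_nonneg.trans (h n)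
  refine ENNReal.toReal_le_of_le_ofReal (tsum_nonneg h0) ?_
  rw [ENNReal.ofReal_tsum_of_nonneg h0 hf]
  refine (measure_iUnion_le s).trans (ENNReal.tsum_le_tsum fun n => ?_)
  rw [← ofReal_measureReal]
  exact ENNReal.ofReal_le_ofReal (h n)

/-- The probability that a walk ever exceeds the line of slope `v` by `K`. -/
lemma exists_measureReal_exists_le {Ω : Type*} [MeasurableSpace Ω] {m : Measure Ω}
    [IsProbabilityMeasure m] {X : ℕ → Ω → ℤ} (hX : ∀ n, Measurable (X n))
    (hXn : ∀ n ω, |X n ω| ≤ (n : ℤ)) {A A' : ℕ → Measure ℤ} (hAX : ∀ n, A n = m.map (X n))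
    (hA : IsWalkLaw A) (hA' : IsWalkLaw A') (hR : ∀ᶠ L : ℕ in atTop, Refreshes A A' L) {v w : ℝ}
    (hwv : w < v) (hw : ∀ᶠ L : ℕ in atTop, mean A' L ≤ w * L) :
    ∃ K₀ : ℕ, ∀ K : ℕ, K₀ ≤ K →
      m.real {ω | ∃ n : ℕ, (n * v + K : ℝ) < X n ω}
        ≤ 2 * Real.exp (-1 * (K : ℝ) ^ (1 / 1000 : ℝ)) := by
  obtain ⟨c, D, hc, hp⟩ := exists_measureReal_ge_le hA hA' hR hwv hw
  obtain ⟨N₀, hN₀⟩ := eventually_atTop.1 (eventually_le_of_root_bound hc hp)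
  set B := 1 + |v| with hB
  have hB0 : 0 < B := by positivity
  have hsum : Summable fun n : ℕ => (((n : ℝ) + 1) ^ 2)⁻¹ := by
    have := (summable_nat_add_iff 1).2 (Real.summable_nat_pow_inv.2 (by norm_num : 1 < 2))
    simpa using this
  obtain ⟨K₀, hK₀⟩ := eventually_atTop.1 ((eventually_mul_exp_le_two_mul_exp hB0
    (∑' n : ℕ, (((n : ℝ) + 1) ^ 2)⁻¹)).and
    (tendsto_natCast_atTop_atTop.eventually_ge_atTop (B * N₀)))
  refine ⟨K₀, fun K hK => ?_⟩
  obtain ⟨h1, h2⟩ := hK₀ K hK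
  refine le_trans ?_ h1
  have hset : {ω | ∃ n : ℕ, (n * v + K : ℝ) < X n ω}
      = ⋃ n : ℕ, {ω | (n * v + K : ℝ) < X n ω} := by ext; simp
  rw [hset, ← tsum_mul_left]
  refine measureReal_iUnion_le_of_summable (hsum.mul_left _) fun n => ?_
  -- At early times the event is empty because `|X n| ≤ n`. At later times `n > K / B`, so the
  -- stretched exponential in `n` is at most the one in `K / B`, and the inverse square remains for
  -- the sum.
  by_cases hn : (n : ℝ) * B ≤ K
  · have : {ω | (n * v + K : ℝ) < X n ω} = ∅ := by
      ext ω
      simp only [mem_ofPred_eq, mem_empty_iff_false, iff_false, not_lt]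
      have e1 : ((X n ω : ℤ) : ℝ) ≤ n := by exact_mod_cast (abs_le.1 (hXn n ω)).2
      have e2 : (n : ℝ) * (-|v|) ≤ n * v := by gcongr; exact neg_abs_le v
      rw [hB] at hn
      linarith
    rw [this, measureReal_empty]
    positivity
  · rw [not_le] at hn
    have hKn : (K : ℝ) / B ≤ n := by rw [div_le_iff₀ hB0]; exact hn.le
    have hnN : N₀ ≤ n := by
      have : (N₀ : ℝ) ≤ n := by
        rw [← le_div_iff₀' hB0] at h2
        exact h2.trans hKn
      exact_mod_cast this
    have h3 : m.real {ω | (n * v + K : ℝ) < X n ω} ≤ (A n).real {x : ℤ | v * n ≤ x} := by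
      rw [hAX, map_measureReal_apply (hX n) MeasurableSet.of_discrete]
      refine measureReal_mono fun ω hω => ?_
      simp only [mem_ofPred_eq, mem_preimage] at *
      have : (0 : ℝ) ≤ K := by positivity
      linarith
    refine (h3.trans (hN₀ n hnN)).trans ?_
    gcongr

/-! ### Existence of the speed at a dense set of densities, and its one-sided limits -/

namespace Environment

variable {T : Type} [CommSemiring T] [LinearOrder T] {E : Environment T} {p₀ p₁ ν : ℝ}

lemma eventually_rpow_neg_le {ε : ℝ} (hε : 0 < ε) :
    ∀ᶠ L : ℕ in atTop, (L : ℝ) ^ (-(1 / 100) : ℝ) ≤ ε :=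
  ((tendsto_rpow_neg_atTop (by norm_num)).comp tendsto_natCast_atTop_atTop).eventually_le_const hε

lemma isBoundedUnder_le_meanSpeed {ρ : ℝ} (hρ : ρ ∈ E.J) :
    IsBoundedUnder (· ≤ ·) atTop (E.meanSpeed p₀ p₁ ρ) :=
  isBoundedUnder_of ⟨1, fun L => (abs_le.1 (abs_meanSpeed_le hρ L)).2⟩

lemma isBoundedUnder_ge_meanSpeed {ρ : ℝ} (hρ : ρ ∈ E.J) :
    IsBoundedUnder (· ≥ ·) atTop (E.meanSpeed p₀ p₁ ρ) :=
  isBoundedUnder_of ⟨-1, fun L => (abs_le.1 (abs_meanSpeed_le hρ L)).1⟩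

/-- The lower speed, which is defined at all densities. -/
def liminfSpeed (E : Environment T) (p₀ p₁ ρ : ℝ) : ℝ := liminf (E.meanSpeed p₀ p₁ ρ) atTop

/-- The limsup of the mean speeds at `ρ` is at most their liminf at any larger density. -/
def SpeedsOrdered (E : Environment T) (p₀ p₁ : ℝ) : Prop :=
  ∀ ρ ρ' : ℝ, ρ ∈ E.J → ρ' ∈ E.J → ρ < ρ' → ρ' < ρ + 1 →
    limsup (E.meanSpeed p₀ p₁ ρ) atTop ≤ E.liminfSpeed p₀ p₁ ρ'

/-- For a fixed gap `ρ' - ρ`, let `N → ∞` and then `L → ∞` in `exists_meanSpeed_le`: the required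
sprinkling eventually drops below the gap, and the error below `δ`. -/
lemma speedsOrdered [IsStrictOrderedRing T] (hν : 0 < ν) (hdrift : E.NoDriftingIn ν)
    (hcover : E.Covering ν) (hp₀ : 0 ≤ p₀) (hp : p₀ ≤ p₁) (hp₁ : p₁ ≤ 1) :
    E.SpeedsOrdered p₀ p₁ := by
  intro ρ ρ' hρ hρ' hlt h1
  obtain ⟨L₁, hL₁⟩ := E.exists_meanSpeed_le hν hdrift hcover hp₀ hp hp₁
  refine le_of_forall_pos_sub_le fun δ hδ => ?_
  refine le_liminf_of_le (isBoundedUnder_le_meanSpeed hρ').isCoboundedUnder_ge ?_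
  filter_upwards [eventually_ge_atTop L₁,
    eventually_rpow_neg_le (half_pos (lt_min hδ (sub_pos.2 hlt)))] with L hL hLε
  have h2 : 2 * (L : ℝ) ^ (-(1 / 100) : ℝ) ≤ min δ (ρ' - ρ) := by linarith
  have key : limsup (E.meanSpeed p₀ p₁ ρ) atTop ≤ E.meanSpeed p₀ p₁ ρ' L + δ := by
    refine limsup_le_of_le (isBoundedUnder_ge_meanSpeed hρ).isCoboundedUnder_le ?_
    filter_upwards [eventually_ge_atTop (L ^ 2)] with N hN
    have := hL₁ L hL ρ (ρ' - ρ) hρ (by rwa [add_sub_cancel]) (by linarith)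
      (h2.trans (min_le_right _ _)) N hN
    rw [add_sub_cancel] at this
    linarith [h2.trans (min_le_left _ _)]
  linarith

lemma speed_eq_liminfSpeed {ρ : ℝ} (hρ : ρ ∈ E.regularDensities p₀ p₁) :
    E.speed p₀ p₁ ρ = E.liminfSpeed p₀ p₁ ρ := by
  obtain ⟨-, v, hv⟩ := hρ
  rw [speed, liminfSpeed, hv.limUnder_eq, hv.liminf_eq]

lemma tendsto_meanSpeed {ρ : ℝ} (hρ : ρ ∈ E.regularDensities p₀ p₁) :
    Tendsto (E.meanSpeed p₀ p₁ ρ) atTop (𝓝 (E.speed p₀ p₁ ρ)) :=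
  tendsto_nhds_limUnder hρ.2

lemma SpeedsOrdered.monotoneOn (h : E.SpeedsOrdered p₀ p₁) {s : Set ℝ} (hs : s ⊆ E.J)
    (hs1 : ∀ x ∈ s, ∀ y ∈ s, y < x + 1) : MonotoneOn (E.liminfSpeed p₀ p₁) s := by
  intro x hx y hy hxy
  rcases hxy.eq_or_lt with rfl | hlt
  · exact le_rfl
  · exact (liminf_le_limsup (isBoundedUnder_le_meanSpeed (hs hx))
      (isBoundedUnder_ge_meanSpeed (hs hx))).trans (h x y (hs hx) (hs hy) hlt (hs1 x hx y hy))

/-- Regular densities are dense. -/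
lemma SpeedsOrdered.exists_regular_between (h : E.SpeedsOrdered p₀ p₁) {a b : ℝ} (hab : a < b)
    (hs : Ioo a b ⊆ E.J) (hba : b < a + 1) : ∃ x ∈ E.regularDensities p₀ p₁, a < x ∧ x < b := by
  have hmono : MonotoneOn (E.liminfSpeed p₀ p₁) (Ioo a b) :=
    h.monotoneOn hs fun x hx y hy => by linarith [hx.1, hy.2]
  -- A monotone function has countably many discontinuities, so its continuity points are dense.
  obtain ⟨x, hx, hxab⟩ :=
    (hmono.countable_not_continuousWithinAt.dense_compl ℝ).exists_between hab
  refine ⟨x, ⟨hs hxab, E.liminfSpeed p₀ p₁ x, ?_⟩, hxab⟩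
  have hcont : ContinuousAt (E.liminfSpeed p₀ p₁) x := by
    have : ContinuousWithinAt (E.liminfSpeed p₀ p₁) (Ioo a b) x := by
      by_contra hc
      exact hx ⟨hxab, hc⟩
    exact this.continuousAt (Ioo_mem_nhds hxab.1 hxab.2)
  refine tendsto_of_le_liminf_of_limsup_le le_rfl ?_ (isBoundedUnder_le_meanSpeed (hs hxab))
    (isBoundedUnder_ge_meanSpeed (hs hxab))
  -- The limsup at `x` is at most the liminf at every `y > x` in the interval. As `y` decreases to
  -- `x`, continuity gives the liminf at `x` itself.
  refine ge_of_tendsto (hcont.tendsto.mono_left (nhdsWithin_le_nhds (s := Ioi x))) ?_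
  filter_upwards [Ioo_mem_nhdsGT hxab.2] with y hy
  exact h x y (hs hxab) (hs ⟨hxab.1.trans hy.1, hy.2⟩) hy.1 (by linarith [hy.2, hxab.1])

/-- The left limit is that of the monotone function `liminfSpeed`, which agrees with the speed at
regular densities; these accumulate at `ρ` because they are dense. The interval is kept shorter than
`1` since the speeds are compared only over gaps below `1`. -/
lemma SpeedsOrdered.exists_isLowerSpeed (h : E.SpeedsOrdered p₀ p₁) {ρ : ℝ} (hρ : ρ ∈ E.J) :
    ∃ v, E.IsLowerSpeed p₀ p₁ ρ v := by
  set a := max E.lo (ρ - 1 / 2) with ha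
  have haρ : a < ρ := max_lt hρ.1 (by linarith)
  have hlo : E.lo ≤ a := le_max_left _ _
  have ha2 : ρ - 1 / 2 ≤ a := le_max_right _ _
  have hJ : Ioo a ρ ⊆ E.J := fun x hx => ⟨hlo.trans_lt hx.1, hx.2.trans hρ.2⟩
  have hmono : MonotoneOn (E.liminfSpeed p₀ p₁) (Ioo a ρ) :=
    h.monotoneOn hJ fun x hx y hy => by linarith [hx.1, hy.2]
  have hbdd : BddAbove (E.liminfSpeed p₀ p₁ '' Ioo a ρ) := by
    refine ⟨1, ?_⟩
    rintro _ ⟨x, hx, rfl⟩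
    exact liminf_le_of_le (isBoundedUnder_ge_meanSpeed (hJ hx)) fun b hb => by
      obtain ⟨L, hL⟩ := hb.exists
      exact hL.trans (abs_le.1 (abs_meanSpeed_le (hJ hx) L)).2
  have hlim := hmono.tendsto_nhdsWithin_Ioo_left (nonempty_Ioo.2 haρ) hbdd
  refine ⟨sSup (E.liminfSpeed p₀ p₁ '' Ioo a ρ), mem_closure_iff_nhdsWithin_neBot.1 ?_, ?_⟩
  · rw [Metric.mem_closure_iff]
    intro δ hδ
    have hlt : max a (ρ - δ) < ρ := max_lt haρ (by linarith)
    obtain ⟨x, hx, hx1, hx2⟩ := h.exists_regular_between hlt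
      (fun x hx => hJ ⟨(le_max_left _ _).trans_lt hx.1, hx.2⟩)
      (by linarith [le_max_left a (ρ - δ)])
    refine ⟨x, ⟨hx, hx2⟩, ?_⟩
    rw [Real.dist_eq, abs_of_pos (sub_pos.2 hx2)]
    linarith [(le_max_right a (ρ - δ)).trans_lt hx1]
  · refine (hlim.mono_left (nhdsWithin_mono _ inter_subset_right)).congr' ?_
    filter_upwards [self_mem_nhdsWithin] with x hx
    exact (speed_eq_liminfSpeed hx.1).symm

lemma SpeedsOrdered.exists_isUpperSpeed (h : E.SpeedsOrdered p₀ p₁) {ρ : ℝ} (hρ : ρ ∈ E.J) :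
    ∃ v, E.IsUpperSpeed p₀ p₁ ρ v := by
  set b := min E.hi (ρ + 1 / 2) with hb
  have hρb : ρ < b := lt_min hρ.2 (by linarith)
  have hhi : b ≤ E.hi := min_le_left _ _
  have hb2 : b ≤ ρ + 1 / 2 := min_le_right _ _
  have hJ : Ioo ρ b ⊆ E.J := fun x hx => ⟨hρ.1.trans hx.1, hx.2.trans_le hhi⟩
  have hmono : MonotoneOn (E.liminfSpeed p₀ p₁) (Ioo ρ b) :=
    h.monotoneOn hJ fun x hx y hy => by linarith [hx.1, hy.2]
  have hbdd : BddBelow (E.liminfSpeed p₀ p₁ '' Ioo ρ b) := by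
    refine ⟨-1, ?_⟩
    rintro _ ⟨x, hx, rfl⟩
    exact le_liminf_of_le (isBoundedUnder_le_meanSpeed (hJ hx)).isCoboundedUnder_ge
      (Eventually.of_forall fun L => (abs_le.1 (abs_meanSpeed_le (hJ hx) L)).1)
  have hlim := hmono.tendsto_nhdsWithin_Ioo_right (nonempty_Ioo.2 hρb) hbdd
  refine ⟨sInf (E.liminfSpeed p₀ p₁ '' Ioo ρ b), mem_closure_iff_nhdsWithin_neBot.1 ?_, ?_⟩
  · rw [Metric.mem_closure_iff]
    intro δ hδ
    have hlt : ρ < min b (ρ + δ) := lt_min hρb (by linarith)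
    obtain ⟨x, hx, hx1, hx2⟩ := h.exists_regular_between hlt
      (fun x hx => hJ ⟨hx.1, hx.2.trans_le (min_le_left _ _)⟩)
      (by linarith [min_le_left b (ρ + δ)])
    refine ⟨x, ⟨hx, hx1⟩, ?_⟩
    rw [dist_comm, Real.dist_eq, abs_of_pos (sub_pos.2 hx1)]
    linarith [hx2.trans_le (min_le_right b (ρ + δ))]
  · refine (hlim.mono_left (nhdsWithin_mono _ inter_subset_right)).congr' ?_
    filter_upwards [self_mem_nhdsWithin] with x hx
    exact (speed_eq_liminfSpeed hx.1).symm

lemma eventually_mean_le_of_speed_lt {ρ w : ℝ} (hρ : ρ ∈ E.regularDensities p₀ p₁)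
    (hw : E.speed p₀ p₁ ρ < w) : ∀ᶠ L : ℕ in atTop, mean (E.walkLaw p₀ p₁ ρ) L ≤ w * L := by
  filter_upwards [(tendsto_meanSpeed hρ).eventually_lt_const hw, eventually_ge_atTop 1] with L h hL
  have hL0 : (0 : ℝ) < L := by exact_mod_cast hL
  rw [meanSpeed_eq, div_lt_iff₀ hL0] at h
  exact h.le

lemma mean_reflect (A : ℕ → Measure ℤ) (n : ℕ) : mean (reflect A) n = -mean A n := by
  rw [mean, integral_reflect, mean, ← integral_neg]
  simp

lemma eventually_mean_reflect_le_of_lt_speed {ρ w : ℝ} (hρ : ρ ∈ E.regularDensities p₀ p₁)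
    (hw : w < E.speed p₀ p₁ ρ) :
    ∀ᶠ L : ℕ in atTop, mean (reflect (E.walkLaw p₀ p₁ ρ)) L ≤ -w * L := by
  filter_upwards [(tendsto_meanSpeed hρ).eventually_const_lt hw, eventually_ge_atTop 1] with L h hL
  have hL0 : (0 : ℝ) < L := by exact_mod_cast hL
  rw [meanSpeed_eq, lt_div_iff₀ hL0] at h
  rw [mean_reflect]
  have : w * L < mean (E.walkLaw p₀ p₁ ρ) L := h
  linarith

end Environment

end

end RWDRE

/-! ### The two deviation bounds -/

open RWDRE RWDRE.Environment

theorem corollary4p3 {T : Type} [CommSemiring T] [LinearOrder T] [IsStrictOrderedRing T]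
    [CanonicallyOrderedAdd T] (E : RWDRE.Environment T)
    (ν : ℝ) (hν : 0 < ν) (hdrift : E.NoDriftingIn ν) (hcover : E.Covering ν)
    (p₀ p₁ : ℝ) (hp₀ : 0 ≤ p₀) (hp : p₀ < p₁) (hp₁ : p₁ ≤ 1)
    (ρ : ℝ) (hρ : ρ ∈ E.J) :
    ∃ vminus vplus : ℝ,
      E.IsLowerSpeed p₀ p₁ ρ vminus ∧ E.IsUpperSpeed p₀ p₁ ρ vplus ∧
      (∀ v ∈ Set.Ioo 0 vminus, ∃ c : ℝ, 0 < c ∧ ∃ K₀ : ℕ, ∀ K : ℕ, K₀ ≤ K →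
        (E.annealed ρ).real {ω | ∃ n : ℕ, (RWDRE.walk p₀ p₁ ω.1 ω.2 n : ℝ) < n * v - K}
          ≤ 2 * Real.exp (-c * (K : ℝ) ^ (1 / 1000 : ℝ))) ∧
      (∀ v ∈ Set.Ioo vplus 1, ∃ c : ℝ, 0 < c ∧ ∃ K₀ : ℕ, ∀ K : ℕ, K₀ ≤ K →
        (E.annealed ρ).real {ω | ∃ n : ℕ, (n * v + K : ℝ) < RWDRE.walk p₀ p₁ ω.1 ω.2 n}
          ≤ 2 * Real.exp (-c * (K : ℝ) ^ (1 / 1000 : ℝ))) := by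
  have hord := E.speedsOrdered hν hdrift hcover hp₀ hp.le hp₁
  obtain ⟨L₀, hL₀⟩ := E.exists_refreshes hν hdrift hcover hp₀ hp.le hp₁
  obtain ⟨vminus, hminus⟩ := hord.exists_isLowerSpeed hρ
  obtain ⟨vplus, hplus⟩ := hord.exists_isUpperSpeed hρ
  have := E.isProbabilityMeasure_annealed hρ
  refine ⟨vminus, vplus, hminus, hplus, fun v hv => ⟨1, one_pos, ?_⟩,
    fun v hv => ⟨1, one_pos, ?_⟩⟩
  · have := hminus.1
    -- A regular density strictly below `ρ`, within distance `1`, whose speed still exceeds `v`.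
    -- Being fixed, the gap `ρ - ρ'` is an admissible sprinkling at every large scale.
    obtain ⟨ρ', ⟨hρ'v, hρ'⟩, hρ'1⟩ := (((hminus.2.eventually_const_lt hv.2).and
      self_mem_nhdsWithin).and
        (nhdsWithin_le_nhds (Ioi_mem_nhds (show ρ - 1 < ρ by linarith)))).exists
    obtain ⟨w, hvw, hwρ'⟩ := exists_between hρ'v
    have hlt : ρ' < ρ := hρ'.2
    have hR : ∀ᶠ L : ℕ in atTop,
        Refreshes (reflect (E.walkLaw p₀ p₁ ρ)) (reflect (E.walkLaw p₀ p₁ ρ')) L := by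
      filter_upwards [eventually_ge_atTop L₀, eventually_rpow_neg_le (sub_pos.2 hlt)] with L h1 h2
      have h3 := (hL₀ L h1 ρ' (ρ - ρ') hρ'.1.1 (by rwa [add_sub_cancel])
        (by linarith [hρ'1]) h2).2
      rwa [add_sub_cancel] at h3
    -- Falling below the line of slope `v` by `K` means that the reflected walk exceeds the line of
    -- slope `-v` by `K`.
    obtain ⟨K₀, hK₀⟩ := exists_measureReal_exists_le (m := E.annealed ρ) (v := -v) (w := -w)
      (X := fun n ω => -walk p₀ p₁ ω.1 ω.2 n) (fun n => (measurable_walk n).neg)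
      (fun n ω => by rw [abs_neg]; exact abs_walk_le _ _ n)
      (fun n => by
        rw [reflect, walkLaw, Measure.map_map (measurable_of_countable _) (measurable_walk n)]
        rfl)
      (isWalkLaw_walkLaw hρ).reflect (isWalkLaw_walkLaw hρ'.1.1).reflect hR (by linarith)
      (eventually_mean_reflect_le_of_lt_speed hρ'.1 hwρ')
    refine ⟨K₀, fun K hK => le_trans (measureReal_mono ?_) (hK₀ K hK)⟩
    rintro ω ⟨n, hn⟩
    refine ⟨n, ?_⟩
    push_cast
    linarith
  · have := hplus.1
    -- Now the regular density is taken strictly above `ρ`, with speed still below `v`, and no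
    -- reflection is needed.
    obtain ⟨ρ', ⟨hρ'v, hρ'⟩, hρ'1⟩ := (((hplus.2.eventually_lt_const hv.1).and
      self_mem_nhdsWithin).and
        (nhdsWithin_le_nhds (Iio_mem_nhds (show ρ < ρ + 1 by linarith)))).exists
    obtain ⟨w, hwρ', hvw⟩ := exists_between hρ'v
    have hlt : ρ < ρ' := hρ'.2
    have hR : ∀ᶠ L : ℕ in atTop, Refreshes (E.walkLaw p₀ p₁ ρ) (E.walkLaw p₀ p₁ ρ') L := by
      filter_upwards [eventually_ge_atTop L₀, eventually_rpow_neg_le (sub_pos.2 hlt)] with L h1 h2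
      have h3 := (hL₀ L h1 ρ (ρ' - ρ) hρ (by rw [add_sub_cancel]; exact hρ'.1.1)
        (by linarith [hρ'1]) h2).1
      rwa [add_sub_cancel] at h3
    exact exists_measureReal_exists_le (m := E.annealed ρ)
      (X := fun n ω => walk p₀ p₁ ω.1 ω.2 n) (fun n => measurable_walk n)
      (fun n ω => abs_walk_le _ _ n) (fun n => rfl)
      (isWalkLaw_walkLaw hρ) (isWalkLaw_walkLaw hρ'.1.1) hR hvw
      (eventually_mean_le_of_speed_lt hρ'.1 hwρ')
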